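/- Let $S$ be a scheme and let $\mathrm{Sch}_S$ be the category of all $S$-schemes. **Normally framed correspondences.** For $X,Y\in\mathrm{Sch}_S$ and $n\ge 0$, a *normally framed correspondence of level $n$* from $X$ to $Y$ consists of a span $X\xleftarrow{f}Z\xrightarrow{h}Y$ over $S$ with $f$ finite and syntomic (flat, locally of finite presentation, with local complete intersection fibers), a closed immersion $i\colon Z\hookrightarrow\mathbb A^n_X$ over $X$, and a trivialization $\tau\colon\mathcal O_Z^n\simeq\mathcal N_i$ of the conormal sheaf of $i$. Let $\mathrm{Corr}^{\mathrm{nfr},n}_S(X,Y)$ be the set of isomorphism classes of such data. Composing $i$ with the embedding $\mathbb A^n_X\hookrightarrow\mathbb A^{n+1}_X$, $x\mapsto(x,0)$, and completing $\tau$ by the class of the last coordinate gives suspension maps $\mathrm{Corr}^{\mathrm{nfr},n}_S(X,Y)\to\mathrm{Corr}^{\mathrm{nfr},n+1}_S(X,Y)$, and $h^{\mathrm{nfr}}_S(Y)$ is the presheaf of sets on $\mathrm{Sch}_S$ given by $X\mapsto\operatorname{colim}_n\mathrm{Corr}^{\mathrm{nfr},n}_S(X,Y)$. **Functoriality.** The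 presheaf $h^{\mathrm{nfr}}_S(Y)$ is functorial in pointed morphisms $p\colon Y_+\to Y'_+$ of $S$-schemes, where $Y_+=Y\sqcup S$ is pointed by $S$: the correspondence $(Z,f,h,i,\tau)$ is sent to its restriction to the open and closed subscheme of $Z$ on which $p\circ h$ lands in $Y'\subset Y'_+$. For $Y_1,\dots,Y_k\in\mathrm{Sch}_S$, the pointed morphisms $(Y_1\sqcup\dots\sqcup Y_k)_+\to(Y_j)_+$ that are the identity on $Y_j$ and send the other summands to the base point induce the canonical map $$h^{\mathrm{nfr}}_S(Y_1\sqcup\dots\sqcup Y_k)\to h^{\mathrm{nfr}}_S(Y_1)\times\dots\times h^{\mathrm{nfr}}_S(Y_k).\qquad(*)$$ For $Y\in\mathrm{Sch}_S$, the functor $I_+\mapsto (Y^{\sqcup I})_+$ on finite pointed sets makes $I_+\mapsto h^{\mathrm{nfr}}_S(Y^{\sqcup I})$ a functor from finite pointed sets to presheaves, with value $h^{\mathrm{nfr}}_S(Y)$ at $\langle 1\rangle=\{1\}_+$. **The functor $L_{\mathrm{htp}}$.** Let $\Delta^m=\operatorname{Spec}\mathbb Z[t_0,\dots,t_m]/(t_0+\dots+t_m-1)$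 be the algebraic $m$-simplex. For a presheaf of sets $F$ on $\mathrm{Sch}_S$, let $L_{\mathrm{htp}}F$ be the presheaf of spaces represented by the simplicial sets $(L_{\mathrm{htp}}F)(X)=F(X\times\Delta^\bullet)$. A map $F\to G$ is an *$L_{\mathrm{htp}}$-equivalence* if for every $X\in\mathrm{Sch}_S$ the map $F(X\times\Delta^\bullet)\to G(X\times\Delta^\bullet)$ is a weak homotopy equivalence of simplicial sets. **Proposition.** 1. For all $k\ge 0$ and all $Y_1,\dots,Y_k\in\mathrm{Sch}_S$, the canonical map $(*)$ is an $L_{\mathrm{htp}}$-equivalence. 2. For every $Y\in\mathrm{Sch}_S$, the functor $I_+\mapsto L_{\mathrm{htp}}h^{\mathrm{nfr}}_S(Y^{\sqcup I})$ from finite pointed sets to presheaves of spaces is an $E_\infty$-object, that is, it satisfies the Segal condition: for every $n\ge 0$, the $n$ pointed maps $\langle n\rangle\to\langle 1\rangle$ that send one element to $1$ and the others to the base point induce an equivalence $$L_{\mathrm{htp}}h^{\mathrm{nfr}}_S(Y^{\sqcup n})\xrightarrow{\ \sim\ }\bigl(L_{\mathrm{htp}}h^{\mathrm{nfr}}_S(Y)\bigr)^n.$$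 -/

import Mathlib

open CategoryTheory Limits AlgebraicGeometry Opposite

universe u

namespace NormalFraming

noncomputable section

/-! ### Bases of conormal modules -/

section

/-- The classes of `s` form a basis of `I / I²` over `B / I`. -/
def IsConormalBasis {B : Type*} [CommRing B] (I : Ideal B) {n : ℕ} (s : Fin n → I) : Prop :=
  LinearIndependent (B ⧸ I) (fun j => I.toCotangent (s j)) ∧
    Submodule.span (B ⧸ I) (Set.range fun j => I.toCotangent (s j)) = ⊤

section Algebra

open TensorProduct

theorem sum_mk_smul_toCotangent {B : Type*} [CommRing B] (I : Ideal B) {n : ℕ} (s : Fin n → I)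
    (a : Fin n → B) :
    ∑ j, (Ideal.Quotient.mk I (a j)) • I.toCotangent (s j) = I.toCotangent (∑ j, a j • s j) := by
  rw [map_sum]
  refine Finset.sum_congr rfl fun j _ => ?_
  rw [map_smul]
  rfl

theorem isConormalBasis_iff {B : Type*} [CommRing B] (I : Ideal B) {n : ℕ} (s : Fin n → I) :
    IsConormalBasis I s ↔
      (∀ a : Fin n → B, ∑ j, a j * (s j : B) ∈ I ^ 2 → ∀ j, a j ∈ I) ∧
        ∀ x ∈ I, ∃ a : Fin n → B, x - ∑ j, a j * (s j : B) ∈ I ^ 2 := by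
  unfold IsConormalBasis
  refine and_congr ?_ ?_
  · rw [Fintype.linearIndependent_iff]
    constructor
    · intro h a ha j
      rw [← Ideal.Quotient.eq_zero_iff_mem]
      refine h (fun j => Ideal.Quotient.mk I (a j)) ?_ j
      rw [sum_mk_smul_toCotangent, Ideal.toCotangent_eq_zero]
      simpa using ha
    · intro h g hg j
      choose a ha using fun j => Ideal.Quotient.mk_surjective (g j)
      obtain rfl : (fun j => Ideal.Quotient.mk I (a j)) = g := funext ha
      rw [sum_mk_smul_toCotangent, Ideal.toCotangent_eq_zero] at hg
      exact Ideal.Quotient.eq_zero_iff_mem.mpr (h a (by simpa using hg) j)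
  · rw [Submodule.eq_top_iff']
    constructor
    · intro h x hx
      obtain ⟨g, hg⟩ := (Submodule.mem_span_range_iff_exists_fun _).mp
        (h (I.toCotangent ⟨x, hx⟩))
      choose a ha using fun j => Ideal.Quotient.mk_surjective (g j)
      obtain rfl : (fun j => Ideal.Quotient.mk I (a j)) = g := funext ha
      rw [sum_mk_smul_toCotangent, eq_comm, Ideal.toCotangent_eq] at hg
      exact ⟨a, by simpa using hg⟩
    · intro h y
      obtain ⟨⟨x, hx⟩, rfl⟩ := I.toCotangent_surjective y
      obtain ⟨a, ha⟩ := h x hx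
      refine (Submodule.mem_span_range_iff_exists_fun _).mpr
        ⟨fun j => Ideal.Quotient.mk I (a j), ?_⟩
      rw [sum_mk_smul_toCotangent, eq_comm, Ideal.toCotangent_eq]
      simpa using ha

/-- A conormal basis stays one under a change of rings `B → B'` that keeps `I → B` injective. -/
theorem IsConormalBasis.map_of_injective {B B' : Type*} [CommRing B] [CommRing B'] [Algebra B B']
    {I : Ideal B} (hinj : Function.Injective (LinearMap.liftBaseChange B'
      (Algebra.linearMap B B' ∘ₗ I.subtype)))
    {n : ℕ} {s : Fin n → I} (hs : IsConormalBasis I s)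
    (s' : Fin n → I.map (algebraMap B B')) (hs' : ∀ j, (s' j : B') = algebraMap B B' (s j)) :
    IsConormalBasis (I.map (algebraMap B B')) s' := by
  have hs2 := ((isConormalBasis_iff I s).mp hs).2
  set I' := I.map (algebraMap B B') with hI'
  set L := LinearMap.liftBaseChange B' (Algebra.linearMap B B' ∘ₗ I.subtype) with hL
  have hLt : ∀ (r : B') (q : I), L (r ⊗ₜ q) = r * algebraMap B B' q := by
    intro r q
    simp [hL]
  let b : Module.Basis (Fin n) (B ⧸ I) I.Cotangent := Module.Basis.mk hs.1 hs.2.ge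
  have hb : ∀ j, b j = I.toCotangent (s j) := fun j => by simp [b]
  have hmap : ∀ x ∈ I, Ideal.Quotient.mk I' (algebraMap B B' x) = 0 := fun x hx =>
    Ideal.Quotient.eq_zero_iff_mem.mpr (Ideal.mem_map_of_mem _ hx)
  let q' : (B ⧸ I) →+* B' ⧸ I' := Ideal.Quotient.lift I
    ((Ideal.Quotient.mk I').comp (algebraMap B B')) hmap
  let ψ : Fin n → I →ₗ[B] B' ⧸ I' := fun k =>
    { toFun := fun x => q' (b.repr (I.toCotangent x) k)
      map_add' := by intro x y; simp
      map_smul' := by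
        intro r x
        have h1 : I.toCotangent (r • x) = (Ideal.Quotient.mk I r) • I.toCotangent x := by
          rw [map_smul]; rfl
        rw [h1]
        simp only [map_smul, Finsupp.smul_apply, smul_eq_mul, map_mul, RingHom.id_apply]
        rw [Algebra.smul_def]
        rfl }
  let Ψ : Fin n → B' ⊗[B] I →ₗ[B'] B' ⧸ I' := fun k => LinearMap.liftBaseChange B' (ψ k)
  have hΨt : ∀ k (r : B') (x : I), Ψ k (r ⊗ₜ x) =
      Ideal.Quotient.mk I' r * q' (b.repr (I.toCotangent x) k) := by
    intro k r x
    simp only [Ψ, LinearMap.liftBaseChange_tmul, ψ, LinearMap.coe_mk, AddHom.coe_mk,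
      Algebra.smul_def]
    rfl
  have lift2 : ∀ x ∈ I' ^ 2, ∃ ξ : B' ⊗[B] I, L ξ = x ∧ ∀ k, Ψ k ξ = 0 := by
    intro x hx
    rw [hI', ← Ideal.map_pow, Ideal.map] at hx
    induction hx using Submodule.span_induction with
    | mem x h =>
      obtain ⟨y, hy, rfl⟩ := h
      refine ⟨1 ⊗ₜ ⟨y, Ideal.pow_le_self two_ne_zero hy⟩, by rw [hLt]; simp, fun k => ?_⟩
      rw [hΨt, (I.toCotangent_eq_zero _).mpr hy]
      simp
    | zero => exact ⟨0, by simp, by simp⟩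
    | add x y _ _ hx hy =>
      obtain ⟨ξ, h1, h2⟩ := hx
      obtain ⟨η, h3, h4⟩ := hy
      exact ⟨ξ + η, by rw [map_add, h1, h3], fun k => by rw [map_add, h2, h4, add_zero]⟩
    | smul c x _ hx =>
      obtain ⟨ξ, h1, h2⟩ := hx
      exact ⟨c • ξ, by rw [map_smul, h1], fun k => by rw [map_smul, h2, smul_zero]⟩
  rw [isConormalBasis_iff]
  constructor
  · intro a ha j
    obtain ⟨ξ, h1, h2⟩ := lift2 _ ha
    have h3 : ξ = ∑ k, a k ⊗ₜ s k := by
      apply hinj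
      rw [h1, map_sum]
      exact Finset.sum_congr rfl fun k _ => by rw [hLt, hs']
    have h4 := h2 j
    rw [h3, map_sum, Finset.sum_eq_single j] at h4
    · rw [hΨt, ← hb, Module.Basis.repr_self, Finsupp.single_eq_same, map_one, mul_one] at h4
      exact Ideal.Quotient.eq_zero_iff_mem.mp h4
    · intro k _ hk
      rw [hΨt, ← hb, Module.Basis.repr_self, Finsupp.single_eq_of_ne hk.symm, map_zero, mul_zero]
    · simp
  · intro x hx
    replace hx : x ∈ Ideal.span (algebraMap B B' '' I) := hx
    induction hx using Submodule.span_induction with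
    | mem x h =>
      obtain ⟨y, hy, rfl⟩ := h
      obtain ⟨a, ha⟩ := hs2 y hy
      refine ⟨fun j => algebraMap B B' (a j), ?_⟩
      have := Ideal.mem_map_of_mem (algebraMap B B') ha
      rw [Ideal.map_pow] at this
      simpa [hs'] using this
    | zero => exact ⟨0, by simp⟩
    | add x y _ _ hx hy =>
      obtain ⟨a, ha⟩ := hx
      obtain ⟨c, hc⟩ := hy
      refine ⟨a + c, ?_⟩
      convert add_mem ha hc using 1
      simp only [Pi.add_apply, add_mul, Finset.sum_add_distrib]; ring
    | smul c x _ hx =>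
      obtain ⟨a, ha⟩ := hx
      refine ⟨c • a, ?_⟩
      convert Ideal.mul_mem_left _ c ha using 1
      simp only [Pi.smul_apply, smul_eq_mul, mul_sub, Finset.mul_sum, mul_assoc]

/-- Flat change of rings. -/
theorem IsConormalBasis.map_of_flat {B B' : Type*} [CommRing B] [CommRing B'] [Algebra B B']
    [Module.Flat B B'] {I : Ideal B} {n : ℕ} {s : Fin n → I} (hs : IsConormalBasis I s)
    (s' : Fin n → I.map (algebraMap B B')) (hs' : ∀ j, (s' j : B') = algebraMap B B' (s j)) :
    IsConormalBasis (I.map (algebraMap B B')) s' := by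
  refine hs.map_of_injective ?_ s' hs'
  have h := Module.Flat.lTensor_preserves_injective_linearMap (M := B') I.subtype
    I.injective_subtype
  have h2 : (LinearMap.liftBaseChange B' (Algebra.linearMap B B' ∘ₗ I.subtype)).restrictScalars B =
      (TensorProduct.rid B B').toLinearMap ∘ₗ I.subtype.lTensor B' := by
    ext x y
    simp [Algebra.smul_def, mul_comm]
  have h3 : Function.Injective ((TensorProduct.rid B B').toLinearMap ∘ₗ I.subtype.lTensor B') :=
    (TensorProduct.rid B B').injective.comp h
  rw [← h2] at h3
  exact h3

/-- Base change along an arbitrary `R → R'` when `B / I` is flat over `R`. -/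
theorem IsConormalBasis.map_of_isPushout {R R' B B' : Type*} [CommRing R] [CommRing R']
    [CommRing B] [CommRing B'] [Algebra R R'] [Algebra R B] [Algebra R' B'] [Algebra B B']
    [Algebra R B'] [IsScalarTower R R' B'] [IsScalarTower R B B'] [Algebra.IsPushout R B R' B']
    {I : Ideal B} [Module.Flat R (B ⧸ I)] {n : ℕ} {s : Fin n → I} (hs : IsConormalBasis I s)
    (s' : Fin n → I.map (algebraMap B B')) (hs' : ∀ j, (s' j : B') = algebraMap B B' (s j)) :
    IsConormalBasis (I.map (algebraMap B B')) s' := by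
  refine hs.map_of_injective ?_ s' hs'
  have h := LinearMap.lTensor_injective_of_exact_of_flat (R := R)
    (Ideal.Quotient.mkₐ R I).toLinearMap Ideal.Quotient.mk_surjective
    (I.subtype.restrictScalars R) I.injective_subtype
    (fun x => by
      simp only [AlgHom.toLinearMap_apply, Ideal.Quotient.mkₐ_eq_mk,
        Ideal.Quotient.eq_zero_iff_mem]
      simp) R'
  have hsymm : Algebra.IsPushout R R' B B' := Algebra.IsPushout.symm inferInstance
  let e := Algebra.IsPushout.cancelBaseChange R R' B B' I
  let E := Algebra.IsPushout.equiv R R' B B'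
  have h2 : ∀ x : R' ⊗[R] I, LinearMap.liftBaseChange B' (Algebra.linearMap B B' ∘ₗ I.subtype)
      (e.symm x) = E ((I.subtype.restrictScalars R).lTensor R' x) := by
    intro x
    induction x using TensorProduct.induction_on with
    | zero => rw [LinearEquiv.map_zero, LinearMap.map_zero, LinearMap.map_zero, _root_.map_zero]
    | tmul r y => simp [e, E, Algebra.IsPushout.equiv_tmul]
    | add x y hx hy => simp only [map_add, hx, hy]
  intro x y hxy
  apply e.injective
  apply h
  apply E.injective
  rw [← h2, ← h2, e.symm_apply_apply, e.symm_apply_apply]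
  exact hxy

/-- Adding a free variable. -/
theorem IsConormalBasis.polynomial {B : Type*} [CommRing B] {I : Ideal B} {n : ℕ} {s : Fin n → I}
    (hs : IsConormalBasis I s) (J : Ideal (Polynomial B))
    (hJ : ∀ p, p ∈ J ↔ p.coeff 0 ∈ I) (s' : Fin (n + 1) → J)
    (hs' : ∀ j : Fin n, (s' j.castSucc : Polynomial B) = Polynomial.C (s j : B))
    (hlast : (s' (Fin.last n) : Polynomial B) = Polynomial.X) :
    IsConormalBasis J s' := by
  rw [isConormalBasis_iff] at hs ⊢
  have hJ2 : ∀ p ∈ J ^ 2, p.coeff 0 ∈ I ^ 2 ∧ p.coeff 1 ∈ I := by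
    intro p hp
    rw [pow_two] at hp
    induction hp using Submodule.mul_induction_on' with
    | mem_mul_mem x hx y hy =>
      rw [hJ] at hx hy
      constructor
      · rw [Polynomial.mul_coeff_zero, pow_two]
        exact Ideal.mul_mem_mul hx hy
      · rw [Polynomial.mul_coeff_one]
        exact add_mem (Ideal.mul_mem_right _ _ hx) (Ideal.mul_mem_left _ _ hy)
    | add x _ y _ hx hy => exact ⟨by simpa using add_mem hx.1 hy.1, by simpa using add_mem hx.2 hy.2⟩
  constructor
  · intro a ha
    rw [Fin.sum_univ_castSucc, hlast] at ha
    simp only [hs'] at ha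
    obtain ⟨h0, h1⟩ := hJ2 _ ha
    simp only [Polynomial.coeff_add, Polynomial.finsetSum_coeff, Polynomial.coeff_C_zero,
      Polynomial.mul_coeff_zero, Polynomial.coeff_X_zero, mul_zero, add_zero] at h0
    simp only [Polynomial.coeff_add, Polynomial.finsetSum_coeff, Polynomial.coeff_mul_C,
      Polynomial.coeff_mul_X] at h1
    have h3 := hs.1 _ h0
    intro j
    rw [hJ]
    induction j using Fin.lastCases with
    | last =>
      have h5 : ∑ j : Fin n, (a j.castSucc).coeff 1 * (s j : B) ∈ I :=
        sum_mem fun j _ => Ideal.mul_mem_left _ _ (s j).2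
      simpa using sub_mem h1 h5
    | cast j => exact h3 j
  · intro p hp
    obtain ⟨a, ha⟩ := hs.2 _ ((hJ p).mp hp)
    refine ⟨Fin.lastCases p.divX (fun j => Polynomial.C (a j)), ?_⟩
    rw [Fin.sum_univ_castSucc, hlast]
    simp only [hs', Fin.lastCases_last, Fin.lastCases_castSucc]
    have h1 : p - (∑ j, Polynomial.C (a j) * Polynomial.C (s j : B) + p.divX * Polynomial.X) =
        Polynomial.C (p.coeff 0 - ∑ j, a j * (s j : B)) := by
      conv_lhs => enter [1]; rw [← p.divX_mul_X_add]
      simp only [map_sub, map_sum, map_mul]; ring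
    rw [h1]
    have hle : I.map (Polynomial.C : B →+* Polynomial B) ≤ J := by
      rw [Ideal.map_le_iff_le_comap]
      intro x hx
      rw [Ideal.mem_comap, hJ]
      simpa using hx
    refine Ideal.pow_right_mono hle 2 ?_
    rw [← Ideal.map_pow]
    exact Ideal.mem_map_of_mem _ ha

end Algebra

section Conormal

/-- The ideal of functions on `V ⊆ A` that vanish on `Z`. -/
abbrev sectionIdeal {Z A : Scheme.{u}} (i : Z ⟶ A) (V : A.Opens) : Ideal Γ(A, V) :=
  RingHom.ker (i.app V).hom

/-- The stalk `I_z` at `i z` of the ideal sheaf of a closed immersion `i : Z ⟶ A`. -/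
abbrev stalkIdeal {Z A : Scheme.{u}} (i : Z ⟶ A) (z : Z) : Ideal (A.presheaf.stalk (i z)) :=
  RingHom.ker (i.stalkMap z).hom

/-- The stalk `I_z / I_z²` at `z` of the conormal sheaf of a closed immersion `i : Z ⟶ A`; it is a
module over `𝒪_{A, i z} / I_z = 𝒪_{Z, z}`. -/
abbrev ConormalStalk {Z A : Scheme.{u}} (i : Z ⟶ A) (z : Z) : Type u :=
  (stalkIdeal i z).Cotangent

theorem germ_mem_stalkIdeal {Z A : Scheme.{u}} (i : Z ⟶ A) (V : A.Opens) (z : Z) (hz : i z ∈ V)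
    (s : sectionIdeal i V) : A.presheaf.germ V (i z) hz s.1 ∈ stalkIdeal i z := by
  have h := s.2
  rw [RingHom.mem_ker] at h ⊢
  have h2 := Scheme.Hom.germ_stalkMap_apply i V z hz s.1
  refine h2.trans ?_
  have h3 : (Scheme.Hom.app i V) s.1 = 0 := h
  rw [h3, map_zero]

/-- The germ at `z` of the section of the conormal sheaf given by a function vanishing on `Z`. -/
def conormalGerm {Z A : Scheme.{u}} (i : Z ⟶ A) (V : A.Opens) (z : Z) (hz : i z ∈ V)
    (s : sectionIdeal i V) : ConormalStalk i z :=
  (stalkIdeal i z).toCotangent ⟨A.presheaf.germ V (i z) hz s.1, germ_mem_stalkIdeal i V z hz s⟩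

variable {Z Z' Z'' A A' A'' : Scheme.{u}}

/-- For a commutative square `i' ≫ G = w ≫ i`, the map `𝒪_{A, i (w z)} → 𝒪_{A', i' z}`. -/
def squareStalkMap {i : Z ⟶ A} {i' : Z' ⟶ A'} {w : Z' ⟶ Z} {G : A' ⟶ A} (sq : i' ≫ G = w ≫ i)
    (z : Z') : A.presheaf.stalk (i (w z)) ⟶ A'.presheaf.stalk (i' z) :=
  A.presheaf.stalkSpecializes (specializes_of_eq (by
    change (i' ≫ G) z = (w ≫ i) z; rw [sq])) ≫ G.stalkMap (i' z)

theorem mem_preimage_of_square {i : Z ⟶ A} {i' : Z' ⟶ A'} {w : Z' ⟶ Z} {G : A' ⟶ A}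
    (sq : i' ≫ G = w ≫ i) {z : Z'} {V : A.Opens} (h : i (w z) ∈ V) : i' z ∈ G ⁻¹ᵁ V := by
  change (i' ≫ G) z ∈ V
  rw [sq]
  exact h

theorem germ_squareStalkMap {i : Z ⟶ A} {i' : Z' ⟶ A'} {w : Z' ⟶ Z} {G : A' ⟶ A}
    (sq : i' ≫ G = w ≫ i) (z : Z') (V : A.Opens) (h : i (w z) ∈ V) (s : Γ(A, V)) :
    squareStalkMap sq z (A.presheaf.germ V _ h s) =
      A'.presheaf.germ (G ⁻¹ᵁ V) (i' z) (mem_preimage_of_square sq h) (G.app V s) := by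
  have e : A.presheaf.germ V _ h ≫ squareStalkMap sq z =
      G.app V ≫ A'.presheaf.germ (G ⁻¹ᵁ V) (i' z) (mem_preimage_of_square sq h) := by
    unfold squareStalkMap
    rw [← Category.assoc, TopCat.Presheaf.germ_stalkSpecializes, Scheme.Hom.germ_stalkMap]
  exact congr($e s)

theorem squareStalkMap_stalkMap {i : Z ⟶ A} {i' : Z' ⟶ A'} {w : Z' ⟶ Z} {G : A' ⟶ A}
    (sq : i' ≫ G = w ≫ i) (z : Z') :
    squareStalkMap sq z ≫ i'.stalkMap z = i.stalkMap (w z) ≫ w.stalkMap z := by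
  unfold squareStalkMap
  rw [Category.assoc, ← Scheme.Hom.stalkMap_comp, ← Scheme.Hom.stalkMap_comp]
  exact (Scheme.Hom.stalkMap_congr_hom _ _ sq.symm z).symm

theorem stalkIdeal_le_comap {i : Z ⟶ A} {i' : Z' ⟶ A'} {w : Z' ⟶ Z} {G : A' ⟶ A}
    (sq : i' ≫ G = w ≫ i) (z : Z') :
    stalkIdeal i (w z) ≤ (stalkIdeal i' z).comap (squareStalkMap sq z).hom.toIntAlgHom := by
  intro x hx
  rw [RingHom.mem_ker] at hx
  have e := congr($(squareStalkMap_stalkMap sq z) x)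
  change i'.stalkMap z (squareStalkMap sq z x) = 0
  refine e.trans ?_
  change w.stalkMap z (i.stalkMap (w z) x) = 0
  have h3 : i.stalkMap (w z) x = 0 := hx
  rw [h3, map_zero]

/-- For a commutative square `i' ≫ G = w ≫ i`, the induced map of stalks of conormal sheaves. -/
def conormalMap {i : Z ⟶ A} {i' : Z' ⟶ A'} {w : Z' ⟶ Z} {G : A' ⟶ A} (sq : i' ≫ G = w ≫ i)
    (z : Z') : ConormalStalk i (w z) →ₗ[ℤ] ConormalStalk i' z :=
  Ideal.mapCotangent (stalkIdeal i (w z)) (stalkIdeal i' z)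
    (squareStalkMap sq z).hom.toIntAlgHom (stalkIdeal_le_comap sq z)

/-- Pulling back functions vanishing on `Z` along a commutative square. -/
def sectionMap {i : Z ⟶ A} {i' : Z' ⟶ A'} {w : Z' ⟶ Z} {G : A' ⟶ A} (sq : i' ≫ G = w ≫ i)
    (V : A.Opens) (s : sectionIdeal i V) : sectionIdeal i' (G ⁻¹ᵁ V) :=
  ⟨G.app V s.1, by
    have h : (i.app V) s.1 = 0 := s.2
    change (i'.app (G ⁻¹ᵁ V)) (G.app V s.1) = 0
    have key : ∀ f g : Z' ⟶ A, f = g → g.app V s.1 = 0 → f.app V s.1 = 0 := by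
      rintro f _ rfl h
      exact h
    refine key (i' ≫ G) (w ≫ i) sq ?_
    change w.app (i ⁻¹ᵁ V) (i.app V s.1) = 0
    rw [h, map_zero]⟩

theorem conormalMap_conormalGerm {i : Z ⟶ A} {i' : Z' ⟶ A'} {w : Z' ⟶ Z} {G : A' ⟶ A}
    (sq : i' ≫ G = w ≫ i) (z : Z') (V : A.Opens) (h : i (w z) ∈ V) (s : sectionIdeal i V) :
    conormalMap sq z (conormalGerm i V (w z) h s) =
      conormalGerm i' (G ⁻¹ᵁ V) z (mem_preimage_of_square sq h) (sectionMap sq V s) := by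
  unfold conormalMap conormalGerm
  rw [Ideal.mapCotangent_toCotangent]
  congr 1
  exact Subtype.ext (germ_squareStalkMap sq z V h s.1)

/-- Restriction of functions vanishing on `Z`. -/
def sectionRestrict (i : Z ⟶ A) {V W : A.Opens} (h : W ≤ V) (s : sectionIdeal i V) :
    sectionIdeal i W :=
  ⟨A.presheaf.map (homOfLE h).op s.1, by
    have h1 : (i.app V) s.1 = 0 := s.2
    change (i.app W) (A.presheaf.map (homOfLE h).op s.1) = 0
    rw [← CommRingCat.comp_apply, Scheme.Hom.naturality, CommRingCat.comp_apply, h1, map_zero]⟩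

theorem conormalGerm_restrict (i : Z ⟶ A) {V W : A.Opens} (h : W ≤ V) (z : Z) (hz : i z ∈ W)
    (s : sectionIdeal i V) :
    conormalGerm i W z hz (sectionRestrict i h s) = conormalGerm i V z (h hz) s := by
  unfold conormalGerm
  congr 1
  exact Subtype.ext (TopCat.Presheaf.germ_res_apply _ _ _ _ _)

/-- `V` is an affine open of `A` on which the functions `s` induce `sec` and form a basis of the
conormal module. -/
def IsChart {i : Z ⟶ A} {n : ℕ} (sec : ∀ z, Fin n → ConormalStalk i z) (V : A.Opens)
    (s : Fin n → sectionIdeal i V) : Prop :=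
  IsAffineOpen V ∧ (∀ z (hz : i z ∈ V) j, sec z j = conormalGerm i V z hz (s j)) ∧
    IsConormalBasis (sectionIdeal i V) s

/-- A trivialization `𝒪_Z^n ≃ N_i` of the conormal sheaf of a closed immersion `i : Z ⟶ A`: an
`n`-tuple of global sections of `N_i = I / I²` (families of germs that are locally induced by
functions in the ideal of `Z`) which, over the members of an affine open covering, is a basis of
`I / I²`. -/
@[ext]
structure Framing {Z A : Scheme.{u}} (i : Z ⟶ A) (n : ℕ) where
  sec : ∀ z, Fin n → ConormalStalk i z
  exists_chart : ∀ z, ∃ (V : A.Opens) (s : Fin n → sectionIdeal i V), i z ∈ V ∧ IsChart sec V s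

/-- The trivialization `t'` is the pullback of `t` along a commutative square. -/
def Framing.IsInduced {i : Z ⟶ A} {i' : Z' ⟶ A'} {w : Z' ⟶ Z} {G : A' ⟶ A}
    (sq : i' ≫ G = w ≫ i) {n : ℕ} (t' : Framing i' n) (t : Framing i n) : Prop :=
  ∀ z j, t'.sec z j = conormalMap sq z (t.sec (w z) j)

theorem Framing.isInduced_refl {i : Z ⟶ A} {n : ℕ} (t : Framing i n) {w : Z ⟶ Z} {G : A ⟶ A}
    (sq : i ≫ G = w ≫ i) (hw : w = 𝟙 Z) (hG : G = 𝟙 A) : Framing.IsInduced sq t t := by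
  subst hw hG
  intro z j
  obtain ⟨V, s, hz, -, hs, -⟩ := t.exists_chart z
  rw [hs z hz, hs ((𝟙 Z : Z ⟶ Z) z) (by simpa using hz), conormalMap_conormalGerm]
  rfl

theorem Framing.IsInduced.comp {i : Z ⟶ A} {i' : Z' ⟶ A'} {i'' : Z'' ⟶ A''}
    {w : Z' ⟶ Z} {G : A' ⟶ A} {w' : Z'' ⟶ Z'} {G' : A'' ⟶ A'}
    {sq : i' ≫ G = w ≫ i} {sq' : i'' ≫ G' = w' ≫ i'} {n : ℕ} {t : Framing i n} {t' : Framing i' n}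
    {t'' : Framing i'' n} (h' : Framing.IsInduced sq' t'' t') (h : Framing.IsInduced sq t' t)
    {w₀ : Z'' ⟶ Z} {G₀ : A'' ⟶ A} (sq₀ : i'' ≫ G₀ = w₀ ≫ i) (hw : w₀ = w' ≫ w)
    (hG : G₀ = G' ≫ G) : Framing.IsInduced sq₀ t'' t := by
  subst hw hG
  intro z j
  rw [h' z j, h (w' z) j]
  obtain ⟨V, s, hz, -, hs, -⟩ := t.exists_chart (w (w' z))
  rw [hs _ hz, hs ((w' ≫ w) z) (by simpa using hz), conormalMap_conormalGerm,
    conormalMap_conormalGerm, conormalMap_conormalGerm]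
  rfl

/-- A section of the conormal sheaf is determined by its pullback along an isomorphism. -/
theorem Framing.IsInduced.of_comp_id {i : Z ⟶ A} {i' : Z' ⟶ A} {e : Z' ≅ Z} {n : ℕ}
    {t : Framing i n} {t' : Framing i' n} {sq : i' ≫ 𝟙 A = e.hom ≫ i}
    (h : Framing.IsInduced sq t' t) (sq' : i ≫ 𝟙 A = e.inv ≫ i') :
    Framing.IsInduced sq' t t' := by
  intro z j
  obtain ⟨V, s, hz, -, hs, -⟩ := t.exists_chart z
  have hz' : i (e.hom (e.inv z)) ∈ V := by
    change i ((e.inv ≫ e.hom) z) ∈ V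
    simpa using hz
  rw [h, hs z hz, hs _ hz', conormalMap_conormalGerm, conormalMap_conormalGerm]
  rfl

end Conormal

end

/-! ### Base change of conormal bases -/

section

theorem ker_eq_map_of_isPushout {B C B' P : CommRingCat.{u}} {φ : B ⟶ C} {β : B ⟶ B'}
    {ι : C ⟶ P} {φ' : B' ⟶ P} (h : IsPushout φ β ι φ') (hφ : Function.Surjective φ.hom) :
    RingHom.ker φ'.hom = (RingHom.ker φ.hom).map β.hom := by
  apply le_antisymm
  · intro x hx
    let q : B' ⟶ CommRingCat.of (B' ⧸ (RingHom.ker φ.hom).map β.hom) :=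
      CommRingCat.ofHom (Ideal.Quotient.mk _)
    have hq : RingHom.ker φ.hom ≤ RingHom.ker (q.hom.comp β.hom) := by
      intro y hy
      rw [RingHom.mem_ker, RingHom.comp_apply]
      exact Ideal.Quotient.eq_zero_iff_mem.mpr (Ideal.mem_map_of_mem _ hy)
    let r : C ⟶ CommRingCat.of (B' ⧸ (RingHom.ker φ.hom).map β.hom) :=
      CommRingCat.ofHom (RingHom.liftOfSurjective φ.hom hφ ⟨q.hom.comp β.hom, hq⟩)
    have e : φ ≫ r = β ≫ q := by
      ext y
      exact RingHom.liftOfRightInverse_comp_apply φ.hom (Function.surjInv hφ)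
        (Function.rightInverse_surjInv hφ) ⟨q.hom.comp β.hom, hq⟩ y
    have h2 := h.inr_desc r q e
    have h3 : q x = 0 := by
      rw [← h2, CommRingCat.comp_apply]
      have : φ' x = 0 := hx
      rw [this, map_zero]
    exact Ideal.Quotient.eq_zero_iff_mem.mp h3
  · rw [Ideal.map_le_iff_le_comap]
    intro y hy
    have h2 := congr($(h.w) y)
    rw [Ideal.mem_comap, RingHom.mem_ker]
    refine h2.symm.trans ?_
    have : φ y = 0 := hy
    rw [CommRingCat.comp_apply, this, map_zero]

/-- The ideal of a base change of a closed immersion, on affine opens. -/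
theorem sectionIdeal_eq_map {Z Z' A A' : Scheme.{u}} {w : Z' ⟶ Z} {i' : Z' ⟶ A'} {i : Z ⟶ A}
    {G : A' ⟶ A} [IsClosedImmersion i] (h : IsPullback w i' i G) {V : A.Opens} {V' : A'.Opens}
    (hV : IsAffineOpen V) (hV' : IsAffineOpen V') (hle : V' ≤ G ⁻¹ᵁ V) :
    sectionIdeal i' V' = (sectionIdeal i V).map (G.appLE V V' hle).hom := by
  have hw : i' ⁻¹ᵁ V' ≤ w ⁻¹ᵁ (i ⁻¹ᵁ V) := by
    intro z hz
    have := hle hz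
    change (w ≫ i) z ∈ V
    rw [h.w]
    exact this
  have h1 := (isIso_pushoutSection_iff h hle (UX := i ⁻¹ᵁ V) le_rfl
    (UY := i' ⁻¹ᵁ V') (by rw [inf_eq_right.mpr hw])).mp
      (isIso_pushoutSection_of_isAffineOpen _ _ _ _ hV hV' (hV.preimage i))
  have h2 := ker_eq_map_of_isPushout h1 (by
    have := i.app_surjective V hV
    rw [Scheme.Hom.appLE_eq_app]
    exact this)
  simpa [sectionIdeal, Scheme.Hom.appLE_eq_app] using h2

theorem isConormalBasis_of_eq {B : Type*} [CommRing B] {I J : Ideal B} (h : I = J) {n : ℕ}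
    {s : Fin n → I} {t : Fin n → J} (hst : ∀ j, (s j : B) = t j) (hs : IsConormalBasis I s) :
    IsConormalBasis J t := by
  subst h
  obtain rfl : s = t := funext fun j => Subtype.ext (hst j)
  exact hs

theorem IsConormalBasis.restrict {Z A : Scheme.{u}} {i : Z ⟶ A} [IsClosedImmersion i]
    {V W : A.Opens} (hV : IsAffineOpen V) (hW : IsAffineOpen W) (h : W ≤ V) {n : ℕ}
    {s : Fin n → sectionIdeal i V} (hs : IsConormalBasis _ s) :
    IsConormalBasis (sectionIdeal i W) (fun j => sectionRestrict i h (s j)) := by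
  have e := sectionIdeal_eq_map (IsPullback.of_horiz_isIso (fst := 𝟙 Z) (snd := i) (f := i)
    (g := 𝟙 A) ⟨by simp⟩) hV hW h
  let _ := ((𝟙 A : A ⟶ A).appLE V W h).hom.toAlgebra
  have : Module.Flat Γ(A, V) Γ(A, W) := Scheme.Hom.flat_appLE (𝟙 A) hV hW h
  have := hs.map_of_flat (B' := Γ(A, W)) (fun j => ⟨_, Ideal.mem_map_of_mem _ (s j).2⟩)
    (fun j => rfl)
  refine isConormalBasis_of_eq e.symm (fun j => ?_) this
  have e1 : (𝟙 A : A ⟶ A).appLE V W h = A.presheaf.map (homOfLE h).op := by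
    exact Category.id_comp _
  exact congr($e1 (s j).1)

/-- Charts of a framing can be pulled back along a cartesian square of embedded schemes lying over
a base change, if the embedded scheme is flat over the base. -/
theorem IsConormalBasis.baseChange {Z Z' A A' X X' : Scheme.{u}} {w : Z' ⟶ Z} {i' : Z' ⟶ A'}
    {i : Z ⟶ A} {G : A' ⟶ A} [IsClosedImmersion i] (h : IsPullback w i' i G)
    {π : A ⟶ X} {π' : A' ⟶ X'} {g : X' ⟶ X} (h' : IsPullback G π' π g) [Flat (i ≫ π)]
    {V : A.Opens} (hV : IsAffineOpen V) {n : ℕ}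
    {s : Fin n → sectionIdeal i V} (hs : IsConormalBasis _ s) (z : Z') (hz : i (w z) ∈ V) :
    ∃ (V' : A'.Opens) (hle : V' ≤ G ⁻¹ᵁ V), IsAffineOpen V' ∧ i' z ∈ V' ∧
      IsConormalBasis (sectionIdeal i' V')
        (fun j => sectionRestrict i' hle (sectionMap h.w.symm V (s j))) := by
  obtain ⟨U, hU, hzU, -⟩ := exists_isAffineOpen_mem_and_subset (X := X)
    (x := π (i (w z))) (U := ⊤) trivial
  obtain ⟨V₁, hV₁, hzV₁, hle₁⟩ := exists_isAffineOpen_mem_and_subset (X := A)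
    (x := i (w z)) (U := V ⊓ π ⁻¹ᵁ U) ⟨hz, hzU⟩
  have hV₁V : V₁ ≤ V := fun x hx => (hle₁ hx).1
  have hV₁U : V₁ ≤ π ⁻¹ᵁ U := fun x hx => (hle₁ hx).2
  have hG : G (i' z) = i (w z) := by
    change (i' ≫ G) z = (w ≫ i) z; rw [h.w]
  have hgz : g (π' (i' z)) = π (i (w z)) := by
    rw [← hG]; change (π' ≫ g) (i' z) = (G ≫ π) (i' z); rw [h'.w]
  obtain ⟨U', hU', hzU', hleU'⟩ := exists_isAffineOpen_mem_and_subset (X := X')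
    (x := π' (i' z)) (U := g ⁻¹ᵁ U) (by change g _ ∈ U; rw [hgz]; exact hzU)
  have hs₁ := hs.restrict hV hV₁ hV₁V
  have hiso := isIso_pushoutSection_of_isAffineOpen h' (US := U) (UT := U') (UX := V₁)
    hleU' hV₁U rfl hU hU' hV₁
  have hpo := (isIso_pushoutSection_iff ..).mp hiso
  set V' := G ⁻¹ᵁ V₁ ⊓ π' ⁻¹ᵁ U' with hV'def
  have hV' : IsAffineOpen V' := by
    have : IsAffine _ := hU
    have : IsAffine _ := hU'
    have : IsAffine _ := hV₁
    exact .of_isIso (Scheme.Hom.isPullback_resLE h' hleU' hV₁U rfl).isoPullback.hom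
  have hle : V' ≤ G ⁻¹ᵁ V₁ := inf_le_left
  refine ⟨V', hle.trans ((Scheme.Hom.preimage_mono G hV₁V)), hV', ?_, ?_⟩
  · refine ⟨?_, hzU'⟩
    change G _ ∈ V₁; rw [hG]; exact hzV₁
  have e := sectionIdeal_eq_map h hV₁ hV' hle
  let _ := (π.appLE U V₁ hV₁U).hom.toAlgebra
  let _ := (g.appLE U U' hleU').hom.toAlgebra
  let _ := (G.appLE V₁ V' hle).hom.toAlgebra
  let _ := (π'.appLE U' V' inf_le_right).hom.toAlgebra
  let _ := ((π.appLE U V₁ hV₁U) ≫ (G.appLE V₁ V' hle)).hom.toAlgebra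
  have : IsScalarTower Γ(X, U) Γ(A, V₁) Γ(A', V') := IsScalarTower.of_algebraMap_eq' rfl
  have : IsScalarTower Γ(X, U) Γ(X', U') Γ(A', V') := IsScalarTower.of_algebraMap_eq' (by
    have := hpo.w
    exact congr(($this).hom))
  have : Algebra.IsPushout Γ(X, U) Γ(A, V₁) Γ(X', U') Γ(A', V') :=
    CommRingCat.isPushout_iff_isPushout.mp hpo
  have hiU : i ⁻¹ᵁ V₁ ≤ (i ≫ π) ⁻¹ᵁ U := fun x hx => hV₁U hx
  have hflat : Module.Flat Γ(X, U) (Γ(A, V₁) ⧸ sectionIdeal i V₁) := by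
    have hfl : ((i ≫ π).appLE U (i ⁻¹ᵁ V₁) hiU).hom.Flat := Scheme.Hom.flat_appLE (i ≫ π) hU (hV₁.preimage i) _
    let _ := ((i ≫ π).appLE U (i ⁻¹ᵁ V₁) hiU).hom.toAlgebra
    have : Module.Flat Γ(X, U) Γ(Z, i ⁻¹ᵁ V₁) := hfl
    let E := RingHom.quotientKerEquivOfSurjective (f := (i.app V₁).hom) (i.app_surjective V₁ hV₁)
    have hE : ∀ (r : Γ(X, U)) (x : Γ(A, V₁) ⧸ sectionIdeal i V₁),
        E (r • x) = r • E x := by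
      intro r x
      rw [Algebra.smul_def, Algebra.smul_def, map_mul]
      congr 1
      have h0 : π.appLE U V₁ hV₁U ≫ i.app V₁ = (i ≫ π).appLE U (i ⁻¹ᵁ V₁) hiU := by
        rw [← Scheme.Hom.appLE_eq_app, Scheme.Hom.appLE_comp_appLE]
      exact congr($h0 r)
    exact Module.Flat.of_linearEquiv
      { E.toAddEquiv with map_smul' := hE }
  have := hs₁.map_of_isPushout (R := Γ(X, U)) (R' := Γ(X', U')) (B' := Γ(A', V'))
    (fun j => ⟨_, Ideal.mem_map_of_mem _ (Subtype.prop _)⟩) (fun j => rfl)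
  refine isConormalBasis_of_eq e.symm (fun j => ?_) this
  have e1 : A.presheaf.map (homOfLE hV₁V).op ≫ G.appLE V₁ V' hle =
      G.appLE V V' (hle.trans (Scheme.Hom.preimage_mono G hV₁V)) := Scheme.Hom.map_appLE ..
  exact congr($e1 (s j).1)

end

/-! ### Pullback of framings -/

section

variable {Z Z' Z'' A A' X X' : Scheme.{u}}

/-- The pullback of a framing along a square, provided there are charts for it. -/
def Framing.ofCharts {i : Z ⟶ A} {i' : Z' ⟶ A'} {w : Z' ⟶ Z} {G : A' ⟶ A}
    (sq : i' ≫ G = w ≫ i) {n : ℕ} (t : Framing i n)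
    (H : ∀ (z : Z') (V : A.Opens) (s : Fin n → sectionIdeal i V), i (w z) ∈ V → IsChart t.sec V s →
      ∃ (V' : A'.Opens) (hle : V' ≤ G ⁻¹ᵁ V), IsAffineOpen V' ∧ i' z ∈ V' ∧
        IsConormalBasis (sectionIdeal i' V')
          (fun j => sectionRestrict i' hle (sectionMap sq V (s j)))) : Framing i' n where
  sec z j := conormalMap sq z (t.sec (w z) j)
  exists_chart z := by
    obtain ⟨V, s, hz, hc⟩ := t.exists_chart (w z)
    obtain ⟨V', hle, hV', hz', hb⟩ := H z V s hz hc
    refine ⟨V', _, hz', hV', ?_, hb⟩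
    intro y hy j
    have hy' : i (w y) ∈ V := by
      have := hle hy
      change (w ≫ i) y ∈ V
      rw [← sq]
      exact this
    change conormalMap sq y (t.sec (w y) j) = _
    rw [hc.2.1 _ hy' j, conormalMap_conormalGerm, conormalGerm_restrict]

theorem sectionIdeal_comp_openImmersion (i'' : Z'' ⟶ A') (j : Z' ⟶ Z'') [IsOpenImmersion j]
    (V : A'.Opens) (h : i'' ⁻¹ᵁ V ≤ j.opensRange) :
    sectionIdeal (j ≫ i'') V = sectionIdeal i'' V := by
  have := Scheme.Hom.isIso_app j (i'' ⁻¹ᵁ V) h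
  have hinj : Function.Injective (j.app (i'' ⁻¹ᵁ V)) :=
    ((ConcreteCategory.isIso_iff_bijective _).mp this).1
  ext x
  rw [RingHom.mem_ker, RingHom.mem_ker]
  change j.app (i'' ⁻¹ᵁ V) (i''.app V x) = 0 ↔ i''.app V x = 0
  rw [map_eq_zero_iff _ hinj]

/-- The pullback of a framing along a base change, followed by restriction to an open subscheme. -/
def Framing.pull {i : Z ⟶ A} {w₀ : Z'' ⟶ Z} {i'' : Z'' ⟶ A'} {G : A' ⟶ A} [IsClosedImmersion i]
    (h : IsPullback w₀ i'' i G)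
    {π : A ⟶ X} {π' : A' ⟶ X'} {g : X' ⟶ X} (h' : IsPullback G π' π g) [Flat (i ≫ π)]
    (j : Z' ⟶ Z'') [IsOpenImmersion j] {n : ℕ} (t : Framing i n)
    (sq : (j ≫ i'') ≫ G = (j ≫ w₀) ≫ i) : Framing (j ≫ i'') n :=
  Framing.ofCharts sq t fun z V s hz hc => by
    have hi'' : IsClosedImmersion i'' := MorphismProperty.of_isPullback h inferInstance
    obtain ⟨V₁, hle₁, hV₁, hz₁, hb⟩ := hc.2.2.baseChange h h' hc.1 (j z) hz
    let C : Set A' := i'' '' (j.opensRange : Set Z'')ᶜ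
    have hC : IsClosed C := i''.isClosedEmbedding.isClosedMap _ j.opensRange.isOpen.isClosed_compl
    obtain ⟨V', hV', hzV', hle'⟩ := exists_isAffineOpen_mem_and_subset (X := A')
      (x := (j ≫ i'') z) (U := V₁ ⊓ ⟨Cᶜ, hC.isOpen_compl⟩) ⟨hz₁, by
        rintro ⟨y, hy, hy2⟩
        have : y = j z := i''.isClosedEmbedding.injective hy2
        exact hy ⟨z, this.symm⟩⟩
    have hV'V₁ : V' ≤ V₁ := fun x hx => (hle' hx).1
    refine ⟨V', hV'V₁.trans hle₁, hV', hzV', ?_⟩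
    have hb' := hb.restrict hV₁ hV' hV'V₁
    refine isConormalBasis_of_eq (sectionIdeal_comp_openImmersion i'' j V' ?_).symm ?_ hb'
    · intro y hy
      by_contra hcon
      exact (hle' hy).2 ⟨y, hcon, rfl⟩
    · intro k
      change (A'.presheaf.map (homOfLE hle₁).op ≫ A'.presheaf.map (homOfLE hV'V₁).op) _ =
        A'.presheaf.map (homOfLE (hV'V₁.trans hle₁)).op _
      rw [← Functor.map_comp]
      rfl

theorem affineSpace_bijective (n : Type u) (A : Scheme.{u}) (V : A.Opens) (hV : IsAffineOpen V) :
    Function.Bijective (MvPolynomial.eval₂Hom ((𝔸(n; A) ↘ A).app V).hom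
      (fun k => 𝔸(n; A).presheaf.map (homOfLE le_top).op (AffineSpace.coord A k)) :
      MvPolynomial n Γ(A, V) →+* Γ(𝔸(n; A), (𝔸(n; A) ↘ A) ⁻¹ᵁ V)) := by
  have : IsAffine V.toScheme := hV
  have hpb := AffineSpace.isPullback_map (n := n) V.ι
  have hopen : IsOpenImmersion (AffineSpace.map n V.ι) :=
    MorphismProperty.of_isPullback hpb.flip inferInstance
  have hrange : (AffineSpace.map n V.ι).opensRange = (𝔸(n; A) ↘ A) ⁻¹ᵁ V := by
    ext x
    constructor
    · rintro ⟨y, rfl⟩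
      change (AffineSpace.map n V.ι ≫ 𝔸(n; A) ↘ A) y ∈ V
      rw [AffineSpace.map_over]
      exact ((𝔸(n; V.toScheme) ↘ V.toScheme) y).2
    · intro hx
      obtain ⟨y, hy, -⟩ := Scheme.exists_preimage_of_isPullback hpb x ⟨_, hx⟩ rfl
      exact ⟨y, hy⟩
  have hle : ⊤ ≤ AffineSpace.map n V.ι ⁻¹ᵁ ((𝔸(n; A) ↘ A) ⁻¹ᵁ V) := by
    rw [← hrange]; intro x _; exact ⟨x, rfl⟩
  let ψ := (AffineSpace.map n V.ι).appLE ((𝔸(n; A) ↘ A) ⁻¹ᵁ V) ⊤ hle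
  have hψ : IsIso ψ := by
    have h1 := Scheme.Hom.isIso_app (AffineSpace.map n V.ι) ((𝔸(n; A) ↘ A) ⁻¹ᵁ V) hrange.ge
    have h2 : homOfLE hle = eqToHom (top_le_iff.mp hle).symm := rfl
    have h3 : IsIso (homOfLE hle) := by rw [h2]; infer_instance
    have h4 : IsIso (𝔸(n; V.toScheme).presheaf.map (homOfLE hle).op) := inferInstance
    exact IsIso.comp_isIso' h1 h4
  have hψb : Function.Bijective ψ.hom := (ConcreteCategory.isIso_iff_bijective ψ).mp hψ
  let θ := V.ι.appLE V ⊤ (by simp)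
  have hθ : IsIso θ := inferInstance
  have hθb : Function.Bijective θ.hom := (ConcreteCategory.isIso_iff_bijective θ).mp hθ
  have h1 : Function.Bijective (MvPolynomial.eval₂Hom ((𝔸(n; V.toScheme) ↘ V.toScheme).appTop).hom
      (AffineSpace.coord V.toScheme)) := by
    have h0 := AffineSpace.isoOfIsAffine_hom_appTop (n := n) (S := V.toScheme)
    rw [← Iso.inv_comp_eq] at h0
    have hiso : IsIso (AffineSpace.isoOfIsAffine n V.toScheme).hom.appTop :=
      inferInstanceAs (IsIso ((AffineSpace.isoOfIsAffine n V.toScheme).hom.app ⊤))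
    have : IsIso (CommRingCat.ofHom (MvPolynomial.eval₂Hom
      ((𝔸(n; V.toScheme) ↘ V.toScheme).appTop).hom (AffineSpace.coord V.toScheme))) := by
      rw [← h0]; exact IsIso.comp_isIso' inferInstance hiso
    exact (ConcreteCategory.isIso_iff_bijective _).mp this
  have h2 : ψ.hom.comp (MvPolynomial.eval₂Hom ((𝔸(n; A) ↘ A).app V).hom
      (fun k => 𝔸(n; A).presheaf.map (homOfLE le_top).op (AffineSpace.coord A k))) =
      (MvPolynomial.eval₂Hom ((𝔸(n; V.toScheme) ↘ V.toScheme).appTop).hom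
      (AffineSpace.coord V.toScheme)).comp (MvPolynomial.map θ.hom) := by
    refine MvPolynomial.ringHom_ext' ?_ ?_
    · ext x
      have e : (𝔸(n; A) ↘ A).app V ≫ ψ = θ ≫ (𝔸(n; V.toScheme) ↘ V.toScheme).appTop := by
        have e1 := AffineSpace.map_over (n := n) V.ι
        have e2 : (𝔸(n; A) ↘ A).app V ≫ ψ = (AffineSpace.map n V.ι ≫ 𝔸(n; A) ↘ A).appLE V ⊤ hle := by
          rw [← Scheme.Hom.appLE_eq_app, Scheme.Hom.appLE_comp_appLE]
        have e3 : θ ≫ (𝔸(n; V.toScheme) ↘ V.toScheme).appTop =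
            ((𝔸(n; V.toScheme) ↘ V.toScheme) ≫ V.ι).appLE V ⊤ (by rw [← e1]; exact hle) := by
          have e4 : (𝔸(n; V.toScheme) ↘ V.toScheme).appTop =
              (𝔸(n; V.toScheme) ↘ V.toScheme).appLE ⊤ ⊤ le_rfl := (Scheme.Hom.appLE_eq_app ..).symm
          rw [e4]
          exact Scheme.Hom.appLE_comp_appLE ..
        rw [e2, e3]
        congr 1
      simpa using congr($e x)
    · intro k
      have e : 𝔸(n; A).presheaf.map (homOfLE le_top).op ≫ ψ = (AffineSpace.map n V.ι).appTop := by
        rw [Scheme.Hom.map_appLE, Scheme.Hom.appTop, ← Scheme.Hom.appLE_eq_app]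
        rfl
      have e2 := congr($e (AffineSpace.coord A k))
      rw [AffineSpace.map_appTop_coord] at e2
      simpa using e2
  have h3 : Function.Bijective (MvPolynomial.map (σ := n) θ.hom) :=
    ⟨MvPolynomial.map_injective _ hθb.1, MvPolynomial.map_surjective _ hθb.2⟩
  rw [← Function.Bijective.of_comp_iff' hψb]
  have h4 := h1.comp h3
  rw [← RingHom.coe_comp, ← h2] at h4
  exact h4

end

/-! ### Affine spaces and suspension -/

section

theorem IsConormalBasis.of_polynomial {B B' : Type*} [CommRing B] [CommRing B'] (φ : B →+* B')
    (t : B') (hφ : Function.Bijective (Polynomial.eval₂RingHom φ t)) {I : Ideal B} {n : ℕ}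
    {s : Fin n → I} (hs : IsConormalBasis I s) (J : Ideal B')
    (hJ : ∀ p, Polynomial.eval₂RingHom φ t p ∈ J ↔ p.coeff 0 ∈ I) (s' : Fin (n + 1) → J)
    (hs' : ∀ j : Fin n, (s' j.castSucc : B') = φ (s j : B)) (hlast : (s' (Fin.last n) : B') = t) :
    IsConormalBasis J s' := by
  let Ψ : Polynomial B ≃+* B' := RingEquiv.ofBijective _ hφ
  have hΨ : ∀ p, Ψ p = Polynomial.eval₂RingHom φ t p := fun p => rfl
  let J₀ : Ideal (Polynomial B) := J.comap (Polynomial.eval₂RingHom φ t)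
  let s₀ : Fin (n + 1) → J₀ := Fin.lastCases
    ⟨Polynomial.X, by
      change Polynomial.eval₂RingHom φ t _ ∈ J
      rw [Polynomial.coe_eval₂RingHom, Polynomial.eval₂_X, ← hlast]
      exact Subtype.prop _⟩
    (fun j => ⟨Polynomial.C (s j : B), by
      change Polynomial.eval₂RingHom φ t _ ∈ J
      rw [Polynomial.coe_eval₂RingHom, Polynomial.eval₂_C, ← hs']
      exact Subtype.prop _⟩)
  have h0 : IsConormalBasis J₀ s₀ := hs.polynomial J₀ hJ s₀ (fun j => by simp [s₀]) (by simp [s₀])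
  let _ := (Polynomial.eval₂RingHom φ t).toAlgebra
  let L : Polynomial B ≃ₗ[Polynomial B] B' :=
    { Ψ.toAddEquiv with
      map_smul' := fun r x => by
        change Ψ (r * x) = Polynomial.eval₂RingHom φ t r * Ψ x
        rw [map_mul]
        rfl }
  have : Module.Flat (Polynomial B) B' := Module.Flat.of_linearEquiv L.symm
  have h1 := h0.map_of_flat (B' := B') (fun j => ⟨_, Ideal.mem_map_of_mem _ (s₀ j).2⟩)
    (fun j => rfl)
  refine isConormalBasis_of_eq ?_ ?_ h1
  · exact Ideal.map_comap_of_surjective _ hφ.2 J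
  · intro j
    change Polynomial.eval₂RingHom φ t (s₀ j : Polynomial B) = s' j
    induction j using Fin.lastCases with
    | last => simp [s₀, hlast]
    | cast j => simp [s₀, hs']

/-- Affine `n`-space `𝔸ⁿ_X`. -/
abbrev Aff (n : ℕ) (X : Scheme.{u}) : Scheme.{u} := 𝔸(ULift.{u} (Fin n); X)

/-- The map `𝔸ⁿ_{X'} → 𝔸ⁿ_X` induced by `X' → X`. -/
abbrev affMap (n : ℕ) {X' X : Scheme.{u}} (g : X' ⟶ X) : Aff n X' ⟶ Aff n X :=
  AffineSpace.map (ULift.{u} (Fin n)) g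

/-- The projection `𝔸ⁿ⁺¹_X → 𝔸ⁿ_X` that forgets the last coordinate. -/
def affProj (n : ℕ) (X : Scheme.{u}) : Aff (n + 1) X ⟶ Aff n X :=
  AffineSpace.reindex (fun k => ⟨k.down.castSucc⟩) X

/-- The last coordinate of `𝔸ⁿ⁺¹_X`. -/
def lastCoord (n : ℕ) (X : Scheme.{u}) : Γ(Aff (n + 1) X, ⊤) :=
  AffineSpace.coord X ⟨Fin.last n⟩

/-- The closed immersion `𝔸ⁿ_X → 𝔸ⁿ⁺¹_X`, `x ↦ (x, 0)`. -/
def affZero (n : ℕ) (X : Scheme.{u}) : Aff n X ⟶ Aff (n + 1) X :=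
  AffineSpace.homOfVector (Aff n X ↘ X) fun k =>
    Fin.lastCases 0 (fun j => AffineSpace.coord X ⟨j⟩) k.down

theorem affProj_over (n : ℕ) (X : Scheme.{u}) : affProj n X ≫ (Aff n X ↘ X) = Aff (n + 1) X ↘ X :=
  AffineSpace.reindex_over _ _

theorem affZero_over (n : ℕ) (X : Scheme.{u}) : affZero n X ≫ (Aff (n + 1) X ↘ X) = Aff n X ↘ X :=
  AffineSpace.homOfVector_over _ _

theorem affZero_lastCoord (n : ℕ) (X : Scheme.{u}) : (affZero n X).appTop (lastCoord n X) = 0 := by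
  refine (AffineSpace.homOfVector_appTop_coord _ _ _).trans ?_
  simp

theorem affZero_proj (n : ℕ) (X : Scheme.{u}) : affZero n X ≫ affProj n X = 𝟙 (Aff n X) := by
  refine AffineSpace.hom_ext ?_ ?_
  · rw [Category.assoc, affProj_over, affZero_over, Category.id_comp]
  · intro k
    rw [Scheme.Hom.comp_appTop, CommRingCat.comp_apply, affProj,
      AffineSpace.reindex_appTop_coord, affZero]
    refine (AffineSpace.homOfVector_appTop_coord _ _ _).trans ?_
    simp

instance (n : ℕ) (X : Scheme.{u}) : IsAffineHom (affProj n X) := by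
  have : IsAffineHom (affProj n X ≫ (Aff n X ↘ X)) := by rw [affProj_over]; infer_instance
  exact .of_comp _ (Aff n X ↘ X)

instance (n : ℕ) (X : Scheme.{u}) : IsClosedImmersion (affZero n X) := by
  have : IsClosedImmersion (affZero n X ≫ affProj n X) := by rw [affZero_proj]; infer_instance
  exact .of_comp _ (affProj n X)

theorem affMap_proj (n : ℕ) {X' X : Scheme.{u}} (g : X' ⟶ X) :
    affMap (n + 1) g ≫ affProj n X = affProj n X' ≫ affMap n g :=
  AffineSpace.map_reindex _ _

theorem affMap_lastCoord (n : ℕ) {X' X : Scheme.{u}} (g : X' ⟶ X) :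
    (affMap (n + 1) g).appTop (lastCoord n X) = lastCoord n X' :=
  AffineSpace.map_appTop_coord _ _

theorem aff_hom_ext {n : ℕ} {T X : Scheme.{u}} {a b : T ⟶ Aff (n + 1) X}
    (h : a ≫ affProj n X = b ≫ affProj n X)
    (h' : a.appTop (lastCoord n X) = b.appTop (lastCoord n X)) : a = b := by
  refine AffineSpace.hom_ext ?_ ?_
  · rw [← affProj_over, reassoc_of% h]
  · rintro ⟨k⟩
    induction k using Fin.lastCases with
    | last => exact h'
    | cast k =>
      have e : (affProj n X).appTop (AffineSpace.coord X ⟨k⟩) =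
        AffineSpace.coord X ⟨k.castSucc⟩ := AffineSpace.reindex_appTop_coord _ _ _
      rw [← e, ← CommRingCat.comp_apply, ← CommRingCat.comp_apply, ← Scheme.Hom.comp_appTop,
        ← Scheme.Hom.comp_appTop, h]

theorem affMap_zero (n : ℕ) {X' X : Scheme.{u}} (g : X' ⟶ X) :
    affMap n g ≫ affZero n X = affZero n X' ≫ affMap (n + 1) g := by
  refine aff_hom_ext ?_ ?_
  · rw [Category.assoc, affZero_proj, Category.assoc, affMap_proj, Category.comp_id,
      ← Category.assoc, affZero_proj, Category.id_comp]
  · rw [Scheme.Hom.comp_appTop, Scheme.Hom.comp_appTop, CommRingCat.comp_apply,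
      CommRingCat.comp_apply, affZero_lastCoord, map_zero, affMap_lastCoord, affZero_lastCoord]

/-- `𝔸ⁿ⁺¹_X` is the affine line over `𝔸ⁿ_X`. -/
def affSuccIso (n : ℕ) (X : Scheme.{u}) : Aff (n + 1) X ≅ 𝔸(PUnit.{u + 1}; Aff n X) where
  hom := AffineSpace.homOfVector (affProj n X) fun _ => lastCoord n X
  inv := AffineSpace.homOfVector ((𝔸(PUnit.{u + 1}; Aff n X) ↘ Aff n X) ≫ (Aff n X ↘ X)) fun k =>
    Fin.lastCases (AffineSpace.coord _ PUnit.unit)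
      (fun j => (𝔸(PUnit.{u + 1}; Aff n X) ↘ Aff n X).appTop (AffineSpace.coord X ⟨j⟩)) k.down
  hom_inv_id := by
    refine AffineSpace.hom_ext ?_ ?_
    · rw [Category.assoc, AffineSpace.homOfVector_over, AffineSpace.homOfVector_over_assoc,
        affProj_over, Category.id_comp]
    · rintro ⟨k⟩
      rw [Scheme.Hom.comp_appTop, CommRingCat.comp_apply, AffineSpace.homOfVector_appTop_coord]
      induction k using Fin.lastCases with
      | last =>
        simp only [Fin.lastCases_last]
        rw [AffineSpace.homOfVector_appTop_coord]
        rfl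
      | cast k =>
        simp only [Fin.lastCases_castSucc]
        rw [← CommRingCat.comp_apply, ← Scheme.Hom.comp_appTop, AffineSpace.homOfVector_over]
        exact AffineSpace.reindex_appTop_coord _ _ _
  inv_hom_id := by
    refine AffineSpace.hom_ext ?_ ?_
    · rw [Category.assoc, AffineSpace.homOfVector_over, Category.id_comp]
      refine AffineSpace.hom_ext ?_ ?_
      · rw [Category.assoc, affProj_over, AffineSpace.homOfVector_over]
      · rintro ⟨k⟩
        rw [Scheme.Hom.comp_appTop, CommRingCat.comp_apply, affProj,
          AffineSpace.reindex_appTop_coord, AffineSpace.homOfVector_appTop_coord]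
        simp
    · intro k
      rw [Scheme.Hom.comp_appTop, CommRingCat.comp_apply, AffineSpace.homOfVector_appTop_coord,
        lastCoord, AffineSpace.homOfVector_appTop_coord]
      simp

theorem affProj_bijective (n : ℕ) (X : Scheme.{u}) (V : (Aff n X).Opens) (hV : IsAffineOpen V) :
    Function.Bijective (Polynomial.eval₂RingHom ((affProj n X).app V).hom
      ((Aff (n + 1) X).presheaf.map (homOfLE le_top).op (lastCoord n X)) :
      Polynomial Γ(Aff n X, V) →+* Γ(Aff (n + 1) X, affProj n X ⁻¹ᵁ V)) := by
  have key : ∀ (p : Aff (n + 1) X ⟶ Aff n X) (t : Γ(Aff (n + 1) X, ⊤))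
      (hp : p = (affSuccIso n X).hom ≫ (𝔸(PUnit.{u + 1}; Aff n X) ↘ Aff n X))
      (ht : t = (affSuccIso n X).hom.appTop (AffineSpace.coord _ PUnit.unit)),
      Function.Bijective (Polynomial.eval₂RingHom (p.app V).hom
      ((Aff (n + 1) X).presheaf.map (homOfLE le_top).op t) :
      Polynomial Γ(Aff n X, V) →+* Γ(Aff (n + 1) X, p ⁻¹ᵁ V)) := by
    rintro _ _ rfl rfl
    have h1 := affineSpace_bijective PUnit.{u + 1} (Aff n X) V hV
    have h2 : Function.Bijective ((affSuccIso n X).hom.app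
        ((𝔸(PUnit.{u + 1}; Aff n X) ↘ Aff n X) ⁻¹ᵁ V)).hom :=
      (ConcreteCategory.isIso_iff_bijective _).mp inferInstance
    have h3 := (MvPolynomial.uniqueAlgEquiv Γ(Aff n X, V) PUnit.{u + 1}).symm.bijective
    have h4 := h2.comp (h1.comp h3)
    refine (congrArg Function.Bijective ?_).mpr h4
    let R : Polynomial Γ(Aff n X, V) →+* Γ(Aff (n + 1) X, ((affSuccIso n X).hom ≫
        (𝔸(PUnit.{u + 1}; Aff n X) ↘ Aff n X)) ⁻¹ᵁ V) :=
      ((affSuccIso n X).hom.app ((𝔸(PUnit.{u + 1}; Aff n X) ↘ Aff n X) ⁻¹ᵁ V)).hom.comp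
        ((MvPolynomial.eval₂Hom ((𝔸(PUnit.{u + 1}; Aff n X) ↘ Aff n X).app V).hom (fun k =>
          𝔸(PUnit.{u + 1}; Aff n X).presheaf.map (homOfLE le_top).op
            (AffineSpace.coord (Aff n X) k))).comp
        (MvPolynomial.uniqueAlgEquiv Γ(Aff n X, V) PUnit.{u + 1}).symm.toRingEquiv.toRingHom)
    change _ = ⇑R
    congr 1
    refine Polynomial.ringHom_ext ?_ ?_
    · intro a
      have hC : (MvPolynomial.uniqueAlgEquiv Γ(Aff n X, V) PUnit.{u + 1}).symm (Polynomial.C a) =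
        MvPolynomial.C a := by
        rw [AlgEquiv.symm_apply_eq]; simp
      have h5 : R (Polynomial.C a) = (affSuccIso n X).hom.app _
          (MvPolynomial.eval₂Hom ((𝔸(PUnit.{u + 1}; Aff n X) ↘ Aff n X).app V).hom (fun k =>
          𝔸(PUnit.{u + 1}; Aff n X).presheaf.map (homOfLE le_top).op
            (AffineSpace.coord (Aff n X) k)) (MvPolynomial.C a)) := by
        rw [← hC]; rfl
      rw [h5, Polynomial.coe_eval₂RingHom, Polynomial.eval₂_C, MvPolynomial.eval₂Hom_C]
      rfl
    · have hX : (MvPolynomial.uniqueAlgEquiv Γ(Aff n X, V) PUnit.{u + 1}).symm Polynomial.X =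
          MvPolynomial.X PUnit.unit := by
        rw [AlgEquiv.symm_apply_eq]; simp
      have h5 : R Polynomial.X = (affSuccIso n X).hom.app _
          (MvPolynomial.eval₂Hom ((𝔸(PUnit.{u + 1}; Aff n X) ↘ Aff n X).app V).hom (fun k =>
          𝔸(PUnit.{u + 1}; Aff n X).presheaf.map (homOfLE le_top).op
            (AffineSpace.coord (Aff n X) k)) (MvPolynomial.X PUnit.unit)) := by
        rw [← hX]; rfl
      rw [h5, Polynomial.coe_eval₂RingHom, Polynomial.eval₂_X, MvPolynomial.eval₂Hom_X']
      have h6 := (affSuccIso n X).hom.naturality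
        (homOfLE (le_top (a := (𝔸(PUnit.{u + 1}; Aff n X) ↘ Aff n X) ⁻¹ᵁ V))).op
      exact congr($h6 (AffineSpace.coord (Aff n X) PUnit.unit)).symm
  exact key _ _ (AffineSpace.homOfVector_over (affProj n X) fun _ => lastCoord n X).symm
    (AffineSpace.homOfVector_appTop_coord (affProj n X) (fun _ => lastCoord n X) _).symm

theorem affZero_square (n : ℕ) {Z X : Scheme.{u}} (i : Z ⟶ Aff n X) :
    (i ≫ affZero n X) ≫ affProj n X = 𝟙 Z ≫ i := by
  rw [Category.assoc, affZero_proj, Category.comp_id, Category.id_comp]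

/-- The last coordinate as a function vanishing on `Z ⊆ 𝔸ⁿ_X ⊆ 𝔸ⁿ⁺¹_X`. -/
def lastSection (n : ℕ) {Z X : Scheme.{u}} (i : Z ⟶ Aff n X) (V' : (Aff (n + 1) X).Opens) :
    sectionIdeal (i ≫ affZero n X) V' :=
  ⟨(Aff (n + 1) X).presheaf.map (homOfLE le_top).op (lastCoord n X), by
    change ((Aff (n + 1) X).presheaf.map (homOfLE le_top).op ≫ (i ≫ affZero n X).app V')
      (lastCoord n X) = 0
    rw [Scheme.Hom.naturality, CommRingCat.comp_apply]
    have h : (i ≫ affZero n X).app ⊤ (lastCoord n X) = 0 := by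
      change i.app _ ((affZero n X).appTop (lastCoord n X)) = 0
      rw [affZero_lastCoord, map_zero]
    rw [h, map_zero]⟩

/-- The framing `(t_1, …, t_n, x_{n+1})` of `Z ⊆ 𝔸ⁿ_X ⊆ 𝔸ⁿ⁺¹_X`. -/
def Framing.suspend {n : ℕ} {Z X : Scheme.{u}} {i : Z ⟶ Aff n X} (t : Framing i n) :
    Framing (i ≫ affZero n X) (n + 1) where
  sec z := Fin.lastCases (conormalGerm (i ≫ affZero n X) ⊤ z trivial (lastSection n i ⊤))
    (fun j => conormalMap (affZero_square n i) z (t.sec z j))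
  exists_chart z := by
    obtain ⟨V, s, hz, hV, hs, hb⟩ := t.exists_chart z
    refine ⟨affProj n X ⁻¹ᵁ V, Fin.lastCases (lastSection n i _)
      (fun j => sectionMap (affZero_square n i) V (s j)), ?_, hV.preimage _, ?_, ?_⟩
    · exact mem_preimage_of_square (affZero_square n i) (w := 𝟙 Z) hz
    · intro y hy j
      induction j using Fin.lastCases with
      | last =>
        simp only [Fin.lastCases_last]
        rw [← conormalGerm_restrict (i ≫ affZero n X) le_top y hy (lastSection n i ⊤)]
        congr 1
        apply Subtype.ext
        change ((Aff (n + 1) X).presheaf.map (homOfLE le_top).op ≫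
          (Aff (n + 1) X).presheaf.map (homOfLE le_top).op) (lastCoord n X) = _
        rw [← Functor.map_comp]
        rfl
      | cast j =>
        simp only [Fin.lastCases_castSucc]
        have hy' : i y ∈ V := by
          have : ((i ≫ affZero n X) ≫ affProj n X) y ∈ V := hy
          rw [affZero_square] at this
          exact this
        rw [hs y hy']
        exact conormalMap_conormalGerm (affZero_square n i) y V hy' (s j)
    · refine hb.of_polynomial _ _ (affProj_bijective n X V hV) _ ?_ _ ?_ ?_
      · intro p
        have h0 : (i ≫ affZero n X).app (affProj n X ⁻¹ᵁ V)
            ((Aff (n + 1) X).presheaf.map (homOfLE le_top).op (lastCoord n X)) = 0 :=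
          (lastSection n i (affProj n X ⁻¹ᵁ V)).2
        rw [RingHom.mem_ker, RingHom.mem_ker, Polynomial.coe_eval₂RingHom, Polynomial.hom_eval₂]
        change Polynomial.eval₂ _ ((i ≫ affZero n X).app (affProj n X ⁻¹ᵁ V)
          ((Aff (n + 1) X).presheaf.map (homOfLE le_top).op (lastCoord n X))) p = 0 ↔ _
        rw [h0, Polynomial.eval₂_at_zero]
        have key : ∀ f g : Z ⟶ Aff n X, f = g →
            (f.app V (p.coeff 0) = 0 ↔ g.app V (p.coeff 0) = 0) := by
          rintro f _ rfl
          rfl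
        refine (key ((i ≫ affZero n X) ≫ affProj n X) i ?_)
        rw [affZero_square, Category.id_comp]
      · intro j
        simp only [Fin.lastCases_castSucc]
        rfl
      · simp only [Fin.lastCases_last]
        rfl

end

/-! ### Syntomic morphisms -/

section

/-- A chart near `y` exhibiting `F` as a local complete intersection over `K`: an open immersion
`Spec Q → F` over `K` hitting `y`, where `Q = P / (r₁, …, r_c)` is the quotient of a smooth
`K`-algebra `P` by a regular sequence. -/
def HasLciChart {K : CommRingCat.{u}} {F : Scheme.{u}} (p : F ⟶ Spec K) (y : F) : Prop :=
  ∃ (P Q : CommRingCat.{u}) (φ : K ⟶ P) (q : P ⟶ Q) (rs : List P) (j : Spec Q ⟶ F),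
    φ.hom.Smooth ∧ Function.Surjective q.hom ∧ RingHom.ker q.hom = Ideal.ofList rs ∧
      RingTheory.Sequence.IsWeaklyRegular P rs ∧ IsOpenImmersion j ∧ y ∈ Set.range j ∧
      j ≫ p = Spec.map (φ ≫ q)

/-- A morphism `p : F → Spec K`, `K` a field, is a local complete intersection if locally on `F` it
factors as a regular closed immersion followed by a smooth morphism. -/
def IsLci {K : CommRingCat.{u}} {F : Scheme.{u}} (p : F ⟶ Spec K) : Prop :=
  ∀ y : F, HasLciChart p y

/-- Syntomic morphisms: flat, locally of finite presentation, and with fibers that are local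
complete intersections. -/
structure IsSyntomic {Z X : Scheme.{u}} (f : Z ⟶ X) : Prop where
  flat : Flat f
  locallyOfFinitePresentation : LocallyOfFinitePresentation f
  isLci_fiber : ∀ x : X, IsLci (f.fiberToSpecResidueField x)

theorem isWeaklyRegular_map {P P' : CommRingCat.{u}} (α : P ⟶ P') (hα : α.hom.Flat) {rs : List P}
    (h : RingTheory.Sequence.IsWeaklyRegular P rs) :
    RingTheory.Sequence.IsWeaklyRegular P' (rs.map α.hom) := by
  let _ := α.hom.toAlgebra
  have : Module.Flat P P' := hα
  exact h.of_flat

theorem flat_of_isPushout {A B A' B' : CommRingCat.{u}} {f : A ⟶ B} {g : A ⟶ A'} {f' : A' ⟶ B'}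
    {g' : B ⟶ B'} (h : IsPushout f g g' f') (hf : f.hom.Flat) : f'.hom.Flat := by
  rw [← Flat.SpecMap_iff] at hf ⊢
  exact MorphismProperty.of_isPullback (P := @Flat) (isPullback_SpecMap_of_isPushout _ _ _ _ h) hf

theorem surjective_of_isPushout {A B A' B' : CommRingCat.{u}} {f : A ⟶ B} {g : A ⟶ A'}
    {f' : A' ⟶ B'} {g' : B ⟶ B'} (h : IsPushout f g g' f') (hf : Function.Surjective f.hom) :
    Function.Surjective f'.hom := by
  have h1 : IsClosedImmersion (Spec.map f) := IsClosedImmersion.spec_of_surjective f hf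
  have h2 : IsClosedImmersion (Spec.map f') :=
    MorphismProperty.of_isPullback (isPullback_SpecMap_of_isPushout _ _ _ _ h) h1
  have h3 := (IsClosedImmersion.isAffine_surjective_of_isAffine (Spec.map f')).2
  have h4 : f' = (Scheme.ΓSpecIso A').inv ≫ (Spec.map f').appTop ≫ (Scheme.ΓSpecIso B').hom := by
    rw [← Category.assoc, ← Scheme.ΓSpecIso_inv_naturality, Category.assoc, Iso.inv_hom_id,
      Category.comp_id]
  rw [h4]
  exact ((ConcreteCategory.isIso_iff_bijective (Scheme.ΓSpecIso B').hom).mp inferInstance).2.comp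
    (h3.comp ((ConcreteCategory.isIso_iff_bijective (Scheme.ΓSpecIso A').inv).mp inferInstance).2)

theorem IsLci.baseChange {K K' : CommRingCat.{u}} {F F' : Scheme.{u}} {p : F ⟶ Spec K}
    {p' : F' ⟶ Spec K'} {κ : K ⟶ K'} {w : F' ⟶ F} (h : IsPullback w p' p (Spec.map κ))
    (hκ : κ.hom.Flat) (hp : IsLci p) : IsLci p' := by
  intro y
  obtain ⟨P, Q, φ, q, rs, j, hφ, hq, hker, hreg, hj, ⟨y₀, hy₀⟩, hjp⟩ := hp (w y)
  have po₁ := IsPushout.of_hasPushout φ κ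
  have po₂ := IsPushout.of_hasPushout q (pushout.inl φ κ)
  have po := po₁.paste_horiz po₂
  have pb := isPullback_SpecMap_of_isPushout _ _ _ _ po
  let j' : Spec (pushout q (pushout.inl φ κ)) ⟶ F' := h.lift (Spec.map (pushout.inl _ _) ≫ j)
    (Spec.map (pushout.inr φ κ ≫ pushout.inr _ _)) (by rw [Category.assoc, hjp, pb.w])
  have hj' : IsPullback j' (Spec.map (pushout.inl q (pushout.inl φ κ))) w j := by
    refine IsPullback.of_right (h₁₂ := p') (h₂₂ := p) (v₁₃ := Spec.map κ) ?_ (h.lift_fst _ _ _)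
      h.flip
    rw [h.lift_snd, hjp]
    exact pb.flip
  refine ⟨_, _, pushout.inr φ κ, pushout.inr q (pushout.inl φ κ), rs.map (pushout.inl φ κ).hom, j',
    ?_, surjective_of_isPushout po₂ hq, ?_, ?_, ?_, ?_, h.lift_snd _ _ _⟩
  · rw [← HasRingHomProperty.Spec_iff (P := @Smooth)] at hφ ⊢
    exact MorphismProperty.of_isPullback (P := @Smooth)
      (isPullback_SpecMap_of_isPushout _ _ _ _ po₁) hφ
  · rw [ker_eq_map_of_isPushout po₂ hq, hker, Ideal.map_ofList]
  · exact isWeaklyRegular_map _ (flat_of_isPushout po₁.flip hκ) hreg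
  · exact MorphismProperty.of_isPullback hj'.flip hj
  · obtain ⟨x, hx, -⟩ := Scheme.exists_preimage_of_isPullback hj' y y₀ hy₀.symm
    exact ⟨x, hx⟩

theorem HasLciChart.restrict {K : CommRingCat.{u}} {F F' : Scheme.{u}} {p : F ⟶ Spec K}
    (o : F' ⟶ F) [IsOpenImmersion o] {y : F'} (h : HasLciChart p (o y)) :
    HasLciChart (o ≫ p) y := by
  obtain ⟨P, Q, φ, q, rs, j, hφ, hq, hker, hreg, hj, ⟨y₀, hy₀⟩, hjp⟩ := h
  obtain ⟨_, ⟨a, rfl⟩, hya, hle⟩ :=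
    PrimeSpectrum.isTopologicalBasis_basic_opens.exists_subset_of_mem_open
      (u := (j ⁻¹ᵁ o.opensRange : Set (Spec Q))) (a := y₀) ⟨y, hy₀.symm⟩
      (j ⁻¹ᵁ o.opensRange).isOpen
  obtain ⟨b, rfl⟩ := hq a
  let α : P ⟶ CommRingCat.of (Localization.Away b) := CommRingCat.ofHom (algebraMap _ _)
  have hα : IsOpenImmersion (Spec.map α) := inferInstance
  have hrange : Set.range (Spec.map α) = (PrimeSpectrum.basicOpen b : Set (PrimeSpectrum P)) :=
    PrimeSpectrum.localization_away_comap_range _ b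
  have po := IsPushout.of_hasPushout q α
  have pb := isPullback_SpecMap_of_isPushout _ _ _ _ po
  have hβ : IsOpenImmersion (Spec.map (pushout.inl q α)) :=
    MorphismProperty.of_isPullback pb.flip hα
  have hsub : Set.range (Spec.map (pushout.inl q α) ≫ j) ⊆ Set.range o := by
    rintro _ ⟨z, rfl⟩
    have h1 : Spec.map α (Spec.map (pushout.inr q α) z) ∈ Set.range (Spec.map α) := ⟨_, rfl⟩
    rw [hrange] at h1
    have h2 : Spec.map α (Spec.map (pushout.inr q α) z) =
        Spec.map q (Spec.map (pushout.inl q α) z) := by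
      change (Spec.map (pushout.inr q α) ≫ Spec.map α) z =
        (Spec.map (pushout.inl q α) ≫ Spec.map q) z
      rw [pb.w]
    rw [h2] at h1
    exact hle h1
  refine ⟨_, _, φ ≫ α, pushout.inr q α, rs.map α.hom,
    IsOpenImmersion.lift o (Spec.map (pushout.inl q α) ≫ j) hsub, ?_,
    surjective_of_isPushout po hq, ?_, ?_, ?_, ?_, ?_⟩
  · rw [← HasRingHomProperty.Spec_iff (P := @Smooth)] at hφ ⊢
    rw [Spec.map_comp]
    infer_instance
  · rw [ker_eq_map_of_isPushout po hq, hker, Ideal.map_ofList]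
  · exact isWeaklyRegular_map _ ((Flat.SpecMap_iff).mp inferInstance) hreg
  · infer_instance
  · obtain ⟨x, hx⟩ : Spec.map q y₀ ∈ Set.range (Spec.map α) := by
      rw [hrange]; exact hya
    obtain ⟨z, hz, -⟩ := Scheme.exists_preimage_of_isPullback pb y₀ x hx.symm
    refine ⟨z, ?_⟩
    apply o.isOpenEmbedding.injective
    change (IsOpenImmersion.lift o (Spec.map (pushout.inl q α) ≫ j) hsub ≫ o) z = _
    rw [IsOpenImmersion.lift_fac]
    change j (Spec.map (pushout.inl q α) z) = _
    exact (congrArg j hz).trans hy₀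
  · rw [← Category.assoc, IsOpenImmersion.lift_fac, Category.assoc, hjp, ← Spec.map_comp]
    congr 1
    rw [Category.assoc, Category.assoc, po.w]

theorem IsLci.restrict {K : CommRingCat.{u}} {F F' : Scheme.{u}} {p : F ⟶ Spec K}
    (o : F' ⟶ F) [IsOpenImmersion o] (h : IsLci p) : IsLci (o ≫ p) :=
  fun y => (h (o y)).restrict o

theorem IsSyntomic.baseChange {Z Z' X X' : Scheme.{u}} {w : Z' ⟶ Z} {f' : Z' ⟶ X'} {f : Z ⟶ X}
    {g : X' ⟶ X} (h : IsPullback w f' f g) (hf : IsSyntomic f) : IsSyntomic f' where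
  flat := MorphismProperty.of_isPullback h hf.flat
  locallyOfFinitePresentation :=
    MorphismProperty.of_isPullback h hf.locallyOfFinitePresentation
  isLci_fiber x := by
    refine (hf.isLci_fiber (g x)).baseChange (isPullback_fiberToSpecResidueField_of_isPullback h x)
      ?_
    let _ := (g.residueFieldMap x).hom.toAlgebra
    exact (inferInstance : Module.Flat (X.residueField (g x)) (X'.residueField x))

theorem IsSyntomic.restrict {Z Z' X : Scheme.{u}} {f : Z ⟶ X} (hf : IsSyntomic f) (o : Z' ⟶ Z)
    [IsOpenImmersion o] : IsSyntomic (o ≫ f) where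
  flat := have := hf.flat; inferInstance
  locallyOfFinitePresentation := have := hf.locallyOfFinitePresentation; inferInstance
  isLci_fiber x := by
    have h1 : IsPullback ((o ≫ f).fiberι x) ((o ≫ f).fiberToSpecResidueField x) (o ≫ f)
      (X.fromSpecResidueField x) := IsPullback.of_hasPullback _ _
    have h2 : IsPullback (f.fiberι x) (f.fiberToSpecResidueField x) f
      (X.fromSpecResidueField x) := IsPullback.of_hasPullback _ _
    let e := h2.lift ((o ≫ f).fiberι x ≫ o) ((o ≫ f).fiberToSpecResidueField x)
      (by rw [Category.assoc, h1.w])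
    have h3 : IsPullback e ((o ≫ f).fiberι x) (f.fiberι x) o := by
      refine IsPullback.of_right (h₁₂ := f.fiberToSpecResidueField x) (h₂₂ := f)
        (v₁₃ := X.fromSpecResidueField x) ?_ (h2.lift_fst _ _ _) h2.flip
      rw [h2.lift_snd]
      exact h1.flip
    have he : IsOpenImmersion e := MorphismProperty.of_isPullback h3.flip inferInstance
    have h4 := (hf.isLci_fiber x).restrict e
    rwa [h2.lift_snd] at h4

end

/-! ### Compatibility of framings with suspension -/

section

theorem Framing.IsInduced.of_comp {Z Z' Z'' A A' A'' : Scheme.{u}} {i : Z ⟶ A} {i' : Z' ⟶ A'}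
    {i'' : Z'' ⟶ A''} {w : Z' ⟶ Z} {G : A' ⟶ A} {w' : Z'' ⟶ Z'} {G' : A'' ⟶ A'}
    {sq : i' ≫ G = w ≫ i} {n : ℕ} {t : Framing i n} {t' : Framing i' n} {t'' : Framing i'' n}
    {w₀ : Z'' ⟶ Z} {G₀ : A'' ⟶ A} {sq₀ : i'' ≫ G₀ = w₀ ≫ i}
    (h₀ : Framing.IsInduced sq₀ t'' t) (h : Framing.IsInduced sq t' t)
    (sq' : i'' ≫ G' = w' ≫ i') (hw : w₀ = w' ≫ w) (hG : G₀ = G' ≫ G) :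
    Framing.IsInduced sq' t'' t' := by
  subst hw hG
  intro z j
  rw [h₀ z j, h (w' z) j]
  obtain ⟨V, s, hz, -, hs, -⟩ := t.exists_chart (w (w' z))
  rw [hs _ hz, hs ((w' ≫ w) z) (by simpa using hz), conormalMap_conormalGerm,
    conormalMap_conormalGerm, conormalMap_conormalGerm]
  rfl

theorem Framing.IsInduced.suspend {n : ℕ} {Z Z' X X' : Scheme.{u}} {i : Z ⟶ Aff n X}
    {i' : Z' ⟶ Aff n X'} {w : Z' ⟶ Z} {g : X' ⟶ X} {sq : i' ≫ affMap n g = w ≫ i}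
    {t : Framing i n} {t' : Framing i' n} (h : Framing.IsInduced sq t' t)
    (sq' : (i' ≫ affZero n X') ≫ affMap (n + 1) g = w ≫ (i ≫ affZero n X)) :
    Framing.IsInduced sq' t'.suspend t.suspend := by
  intro z j
  induction j using Fin.lastCases with
  | last =>
    simp only [Framing.suspend, Fin.lastCases_last]
    refine Eq.trans ?_ (conormalMap_conormalGerm sq' z ⊤ trivial (lastSection n i ⊤)).symm
    change conormalGerm _ ⊤ _ _ _ = conormalGerm _ ⊤ _ _ _
    congr 1
    apply Subtype.ext
    have e := affMap_lastCoord n g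
    change (Aff (n + 1) X').presheaf.map (𝟙 _) (lastCoord n X') =
      (affMap (n + 1) g).appTop ((Aff (n + 1) X).presheaf.map (𝟙 _) (lastCoord n X))
    simp only [CategoryTheory.Functor.map_id, CommRingCat.id_apply]
    exact e.symm
  | cast j =>
    simp only [Framing.suspend, Fin.lastCases_castSucc]
    rw [h z j]
    obtain ⟨V, s, hz, -, hs, -⟩ := t.exists_chart (w z)
    rw [hs _ hz, conormalMap_conormalGerm]
    refine (conormalMap_conormalGerm (affZero_square n i') z (affMap n g ⁻¹ᵁ V)
      (mem_preimage_of_square sq hz) (sectionMap sq V (s j))).trans ?_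
    refine Eq.trans ?_ (congrArg (conormalMap sq' z)
      (conormalMap_conormalGerm (affZero_square n i) (w z) V hz (s j)).symm)
    refine Eq.trans ?_ (conormalMap_conormalGerm sq' z (affProj n X ⁻¹ᵁ V)
      (mem_preimage_of_square (affZero_square n i) (w := 𝟙 Z) hz)
      (sectionMap (affZero_square n i) V (s j))).symm
    have key : ∀ (f₁ f₂ : Aff (n + 1) X' ⟶ Aff n X) (hf : f₁ = f₂) (x : Γ(Aff n X, V))
      (s₁ : sectionIdeal (i' ≫ affZero n X') (f₁ ⁻¹ᵁ V))
      (s₂ : sectionIdeal (i' ≫ affZero n X') (f₂ ⁻¹ᵁ V))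
      (hs₁ : s₁.1 = f₁.app V x) (hs₂ : s₂.1 = f₂.app V x) (h1) (h2),
      conormalGerm _ _ z h1 s₁ = conormalGerm _ _ z h2 s₂ := by
      rintro f₁ _ rfl x s₁ s₂ hs₁ hs₂ h1 h2
      congr 1
      exact Subtype.ext (hs₁.trans hs₂.symm)
    exact key (affProj n X' ≫ affMap n g) (affMap (n + 1) g ≫ affProj n X) (affMap_proj n g).symm
      (s j).1 _ _ rfl rfl _ _

end

/-! ### Normally framed correspondences -/

section

variable {S : Scheme.{u}}

/-- The `S`-scheme `Y_+ = Y ⨿ S`. -/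
abbrev plus (Y : Over S) : Over S := Y ⨿ Over.mk (𝟙 S)

/-- The category of pointed `S`-schemes of the form `Y_+`, with pointed morphisms; its objects are
given by the `S`-schemes `Y`. -/
abbrev SchPt (S : Scheme.{u}) : Type (u + 1) :=
  InducedCategory (Under (Over.mk (𝟙 S)))
    (fun Y : Over S => Under.mk (coprod.inr : Over.mk (𝟙 S) ⟶ plus Y))

/-- The `S`-scheme `Y` underlying `Y_+`. -/
abbrev SchPt.sch (Y : SchPt S) : Over S := Y

/-- The pointed `S`-scheme `Y_+`. -/
abbrev SchPt.of (Y : Over S) : SchPt S := Y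

/-- The underlying morphism `Y_+ → Y'_+` of a pointed morphism. -/
abbrev plusMap {Y Y' : SchPt S} (p : Y ⟶ Y') : plus Y.sch ⟶ plus Y'.sch :=
  p.hom.right

/-- The pointed morphism given by a morphism `Y_+ → Y'_+` that preserves the base point. -/
def SchPt.mkHom {Y Y' : Over S} (f : plus Y ⟶ plus Y') (hf : coprod.inr ≫ f = coprod.inr) :
    SchPt.of Y ⟶ SchPt.of Y' :=
  InducedCategory.homMk (Under.homMk f hf)

theorem inr_plusMap {Y Y' : SchPt S} (p : Y ⟶ Y') :
    (coprod.inr : Over.mk (𝟙 S) ⟶ plus Y.sch) ≫ plusMap p = coprod.inr :=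
  Under.w p.hom

theorem plusMap_id (Y : SchPt S) : plusMap (𝟙 Y) = 𝟙 _ := rfl

theorem plusMap_comp {Y Y' Y'' : SchPt S} (p : Y ⟶ Y') (p' : Y' ⟶ Y'') :
    plusMap (p ≫ p') = plusMap p ≫ plusMap p' := rfl

/-- The inclusion `Y → Y_+` of schemes. -/
abbrev inclPlus (Y : Over S) : Y.left ⟶ (plus Y).left := (coprod.inl : Y ⟶ plus Y).left

/-- The base point `S → Y_+` of schemes. -/
abbrev basePlus (Y : Over S) : S ⟶ (plus Y).left :=
  (coprod.inr : Over.mk (𝟙 S) ⟶ plus Y).left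

/-- The restriction `Y → Y'_+` of a pointed morphism `Y_+ → Y'_+`. -/
abbrev plusRes {Y Y' : SchPt S} (p : Y ⟶ Y') : Y.sch.left ⟶ (plus Y'.sch).left :=
  inclPlus Y.sch ≫ (plusMap p).left

/-- The underlying scheme of `Y_+` is the disjoint union of those of `Y` and `S`. -/
def plusIso (Y : Over S) : (Y.left ⨿ S : Scheme.{u}) ≅ (plus Y).left :=
  PreservesColimitPair.iso (Over.forget S) Y (Over.mk (𝟙 S))

theorem inclPlus_eq (Y : Over S) : inclPlus Y = coprod.inl ≫ (plusIso Y).hom :=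
  (coprodComparison_inl (Over.forget S) (A := Y) (B := Over.mk (𝟙 S))).symm

theorem basePlus_eq (Y : Over S) : basePlus Y = coprod.inr ≫ (plusIso Y).hom :=
  (coprodComparison_inr (Over.forget S) (A := Y) (B := Over.mk (𝟙 S))).symm

instance (Y : Over S) : IsOpenImmersion (inclPlus Y) := by
  rw [inclPlus_eq]; infer_instance

instance (Y : Over S) : IsOpenImmersion (basePlus Y) := by
  rw [basePlus_eq]; infer_instance

theorem isCompl_range_plus (Y : Over S) :
    IsCompl (Set.range (inclPlus Y)) (Set.range (basePlus Y)) := by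
  have h := isCompl_range_inl_inr Y.left S
  have hb : Function.Bijective (plusIso Y).hom := (plusIso Y).hom.homeomorph.bijective
  have e₁ : Set.range (inclPlus Y) = (plusIso Y).hom '' Set.range (coprod.inl : Y.left ⟶ _) := by
    rw [inclPlus_eq, ← Set.range_comp]; rfl
  have e₂ : Set.range (basePlus Y) = (plusIso Y).hom '' Set.range (coprod.inr : S ⟶ _) := by
    rw [basePlus_eq, ← Set.range_comp]; rfl
  rw [e₁, e₂]
  refine ⟨(Set.disjoint_image_iff hb.1).mpr h.disjoint, ?_⟩
  have h2 := h.sup_eq_top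
  change _ ∪ _ = Set.univ at h2
  rw [codisjoint_iff]
  change _ ∪ _ = Set.univ
  rw [← Set.image_union, h2, Set.image_univ, hb.2.range_eq]

instance (Y : Over S) : IsClosedImmersion (inclPlus Y) := by
  refine IsClosedImmersion.of_isPreimmersion _ ?_
  rw [(isCompl_range_plus Y).eq_compl]
  exact (basePlus Y).isOpenEmbedding.isOpen_range.isClosed_compl

/-- A point of `Y_+` over which a pointed morphism lands in `Y'` lies in `Y`. -/
theorem mem_range_inclPlus {Y Y' : SchPt S} (p : Y ⟶ Y') (y : (plus Y.sch).left)
    (hy : (plusMap p).left y ∈ Set.range (inclPlus Y'.sch)) :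
    y ∈ Set.range (inclPlus Y.sch) := by
  by_contra hcon
  have h1 : y ∈ Set.range (basePlus Y.sch) := by
    rw [← (isCompl_range_plus Y.sch).compl_eq]
    exact hcon
  obtain ⟨x, rfl⟩ := h1
  have h2 : (plusMap p).left (basePlus Y.sch x) = basePlus Y'.sch x := by
    have e := congr(($(inr_plusMap p)).left)
    exact congr($e x)
  rw [h2] at hy
  exact Set.disjoint_left.mp (isCompl_range_plus Y'.sch).disjoint hy ⟨x, rfl⟩

/-- A normally framed correspondence of level `n` from `X` to `Y`: a span `X ← Z → Y` over `S`
whose left leg is finite and syntomic, a closed immersion `Z → 𝔸ⁿ_X` over `X` (the left leg is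
recorded as the composite `Z → 𝔸ⁿ_X → X`), and a trivialization of its conormal sheaf. -/
structure NFr (n : ℕ) (X Y : Over S) where
  Z : Scheme.{u}
  i : Z ⟶ Aff n X.left
  h : Z ⟶ Y.left
  isClosedImmersion : IsClosedImmersion i
  isFinite : IsFinite (i ≫ (Aff n X.left ↘ X.left))
  isSyntomic : IsSyntomic (i ≫ (Aff n X.left ↘ X.left))
  w : h ≫ Y.hom = (i ≫ (Aff n X.left ↘ X.left)) ≫ X.hom
  framing : Framing i n

attribute [instance] NFr.isClosedImmersion NFr.isFinite

/-- `D'` is the correspondence obtained from `D` by pulling back along `g : X' → X` and composing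
with `p : Y_+ → Y'_+`, that is: `Z'` is the part of `Z ×_X X'` that maps to `Y' ⊆ Y'_+`. -/
def IsTransport {n : ℕ} {X X' : Over S} {Y Y' : SchPt S} (g : X' ⟶ X) (p : Y ⟶ Y')
    (D' : NFr n X' Y'.sch) (D : NFr n X Y.sch) : Prop :=
  ∃ (w : D'.Z ⟶ D.Z) (sq : D'.i ≫ affMap n g.left = w ≫ D.i),
    D'.h ≫ inclPlus Y'.sch = w ≫ D.h ≫ plusRes p ∧
    (∀ (T : Scheme.{u}) (a : T ⟶ D.Z) (b : T ⟶ Aff n X'.left) (c : T ⟶ Y'.sch.left),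
      b ≫ affMap n g.left = a ≫ D.i → a ≫ D.h ≫ plusRes p = c ≫ inclPlus Y'.sch →
      ∃ l : T ⟶ D'.Z, l ≫ w = a ∧ l ≫ D'.i = b) ∧
    Framing.IsInduced sq D'.framing D.framing

/-- Isomorphism of normally framed correspondences. -/
def NFr.Rel {n : ℕ} {X Y : Over S} (D D' : NFr n X Y) : Prop :=
  ∃ (e : D.Z ≅ D'.Z) (sq : D.i ≫ 𝟙 _ = e.hom ≫ D'.i), e.hom ≫ D'.h = D.h ∧
    Framing.IsInduced sq D.framing D'.framing

theorem NFr.Rel.refl {n : ℕ} {X Y : Over S} (D : NFr n X Y) : D.Rel D :=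
  ⟨Iso.refl _, by simp, by simp, Framing.isInduced_refl _ _ rfl rfl⟩

theorem NFr.Rel.symm {n : ℕ} {X Y : Over S} {D D' : NFr n X Y} (h : D.Rel D') : D'.Rel D := by
  obtain ⟨e, sq, h, h'⟩ := h
  refine ⟨e.symm, ?_, ?_, ?_⟩
  · rw [Category.comp_id] at sq ⊢
    rw [Iso.symm_hom, Iso.eq_inv_comp]; exact sq.symm
  · rw [Iso.symm_hom, Iso.inv_comp_eq]; exact h.symm
  · exact h'.of_comp_id _

theorem NFr.Rel.trans {n : ℕ} {X Y : Over S} {D D' D'' : NFr n X Y} (h : D.Rel D')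
    (k : D'.Rel D'') : D.Rel D'' := by
  obtain ⟨e, sq, h, h'⟩ := h
  obtain ⟨f, sq₂, k, k'⟩ := k
  have sq₃ : D.i ≫ 𝟙 _ = (e.hom ≫ f.hom) ≫ D''.i := by
    rw [Category.comp_id] at sq sq₂ ⊢
    rw [Category.assoc, ← sq₂, sq]
  exact ⟨e ≪≫ f, sq₃, by rw [Iso.trans_hom, Category.assoc, k, h],
    h'.comp k' sq₃ rfl (Category.comp_id _).symm⟩

/-- Isomorphism of normally framed correspondences as an equivalence relation. -/
instance NFr.setoid (n : ℕ) (X Y : Over S) : Setoid (NFr n X Y) :=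
  ⟨NFr.Rel, NFr.Rel.refl, NFr.Rel.symm, NFr.Rel.trans⟩

variable {n : ℕ} {X X' X'' : Over S} {Y Y' Y'' : SchPt S}

theorem IsTransport.rel {g : X' ⟶ X} {p : Y ⟶ Y'} {D : NFr n X Y.sch}
    {D' D'' : NFr n X' Y'.sch} (h' : IsTransport g p D' D) (h'' : IsTransport g p D'' D) :
    D'.Rel D'' := by
  obtain ⟨w', sq', hh', u', f'⟩ := h'
  obtain ⟨w'', sq'', hh'', u'', f''⟩ := h''
  obtain ⟨e, he, he'⟩ := u'' _ w' D'.i D'.h sq' hh'.symm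
  obtain ⟨d, hd, hd'⟩ := u' _ w'' D''.i D''.h sq'' hh''.symm
  have sq : D'.i ≫ 𝟙 _ = e ≫ D''.i := by rw [he', Category.comp_id]
  refine ⟨⟨e, d, ?_, ?_⟩, sq, ?_, ?_⟩
  · rw [← cancel_mono D'.i, Category.assoc, hd', he', Category.id_comp]
  · rw [← cancel_mono D''.i, Category.assoc, he', hd', Category.id_comp]
  · change e ≫ D''.h = D'.h
    rw [← cancel_mono (inclPlus Y'.sch), Category.assoc, hh'', reassoc_of% he, ← hh']
  · exact f'.of_comp f'' sq he.symm (Category.id_comp _).symm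

theorem IsTransport.of_rel {g : X' ⟶ X} {p : Y ⟶ Y'} {D₁ D₂ : NFr n X Y.sch}
    {D' : NFr n X' Y'.sch} (h : IsTransport g p D' D₂) (r : D₂.Rel D₁) :
    IsTransport g p D' D₁ := by
  obtain ⟨w, sq, hh, u, f⟩ := h
  obtain ⟨e, sq₁, hh₁, f₁⟩ := r
  rw [Category.comp_id] at sq₁
  have sq₂ : D'.i ≫ affMap n g.left = (w ≫ e.hom) ≫ D₁.i := by
    rw [Category.assoc, ← sq₁, sq]
  refine ⟨w ≫ e.hom, sq₂, ?_, ?_, ?_⟩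
  · rw [hh, ← hh₁]; simp only [Category.assoc]
  · intro T a b c h1 h2
    obtain ⟨l, hl, hl'⟩ := u T (a ≫ e.inv) b c
      (by rw [h1, Category.assoc, sq₁, Iso.inv_hom_id_assoc])
      (by rw [← h2, ← hh₁]; simp)
    exact ⟨l, by rw [reassoc_of% hl, Iso.inv_hom_id, Category.comp_id], hl'⟩
  · exact f.comp f₁ sq₂ rfl (Category.comp_id _).symm

theorem IsTransport.id (D : NFr n X Y.sch) : IsTransport (𝟙 X) (𝟙 Y) D D := by
  have e : affMap n (𝟙 X : X ⟶ X).left = 𝟙 _ := AffineSpace.map_id _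
  refine ⟨𝟙 _, by rw [e]; simp, ?_, ?_, Framing.isInduced_refl _ _ rfl e⟩
  · rw [Category.id_comp]
    congr 1
  · intro T a b c h1 _
    rw [e, Category.comp_id] at h1
    exact ⟨a, Category.comp_id _, h1.symm⟩

theorem IsTransport.comp {g : X' ⟶ X} {g' : X'' ⟶ X'} {p : Y ⟶ Y'} {p' : Y' ⟶ Y''}
    {D : NFr n X Y.sch} {D' : NFr n X' Y'.sch} {D'' : NFr n X'' Y''.sch}
    (h : IsTransport g p D' D) (h' : IsTransport g' p' D'' D') :
    IsTransport (g' ≫ g) (p ≫ p') D'' D := by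
  obtain ⟨w, sq, hh, u, f⟩ := h
  obtain ⟨w', sq', hh', u', f'⟩ := h'
  have e : affMap n (g' ≫ g).left = affMap n g'.left ≫ affMap n g.left := AffineSpace.map_comp ..
  have ep : plusRes (p ≫ p') = plusRes p ≫ (plusMap p').left := by
    simp [plusRes, plusMap_comp]
  have sq₀ : D''.i ≫ affMap n (g' ≫ g).left = (w' ≫ w) ≫ D.i := by
    rw [e, reassoc_of% sq', sq, Category.assoc]
  refine ⟨w' ≫ w, sq₀, ?_, ?_, f'.comp f sq₀ rfl e⟩
  · rw [hh', ep, plusRes, ← Category.assoc D'.h, hh]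
    simp only [Category.assoc]
  · intro T a b c h1 h2
    have hr : Set.range (a ≫ D.h ≫ plusRes p) ⊆ Set.range (inclPlus Y'.sch) := by
      rintro _ ⟨t, rfl⟩
      refine mem_range_inclPlus p' _ ⟨c t, ?_⟩
      rw [ep] at h2
      have h3 : (a ≫ D.h ≫ plusRes p) ≫ (plusMap p').left = c ≫ inclPlus Y''.sch := by
        rw [← h2]; simp only [Category.assoc]
      exact congr($h3.symm t)
    let c' := IsOpenImmersion.lift (inclPlus Y'.sch) _ hr
    have hc' : c' ≫ inclPlus Y'.sch = a ≫ D.h ≫ plusRes p := IsOpenImmersion.lift_fac _ _ hr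
    obtain ⟨l, hl, hl'⟩ := u T a (b ≫ affMap n g'.left) c'
      (by rw [Category.assoc, ← e, h1]) hc'.symm
    obtain ⟨m, hm, hm'⟩ := u' T l b c hl'.symm (by
      rw [← h2, ep, plusRes, ← Category.assoc D'.h, hh]
      simp only [Category.assoc]
      rw [reassoc_of% hl])
    exact ⟨m, by rw [reassoc_of% hm, hl], hm'⟩

end

/-! ### The presheaves of normally framed correspondences -/

section

variable {S : Scheme.{u}} {n : ℕ} {X X' X'' : Over S} {Y Y' Y'' : SchPt S}

theorem inclPlus_hom (Y : Over S) : inclPlus Y ≫ (plus Y).hom = Y.hom :=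
  Over.w (coprod.inl : Y ⟶ plus Y)

theorem plusRes_hom (p : Y ⟶ Y') : plusRes p ≫ (plus Y'.sch).hom = Y.sch.hom := by
  rw [plusRes, Category.assoc, Over.w, inclPlus_hom]

/-- Functoriality of normally framed correspondences in `X` and in the pointed scheme `Y_+`. -/
def NFr.pull (D : NFr n X Y.sch) (g : X' ⟶ X) (p : Y ⟶ Y') : NFr n X' Y'.sch where
  Z := pullback (pullback.fst D.i (affMap n g.left) ≫ D.h ≫ plusRes p) (inclPlus Y'.sch)
  i := pullback.fst _ _ ≫ pullback.snd D.i (affMap n g.left)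
  h := pullback.snd _ _
  isClosedImmersion := inferInstance
  isFinite := by
    have h : IsFinite (pullback.snd D.i (affMap n g.left) ≫ (Aff n X'.left ↘ X'.left)) :=
      MorphismProperty.of_isPullback ((IsPullback.of_hasPullback _ _).paste_vert
        (AffineSpace.isPullback_map g.left)) D.isFinite
    rw [Category.assoc]
    infer_instance
  isSyntomic := by
    have h := D.isSyntomic.baseChange ((IsPullback.of_hasPullback _ _).paste_vert
        (AffineSpace.isPullback_map g.left))
    rw [Category.assoc]
    exact h.restrict _
  w := by
    have h1 : pullback.snd D.i (affMap n g.left) ≫ (Aff n X'.left ↘ X'.left) ≫ g.left =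
        pullback.fst D.i (affMap n g.left) ≫ D.i ≫ (Aff n X.left ↘ X.left) := by
      rw [pullback.condition_assoc, AffineSpace.map_over]
    have h2 := D.w
    rw [Category.assoc] at h2
    simp only [Category.assoc]
    rw [← Over.w g, reassoc_of% h1, ← h2, ← plusRes_hom p, ← inclPlus_hom, ← pullback.condition_assoc]
    simp only [Category.assoc]
  framing := have := D.isSyntomic.flat
    D.framing.pull (IsPullback.of_hasPullback D.i (affMap n g.left))
      (AffineSpace.isPullback_map g.left) (pullback.fst _ _) (by
        rw [Category.assoc, Category.assoc, pullback.condition])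

theorem NFr.isTransport_pull (D : NFr n X Y.sch) (g : X' ⟶ X) (p : Y ⟶ Y') :
    IsTransport g p (D.pull g p) D := by
  let j : pullback (pullback.fst D.i (affMap n g.left) ≫ D.h ≫ plusRes p) (inclPlus Y'.sch) ⟶
    pullback D.i (affMap n g.left) := pullback.fst _ _
  have e1 : (j ≫ pullback.snd D.i (affMap n g.left)) ≫ affMap n g.left =
      (j ≫ pullback.fst D.i (affMap n g.left)) ≫ D.i := by
    rw [Category.assoc, Category.assoc, pullback.condition]
  have e2 : pullback.snd (pullback.fst D.i (affMap n g.left) ≫ D.h ≫ plusRes p)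
      (inclPlus Y'.sch) ≫ inclPlus Y'.sch =
      (j ≫ pullback.fst D.i (affMap n g.left)) ≫ D.h ≫ plusRes p := by
    rw [Category.assoc]
    exact pullback.condition.symm
  have e3 : ∀ (T : Scheme.{u}) (a : T ⟶ D.Z) (b : T ⟶ Aff n X'.left) (c : T ⟶ Y'.sch.left),
      b ≫ affMap n g.left = a ≫ D.i → a ≫ D.h ≫ plusRes p = c ≫ inclPlus Y'.sch →
      ∃ l : T ⟶ pullback (pullback.fst D.i (affMap n g.left) ≫ D.h ≫ plusRes p) (inclPlus Y'.sch),
        l ≫ j ≫ pullback.fst D.i (affMap n g.left) = a ∧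
          l ≫ j ≫ pullback.snd D.i (affMap n g.left) = b := by
    intro T a b c h1 h2
    have h3 : pullback.lift a b h1.symm ≫ pullback.fst D.i (affMap n g.left) ≫ D.h ≫ plusRes p =
        c ≫ inclPlus Y'.sch := by
      rw [pullback.lift_fst_assoc]; exact h2
    exact ⟨pullback.lift _ c h3, by rw [pullback.lift_fst_assoc, pullback.lift_fst],
      by rw [pullback.lift_fst_assoc, pullback.lift_snd]⟩
  exact ⟨_, e1, e2, e3, fun z j => rfl⟩

/-- The correspondence of level `n + 1` obtained from the embedding `𝔸ⁿ_X → 𝔸ⁿ⁺¹_X`. -/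
def NFr.suspend {Y : Over S} (D : NFr n X Y) : NFr (n + 1) X Y where
  Z := D.Z
  i := D.i ≫ affZero n X.left
  h := D.h
  isClosedImmersion := inferInstance
  isFinite := by
    rw [Category.assoc, affZero_over]
    exact D.isFinite
  isSyntomic := by
    rw [Category.assoc, affZero_over]
    exact D.isSyntomic
  w := by
    rw [Category.assoc D.i, affZero_over]
    exact D.w
  framing := D.framing.suspend

theorem IsTransport.suspend {g : X' ⟶ X} {p : Y ⟶ Y'} {D : NFr n X Y.sch} {D' : NFr n X' Y'.sch}
    (h : IsTransport g p D' D) : IsTransport g p D'.suspend D.suspend := by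
  obtain ⟨w, sq, hh, u, f⟩ := h
  have sq' : (D'.i ≫ affZero n X'.left) ≫ affMap (n + 1) g.left =
      w ≫ (D.i ≫ affZero n X.left) := by
    rw [Category.assoc, ← affMap_zero, reassoc_of% sq]
  refine ⟨w, sq', hh, ?_, f.suspend sq'⟩
  have e3 : ∀ (T : Scheme.{u}) (a : T ⟶ D.Z) (b : T ⟶ Aff (n + 1) X'.left) (c : T ⟶ Y'.sch.left),
      b ≫ affMap (n + 1) g.left = a ≫ D.i ≫ affZero n X.left →
      a ≫ D.h ≫ plusRes p = c ≫ inclPlus Y'.sch →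
      ∃ l : T ⟶ D'.Z, l ≫ w = a ∧ l ≫ D'.i ≫ affZero n X'.left = b := by
    intro T a b c h1 h2
    obtain ⟨l, hl, hl'⟩ := u T a (b ≫ affProj n X'.left) c (by
      rw [Category.assoc, ← affMap_proj, reassoc_of% h1, affZero_proj, Category.comp_id]) h2
    refine ⟨l, hl, ?_⟩
    rw [reassoc_of% hl']
    refine aff_hom_ext ?_ ?_
    · rw [Category.assoc, Category.assoc, affZero_proj, Category.comp_id]
    · rw [← Category.assoc, Scheme.Hom.comp_appTop, CommRingCat.comp_apply, affZero_lastCoord,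
        map_zero, ← affMap_lastCoord n g.left, ← CommRingCat.comp_apply, ← Scheme.Hom.comp_appTop,
        h1, ← Category.assoc, Scheme.Hom.comp_appTop, CommRingCat.comp_apply, affZero_lastCoord,
        map_zero]
  exact e3

theorem NFr.Rel.isTransport {D D' : NFr n X Y.sch} (h : D.Rel D') :
    IsTransport (𝟙 X) (𝟙 Y) D D' := (IsTransport.id D).of_rel h

/-- The set `Corr^{nfr,n}_S(X, Y)` of isomorphism classes of normally framed correspondences of
level `n` (such correspondences have no nontrivial automorphisms). -/
abbrev CorrNfr (n : ℕ) (X Y : Over S) : Type (u + 1) := Quotient (NFr.setoid n X Y)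

/-- Functoriality of `Corr^{nfr,n}_S(X, Y)`. -/
def CorrNfr.map (g : X' ⟶ X) (p : Y ⟶ Y') : CorrNfr n X Y.sch → CorrNfr n X' Y'.sch :=
  Quotient.map (fun D => D.pull g p) fun D₁ D₂ h =>
    ((D₁.isTransport_pull g p).of_rel h).rel (D₂.isTransport_pull g p)

theorem CorrNfr.map_mk_eq {g : X' ⟶ X} {p : Y ⟶ Y'} {D : NFr n X Y.sch} {D' : NFr n X' Y'.sch}
    (h : IsTransport g p D' D) :
    CorrNfr.map g p (Quotient.mk _ D) = Quotient.mk _ D' :=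
  Quotient.sound ((D.isTransport_pull g p).rel h)

theorem CorrNfr.map_id (x : CorrNfr n X Y.sch) : CorrNfr.map (𝟙 X) (𝟙 Y) x = x := by
  induction x using Quotient.inductionOn with
  | h D => exact CorrNfr.map_mk_eq (IsTransport.id D)

theorem CorrNfr.map_comp (g : X' ⟶ X) (g' : X'' ⟶ X') (p : Y ⟶ Y') (p' : Y' ⟶ Y'')
    (x : CorrNfr n X Y.sch) :
    CorrNfr.map (g' ≫ g) (p ≫ p') x = CorrNfr.map g' p' (CorrNfr.map g p x) := by
  induction x using Quotient.inductionOn with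
  | h D =>
    exact CorrNfr.map_mk_eq ((D.isTransport_pull g p).comp ((D.pull g p).isTransport_pull g' p'))

/-- The suspension map `Corr^{nfr,n}_S(X, Y) → Corr^{nfr,n+1}_S(X, Y)`. -/
def CorrNfr.suspend {Y : Over S} : CorrNfr n X Y → CorrNfr (n + 1) X Y :=
  Quotient.map NFr.suspend fun _ D' h =>
    ((NFr.Rel.isTransport (Y := SchPt.of Y) h).suspend.rel
      (IsTransport.id (Y := SchPt.of Y) D'.suspend))

theorem CorrNfr.map_suspend (g : X' ⟶ X) (p : Y ⟶ Y') (x : CorrNfr n X Y.sch) :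
    CorrNfr.map g p x.suspend = (CorrNfr.map g p x).suspend := by
  induction x using Quotient.inductionOn with
  | h D => exact CorrNfr.map_mk_eq (D.isTransport_pull g p).suspend

/-- The presheaves `Corr^{nfr,n}_S(-, Y)` on `S`-schemes, functorially in `Y_+`. -/
def corrNfr (S : Scheme.{u}) (n : ℕ) : SchPt S ⥤ (Over S)ᵒᵖ ⥤ Type (u + 1) where
  obj Y :=
    { obj := fun X => CorrNfr n X.unop Y.sch
      map := fun g => ↾(CorrNfr.map g.unop (𝟙 Y))
      map_id := fun X => by
        ext x
        exact CorrNfr.map_id x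
      map_comp := fun g g' => by
        ext x
        exact CorrNfr.map_comp g.unop g'.unop (𝟙 Y) (𝟙 Y) x }
  map {Y Y'} p :=
    { app := fun X => ↾(CorrNfr.map (𝟙 X.unop) p)
      naturality := fun X X' g => by
        ext x
        have h1 := CorrNfr.map_comp g.unop (𝟙 X'.unop) (𝟙 Y) p x
        have h2 := CorrNfr.map_comp (𝟙 X.unop) g.unop p (𝟙 Y') x
        rw [Category.id_comp, Category.id_comp] at h1
        rw [Category.comp_id, Category.comp_id] at h2
        exact h1.symm.trans h2 }
  map_id Y := by
    ext X x
    exact CorrNfr.map_id x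
  map_comp p p' := by
    ext X x
    exact CorrNfr.map_comp (𝟙 X.unop) (𝟙 X.unop) p p' x

/-- The suspension `Corr^{nfr,n}_S → Corr^{nfr,n+1}_S`. -/
def corrNfrSuspend (S : Scheme.{u}) (n : ℕ) : corrNfr S n ⟶ corrNfr S (n + 1) where
  app Y :=
    { app := fun X => ↾CorrNfr.suspend
      naturality := fun X X' g => by
        ext x
        exact (CorrNfr.map_suspend g.unop (𝟙 Y) x).symm }
  naturality Y Y' p := by
    ext X x
    exact (CorrNfr.map_suspend (𝟙 X.unop) p x).symm

/-- `h^{nfr}_S(Y)`, the presheaf `X ↦ colim_n Corr^{nfr,n}_S(X, Y)`, functorially in `Y_+`. -/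
def hnfr (S : Scheme.{u}) : SchPt S ⥤ (Over S)ᵒᵖ ⥤ Type (u + 1) :=
  colimit (Functor.ofSequence (corrNfrSuspend S))

end

/-! ### Pointed schemes and the collapse maps -/

section

variable {S : Scheme.{u}}

/-- The morphism `Y → S` of `S`-schemes. -/
abbrev toBase (Y : Over S) : Y ⟶ Over.mk (𝟙 S) := Over.mkIdTerminal.from Y

/-- The pointed morphism `(Y_1 ⨿ ⋯ ⨿ Y_k)_+ → (Y_j)_+` that is the identity on `Y_j` and sends the
other summands to the base point. -/
def collapse {k : ℕ} (Y : Fin k → Over S) (j : Fin k) : SchPt.of (∐ Y) ⟶ SchPt.of (Y j) :=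
  SchPt.mkHom
    (coprod.desc
      (Sigma.desc fun l =>
        if h : l = j then eqToHom (congrArg Y h) ≫ coprod.inl else toBase (Y l) ≫ coprod.inr)
      coprod.inr)
    (coprod.inr_desc _ _)

/-- The canonical map `h^{nfr}_S(Y_1 ⨿ ⋯ ⨿ Y_k) → h^{nfr}_S(Y_1) × ⋯ × h^{nfr}_S(Y_k)`. -/
def hnfrToProd {k : ℕ} (Y : Fin k → Over S) :
    (hnfr S).obj (SchPt.of (∐ Y)) ⟶ ∏ᶜ fun j => (hnfr S).obj (SchPt.of (Y j)) :=
  Pi.lift fun j => (hnfr S).map (collapse Y j)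

/-! ### Finite pointed sets -/

/-- The category of finite pointed sets `⟨n⟩ = {1, …, n}_+`, with pointed maps. -/
structure FinPt where
  card : ℕ

/-- The pointed maps `⟨m⟩ → ⟨n⟩`, where `none` is the base point. -/
@[ext]
structure FinPt.Hom (m n : FinPt) where
  toFun : Option (Fin m.card) → Option (Fin n.card)
  map_none : toFun none = none

instance : Category FinPt where
  Hom := FinPt.Hom
  id _ := ⟨fun x => x, rfl⟩
  comp f g := ⟨fun x => g.toFun (f.toFun x), by rw [f.map_none, g.map_none]⟩

/-- The map `⟨n⟩ → ⟨1⟩` that sends `i` to `1` and all other elements to the base point. -/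
def FinPt.rho (n : ℕ) (i : Fin n) : FinPt.mk n ⟶ FinPt.mk 1 where
  toFun x := if x = some i then some 0 else none
  map_none := by simp

/-- The inclusion of the summand indexed by `x`, for `x` in a finite pointed set, into
`(Y^{⨿ n})_+`; the base point gives the base point. -/
def finIncl (Y : Over S) (n : ℕ) : Option (Fin n) → (Y ⟶ plus (∐ fun _ : Fin n => Y))
  | none => toBase Y ≫ coprod.inr
  | some i => Sigma.ι (fun _ : Fin n => Y) i ≫ coprod.inl

/-- The morphism `(Y^{⨿ m})_+ → (Y^{⨿ n})_+` induced by a pointed map `⟨m⟩ → ⟨n⟩`. -/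
def finMap (Y : Over S) {m n : FinPt} (f : m ⟶ n) :
    plus (∐ fun _ : Fin m.card => Y) ⟶ plus (∐ fun _ : Fin n.card => Y) :=
  coprod.desc (Sigma.desc fun i => finIncl Y n.card (FinPt.Hom.toFun f (some i))) coprod.inr

theorem finIncl_finMap (Y : Over S) {m n : FinPt} (f : m ⟶ n) (x : Option (Fin m.card)) :
    finIncl Y m.card x ≫ finMap Y f = finIncl Y n.card (FinPt.Hom.toFun f x) := by
  cases x with
  | none =>
    rw [FinPt.Hom.map_none, finIncl, finMap, Category.assoc, coprod.inr_desc, finIncl]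
  | some i =>
    rw [finIncl, finMap, Category.assoc, coprod.inl_desc, Sigma.ι_desc]

theorem fin_hom_ext (Y : Over S) {n : ℕ} {T : Over S}
    {a b : plus (∐ fun _ : Fin n => Y) ⟶ T}
    (h : ∀ i : Fin n, finIncl Y n (some i) ≫ a = finIncl Y n (some i) ≫ b)
    (h' : coprod.inr ≫ a = coprod.inr ≫ b) : a = b := by
  refine coprod.hom_ext (Sigma.hom_ext _ _ fun i => ?_) h'
  have := h i
  simpa only [finIncl, Category.assoc] using this

/-- The functor `I_+ ↦ (Y^{⨿ I})_+` from finite pointed sets to pointed `S`-schemes. -/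
def finPower (Y : Over S) : FinPt ⥤ SchPt S where
  obj n := SchPt.of (∐ fun _ : Fin n.card => Y)
  map f := SchPt.mkHom (finMap Y f) (coprod.inr_desc _ _)
  map_id n := by
    have h : finMap Y (𝟙 n) = 𝟙 _ := fin_hom_ext Y
      (fun i => by rw [finIncl_finMap, Category.comp_id]; rfl)
      (by rw [finMap, coprod.inr_desc, Category.comp_id])
    refine InducedCategory.Hom.ext (Under.UnderMorphism.ext h)
  map_comp f g := by
    have h : finMap Y (f ≫ g) = finMap Y f ≫ finMap Y g := fin_hom_ext Y
      (fun i => by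
        rw [finIncl_finMap, reassoc_of% (finIncl_finMap Y f), finIncl_finMap]; rfl)
      (by simp only [finMap, coprod.inr_desc, coprod.inr_desc_assoc])
    refine InducedCategory.Hom.ext (Under.UnderMorphism.ext h)

/-! ### The `𝔸¹`-localization `L_htp` -/

/-- The coordinate ring `ℤ[t_0, …, t_k] / (t_0 + ⋯ + t_k - 1)` of the algebraic `k`-simplex. -/
abbrev simplexRing (k : ℕ) : Type u :=
  MvPolynomial (Fin (k + 1)) (ULift.{u} ℤ) ⧸
    Ideal.span {(∑ i, MvPolynomial.X i - 1 : MvPolynomial (Fin (k + 1)) (ULift.{u} ℤ))}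

/-- The map of coordinate rings with `t_i ↦ ∑_{a j = i} t_j` induced by `a : [k] → [l]`. -/
def simplexRingMap {k l : ℕ} (a : Fin (k + 1) → Fin (l + 1)) :
    simplexRing.{u} l →+* simplexRing.{u} k :=
  Ideal.quotientMap _
    (MvPolynomial.aeval (R := ULift.{u} ℤ) fun i =>
      ∑ j with a j = i, (MvPolynomial.X j : MvPolynomial (Fin (k + 1)) (ULift.{u} ℤ))).toRingHom
    (by
      rw [Ideal.span_singleton_le_iff_mem, Ideal.mem_comap]
      have h : (∑ i, ∑ j with a j = i,
          (MvPolynomial.X j : MvPolynomial (Fin (k + 1)) (ULift.{u} ℤ))) =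
          ∑ j, MvPolynomial.X j :=
        Finset.sum_fiberwise _ _ _
      have e : (MvPolynomial.aeval (R := ULift.{u} ℤ) fun i =>
          ∑ j with a j = i,
            (MvPolynomial.X j : MvPolynomial (Fin (k + 1)) (ULift.{u} ℤ))).toRingHom
          (∑ i, MvPolynomial.X i - 1) = ∑ j, MvPolynomial.X j - 1 := by
        rw [← h]; simp
      rw [e]
      exact Ideal.mem_span_singleton_self _)

theorem simplexRing_hom_ext {k : ℕ} {R : Type u} [CommRing R] {f g : simplexRing.{u} k →+* R}
    (h : ∀ i, f (Ideal.Quotient.mk _ (MvPolynomial.X i)) =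
      g (Ideal.Quotient.mk _ (MvPolynomial.X i))) : f = g := by
  refine Ideal.Quotient.ringHom_ext (MvPolynomial.ringHom_ext (fun r => ?_) h)
  have : (f.comp (Ideal.Quotient.mk _)).comp
        (MvPolynomial.C.comp (ULift.ringEquiv (R := ℤ)).symm.toRingHom) =
      (g.comp (Ideal.Quotient.mk _)).comp
        (MvPolynomial.C.comp (ULift.ringEquiv (R := ℤ)).symm.toRingHom) :=
    RingHom.ext_int _ _
  exact congr($this r.down)

theorem simplexRingMap_X {k l : ℕ} (a : Fin (k + 1) → Fin (l + 1)) (i : Fin (l + 1)) :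
    simplexRingMap.{u} a (Ideal.Quotient.mk _ (MvPolynomial.X i)) =
      ∑ j with a j = i, Ideal.Quotient.mk _ (MvPolynomial.X j) := by
  simp [simplexRingMap, Ideal.quotientMap_mk]

theorem simplexRingMap_id (k : ℕ) : simplexRingMap.{u} (fun i : Fin (k + 1) => i) =
    RingHom.id _ :=
  simplexRing_hom_ext (k := k) (R := simplexRing.{u} k) fun i => by
    rw [simplexRingMap_X]
    simp [Finset.filter_eq']

theorem simplexRingMap_comp {k l m : ℕ} (a : Fin (k + 1) → Fin (l + 1))
    (b : Fin (l + 1) → Fin (m + 1)) :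
    simplexRingMap.{u} (fun i => b (a i)) =
      (simplexRingMap.{u} a).comp (simplexRingMap.{u} b) :=
  simplexRing_hom_ext (k := m) (R := simplexRing.{u} k) fun i => by
    rw [RingHom.comp_apply, simplexRingMap_X, simplexRingMap_X, map_sum]
    simp only [simplexRingMap_X, Finset.sum_filter]
    simp only [Finset.ite_sum_zero]
    rw [Finset.sum_comm]
    refine Finset.sum_congr rfl fun j _ => ?_
    rw [Finset.sum_eq_single (a j)]
    · simp
    · intro c _ hc
      simp [hc.symm]
    · simp

/-- The cosimplicial scheme `Δ^•` of algebraic simplices. -/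
def algSimplex : SimplexCategory ⥤ Scheme.{u} where
  obj k := Spec (CommRingCat.of (simplexRing.{u} k.len))
  map a := Spec.map (CommRingCat.ofHom (simplexRingMap.{u} a.toOrderHom))
  map_id k := by
    rw [← Spec.map_id, ← CommRingCat.ofHom_id, ← simplexRingMap_id]
    rfl
  map_comp a b := by
    rw [← Spec.map_comp, ← CommRingCat.ofHom_comp, ← simplexRingMap_comp]
    rfl

/-- The cosimplicial `S`-scheme `X × Δ^•`. -/
def prodSimplex (X : Over S) : SimplexCategory ⥤ Over S where
  obj k := Over.mk ((prod.fst : X.left ⨯ algSimplex.obj k ⟶ X.left) ≫ X.hom)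
  map a := Over.homMk (prod.map (𝟙 _) (algSimplex.map a)) (by simp)
  map_id k := by ext; simp
  map_comp a b := by ext; simp

/-- The morphism `X' × Δ^• → X × Δ^•` induced by `X' → X`. -/
def prodSimplexMap {X X' : Over S} (g : X' ⟶ X) : prodSimplex X' ⟶ prodSimplex X where
  app k := Over.homMk (prod.map g.left (𝟙 _)) (by simp [prodSimplex])
  naturality k l a := by
    ext
    change prod.map _ _ ≫ prod.map _ _ = prod.map _ _ ≫ prod.map _ _
    simp

/-- `L_htp F`, the presheaf of simplicial sets `X ↦ F(X × Δ^•)`. -/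
def Lhtp (S : Scheme.{u}) :
    ((Over S)ᵒᵖ ⥤ Type (u + 1)) ⥤ ((Over S)ᵒᵖ ⥤ SSet.{u + 1}) where
  obj F :=
    { obj := fun X => (prodSimplex X.unop).op ⋙ F
      map := fun g => Functor.whiskerRight (NatTrans.op (prodSimplexMap g.unop)) F
      map_id := fun X => by
        have h : prodSimplexMap (𝟙 X.unop) = 𝟙 _ := by
          ext k
          change prod.map _ _ = 𝟙 _
          simp
        rw [unop_id, h]
        ext
        exact congr($(F.map_id _) _)
      map_comp := fun g g' => by
        have h : prodSimplexMap (g'.unop ≫ g.unop) =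
            prodSimplexMap g'.unop ≫ prodSimplexMap g.unop := by
          ext k
          change prod.map _ _ = prod.map _ _ ≫ prod.map _ _
          simp
        rw [unop_comp, h]
        ext
        exact congr($(F.map_comp _ _) _) }
  map φ := { app := fun X => Functor.whiskerLeft _ φ }

/-- Weak homotopy equivalences of simplicial sets: precomposition with `f` gives a bijection on
homotopy classes of maps to every Kan complex. -/
def IsWeakEquivalence {A B : SSet.{u}} (f : A ⟶ B) : Prop :=
  ∀ (K : SSet.{u}) [SSet.KanComplex K],
    (∀ a : A ⟶ K, ∃ b : B ⟶ K, Nonempty (SSet.Homotopy (f ≫ b) a)) ∧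
    (∀ b b' : B ⟶ K, Nonempty (SSet.Homotopy (f ≫ b) (f ≫ b')) → Nonempty (SSet.Homotopy b b'))

/-- A morphism of presheaves that becomes an equivalence of presheaves of spaces after applying
`L_htp`. -/
def IsLhtpEquivalence {F G : (Over S)ᵒᵖ ⥤ Type (u + 1)} (φ : F ⟶ G) : Prop :=
  ∀ X : Over S, IsWeakEquivalence (((Lhtp S).map φ).app (op X))

/-- A functor `A` from finite pointed sets to presheaves of spaces is an `E_∞`-object if it
satisfies the Segal condition: for all `n ≥ 0`, the map `A⟨n⟩ → A⟨1⟩ⁿ` is an equivalence. -/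
def IsEInfinityObject (A : FinPt ⥤ (Over S)ᵒᵖ ⥤ SSet.{u + 1}) : Prop :=
  ∀ (n : ℕ) (X : Over S), IsWeakEquivalence
    ((Pi.lift fun i : Fin n => A.map (FinPt.rho n i) :
      A.obj (FinPt.mk n) ⟶ ∏ᶜ fun _ : Fin n => A.obj (FinPt.mk 1)).app (op X))

end

end

end NormalFraming

/-!
Let `W` be the disjoint union of the `S`-schemes `V_1, …, V_k`, and fix an `S`-scheme `X`. The map
`ι : h(W)(X × Δ^•) ⟶ ∏_j h(V_j)(X × Δ^•)`, for `h = h^{nfr}_S`, splits a framed correspondence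
`Z ⊆ 𝔸ⁿ_X` into its parts `Z_j` over the `V_j`. Conversely, correspondences `Z_j ⊆ 𝔸ⁿ_X` to the
`V_j` can be glued if and only if their embedded schemes are disjoint. So `ι` is injective, and its
image consists of the disjoint families (`IsDecomposition.stableMap_injective`,
`IsDecomposition.exists_stableMap_eq_iff`). Disjointness makes sense for stable classes because the
suspension maps are injective (`CorrNfr.suspend_injective`).

The map `ι` is an equivalence because a family can be made disjoint by translations, and these
translations can be contracted. Finitely supported sequences of functions on `X` act on `h(V)(X)` by
translation in `𝔸ⁿ_X`. Let `T` be the simplicial set of pairs `(x, c)`, where `x` is a family over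
`X × Δ^m` and `c` consists of sequences `c_j` in the coordinate ring of `Δ^m` such that the
translates `x_j + c_j` are disjoint (`movedFamilies`).

* Forgetting `c` is a trivial fibration `p` (`forgetMove_rlp`). Indeed translations `c` given on the
  boundary of a simplex extend to functions on the simplex (`exists_simplexRingMap_succAbove_eq`).
  Then the `j`-th member is moved in addition by `t_0 ⋯ t_m` in a fresh coordinate of its own. This
  changes nothing on the boundary, and in the interior, where `t_0 ⋯ t_m` is invertible, the members
  are separated by the fresh coordinates (`exists_stableDisjoint`, `mem_range_face`).
* Gluing the translates gives a map `θ` from `T` to `h(W)(X × Δ^•)` (`glueMoved`), and `θ ≫ ι` is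
  homotopic to `p` in both directions: multiply `c` by a coordinate of the interval
  (`moveHomotopy`).
* A disjoint family needs no translation, so `ι` lifts to a map `z` to `T` with `z ≫ θ = 𝟙`
  (`splitCorr`).

Since `ι` is a monomorphism, `z` extends to a section of `p`, and the composite of this section with
`θ` is a homotopy inverse of `ι` (`isWeakEquivalence_of_trivialFibration`). Both parts of the
theorem are the case of a finite coproduct, because products of presheaves are computed objectwise.
-/

namespace NormalFraming

noncomputable section

/-! ### Weak equivalences of simplicial sets from lifting properties -/

section Simplicial

open MonoidalCategory Simplicial SSet SSet.modelCategoryQuillen HomotopicalAlgebra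

/-- A homotopy from a cylinder map with prescribed ends. -/
def homotopyMk {A K : SSet.{u}} {f g : A ⟶ K} (h : A ⊗ Δ[1] ⟶ K) (h₀ : SSet.ι₀ ≫ h = f)
    (h₁ : SSet.ι₁ ≫ h = g) : SSet.Homotopy f g where
  h := h
  h₀ := h₀
  h₁ := h₁
  rel := by
    ext m ⟨⟨x, hx⟩, y⟩
    simp at hx

theorem homotopy_precomp {A B K : SSet.{u}} (e : A ⟶ B) {f g : B ⟶ K}
    (h : Nonempty (SSet.Homotopy f g)) : Nonempty (SSet.Homotopy (e ≫ f) (e ≫ g)) := by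
  obtain ⟨H⟩ := h
  exact ⟨homotopyMk (e ▷ _ ≫ H.h) (by rw [SSet.ι₀_comp_assoc, H.h₀])
    (by rw [SSet.ι₁_comp_assoc, H.h₁])⟩

theorem homotopy_postcomp {A K L : SSet.{u}} {f g : A ⟶ K} (e : K ⟶ L)
    (h : Nonempty (SSet.Homotopy f g)) : Nonempty (SSet.Homotopy (f ≫ e) (g ≫ e)) := by
  obtain ⟨H⟩ := h
  exact ⟨homotopyMk (H.h ≫ e) (by rw [H.h₀_assoc]) (by rw [H.h₁_assoc])⟩

theorem homotopy_refl {A K : SSet.{u}} (f : A ⟶ K) : Nonempty (SSet.Homotopy f f) :=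
  ⟨homotopyMk (SemiCartesianMonoidalCategory.fst _ _ ≫ f) rfl rfl⟩

/-- Homotopies of maps to a Kan complex can be concatenated: fill `A ⊗ Λ[2, 1] ⟶ A ⊗ Δ[2]`. -/
theorem homotopy_trans {A K : SSet.{u}} [SSet.KanComplex K] {f g h : A ⟶ K}
    (H : Nonempty (SSet.Homotopy f g)) (H' : Nonempty (SSet.Homotopy g h)) :
    Nonempty (SSet.Homotopy f h) := by
  obtain ⟨H⟩ := H
  obtain ⟨H'⟩ := H'
  have po := horn₂₁.isPushout.{u}.map (tensorLeft A)
  have e₀ : ∀ (G : A ⊗ Δ[1] ⟶ K), A ◁ stdSimplex.δ (1 : Fin 2) ≫ G =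
      SemiCartesianMonoidalCategory.fst _ _ ≫ SSet.ι₀ ≫ G := by
    intro G
    rw [stdSimplex.δ_one_eq_const]; rfl
  have e₁ : ∀ (G : A ⊗ Δ[1] ⟶ K), A ◁ stdSimplex.δ (0 : Fin 2) ≫ G =
      SemiCartesianMonoidalCategory.fst _ _ ≫ SSet.ι₁ ≫ G := by
    intro G
    rw [stdSimplex.δ_zero_eq_const]; rfl
  let d : A ⊗ (Λ[2, 1] : SSet) ⟶ K := po.desc H.h H'.h (by
    refine (e₁ H.h).trans (Eq.trans ?_ (e₀ H'.h).symm)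
    rw [H.h₁, H'.h₀])
  have hl : HasLiftingProperty (A ◁ Λ[2, 1].ι) (terminal.from K) :=
    (anodyneExtensions.horn_ι (n := 2) (1 : Fin 3)).whiskerLeft A _
      (by rw [← HomotopicalAlgebra.fibration_iff]; infer_instance)
  have sq : CommSq d (A ◁ Λ[2, 1].ι) (terminal.from K) (terminal.from _) := ⟨by simp⟩
  have hd₂ : A ◁ stdSimplex.δ (2 : Fin 3) ≫ sq.lift = H.h := by
    have : A ◁ stdSimplex.δ (2 : Fin 3) = A ◁ horn₂₁.ι₀₁ ≫ A ◁ Λ[2, 1].ι := rfl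
    rw [this, Category.assoc, sq.fac_left]
    exact po.inl_desc _ _ _
  have hd₀ : A ◁ stdSimplex.δ (0 : Fin 3) ≫ sq.lift = H'.h := by
    have : A ◁ stdSimplex.δ (0 : Fin 3) = A ◁ horn₂₁.ι₁₂ ≫ A ◁ Λ[2, 1].ι := rfl
    rw [this, Category.assoc, sq.fac_left]
    exact po.inr_desc _ _ _
  refine ⟨homotopyMk (A ◁ stdSimplex.δ (1 : Fin 3) ≫ sq.lift) ?_ ?_⟩
  · rw [← H.h₀, ← hd₂]
    rfl
  · rw [← H'.h₁, ← hd₀]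
    rfl

/-- Suppose that the trivial fibration `p : T ⟶ B` is homotopic, in both directions, to a map
`θ ≫ ι` through `ι : A ⟶ B`, and that `A` has a lift `z` to `T` with `z ≫ θ = 𝟙`. Extending `z` to a
section of `p` shows that `A` is a deformation retract of `B`. -/
theorem isWeakEquivalence_of_trivialFibration {A B T : SSet.{u}} {ι : A ⟶ B} [Mono ι] {p : T ⟶ B}
    (hp : I.{u}.rlp p) (θ : T ⟶ A) (z : A ⟶ T) (hzp : z ≫ p = ι) (hzθ : z ≫ θ = 𝟙 A)
    (H : Nonempty (SSet.Homotopy p (θ ≫ ι))) (H' : Nonempty (SSet.Homotopy (θ ≫ ι) p)) :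
    IsWeakEquivalence ι := by
  rw [← rlp_monomorphisms] at hp
  have := hp ι (MorphismProperty.monomorphisms.infer_property ι)
  have sq : CommSq z ι p (𝟙 B) := ⟨by rw [hzp, Category.comp_id]⟩
  have hs : ι ≫ sq.lift = z := sq.fac_left
  have hsp : sq.lift ≫ p = 𝟙 B := sq.fac_right
  intro K _
  refine ⟨fun a => ⟨sq.lift ≫ θ ≫ a, ?_⟩, fun b b' h => ?_⟩
  · rw [reassoc_of% hs, reassoc_of% hzθ]
    exact homotopy_refl a
  · have h1 := homotopy_postcomp b (homotopy_precomp sq.lift H)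
    have h2 := homotopy_postcomp b' (homotopy_precomp sq.lift H')
    have h3 := homotopy_precomp (sq.lift ≫ θ) h
    rw [hsp, Category.id_comp] at h1 h2
    simp only [Category.assoc] at h1 h2 h3
    exact homotopy_trans h1 (homotopy_trans h3 h2)

theorem IsWeakEquivalence.of_comp_iso {A B B' : SSet.{u}} {f : A ⟶ B} (e : B ⟶ B') [IsIso e]
    (h : IsWeakEquivalence (f ≫ e)) : IsWeakEquivalence f := by
  intro K _
  obtain ⟨h1, h2⟩ := h K
  refine ⟨fun a => ?_, fun b b' hb => ?_⟩
  · obtain ⟨b, hb⟩ := h1 a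
    exact ⟨e ≫ b, by rwa [Category.assoc] at hb⟩
  · have := homotopy_precomp e (h2 (inv e ≫ b) (inv e ≫ b') (by simpa using hb))
    simpa using this

end Simplicial

/-! ### Functions on the boundary of an algebraic simplex -/

section SimplexRing

/-- The barycentric coordinate `t_i` on the algebraic simplex. -/
abbrev bary (k : ℕ) (i : Fin (k + 1)) : simplexRing.{u} k :=
  Ideal.Quotient.mk _ (MvPolynomial.X i)

theorem sum_bary (k : ℕ) : ∑ i, bary.{u} k i = 1 := by
  rw [← sub_eq_zero, ← map_sum, ← map_one (Ideal.Quotient.mk _), ← map_sub]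
  exact Ideal.Quotient.eq_zero_iff_mem.mpr (Ideal.mem_span_singleton_self _)

theorem simplexRingMap_bary_eq_zero {k l : ℕ} (a : Fin (k + 1) → Fin (l + 1)) (i : Fin (l + 1))
    (h : ∀ j, a j ≠ i) : simplexRingMap.{u} a (bary l i) = 0 := by
  rw [simplexRingMap_X, Finset.filter_eq_empty_iff.mpr fun j _ => h j, Finset.sum_empty]

theorem simplexRingMap_bary_of_injective {k l : ℕ} {a : Fin (k + 1) → Fin (l + 1)}
    (ha : Function.Injective a) (j : Fin (k + 1)) :
    simplexRingMap.{u} a (bary l (a j)) = bary k j := by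
  rw [simplexRingMap_X, Finset.sum_eq_single j]
  · intro b hb hbj
    exact absurd (ha (Finset.mem_filter.mp hb).2) hbj
  · simp

theorem simplexRingMap_simplexRingMap {k l m : ℕ} (a : Fin (k + 1) → Fin (l + 1))
    (b : Fin (l + 1) → Fin (m + 1)) (x : simplexRing.{u} m) :
    simplexRingMap.{u} a (simplexRingMap.{u} b x) = simplexRingMap.{u} (fun i => b (a i)) x := by
  rw [← RingHom.comp_apply, ← simplexRingMap_comp]

/-- A map that misses `l` factors through the face opposite to `l`. -/
theorem exists_monotone_succAbove {q p : ℕ} {l : Fin (p + 1)} {e : Fin q → Fin (p + 1)}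
    (he : ∀ x, e x ≠ l) : ∃ b : Fin q → Fin p, (∀ x, l.succAbove (b x) = e x) ∧
      (Monotone e → Monotone b) := by
  choose b hb using fun x => Fin.exists_succAbove_eq (he x)
  refine ⟨b, hb, fun hm x y hxy => ?_⟩
  rw [← Fin.succAbove_le_succAbove_iff (p := l), hb, hb]
  exact hm hxy

/-- A function on a face `t_r = 0` that vanishes on the intersection with the face opposite to
`r.succAbove l'`, pulled back along the map merging the vertex `r` into `r.succAbove i'`, vanishes
on the face opposite to `r.succAbove l'`, if `i' ≠ l'`. -/
theorem simplexRingMap_merge_eq_zero {p : ℕ} (r : Fin (p + 2)) (i' l' : Fin (p + 1)) (h : i' ≠ l')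
    (g : simplexRing.{u} p)
    (hg : ∀ (q : ℕ) (a : Fin (q + 1) → Fin (p + 1)), Monotone a → (∀ x, a x ≠ l') →
      simplexRingMap.{u} a g = 0) :
    simplexRingMap.{u} (r.succAbove l').succAbove
      (simplexRingMap.{u} (Fin.insertNth (α := fun _ => Fin (p + 1)) r i' id) g) = 0 := by
  rw [simplexRingMap_simplexRingMap]
  obtain _ | q := p
  · exact absurd (Fin.ext (by omega)) h
  have hmiss : ∀ x, Fin.insertNth (α := fun _ => Fin (q + 2)) r i' id
      ((r.succAbove l').succAbove x) ≠ l' := by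
    intro x hx
    rcases Fin.eq_self_or_eq_succAbove r ((r.succAbove l').succAbove x) with h1 | ⟨j, h1⟩
    · rw [h1, Fin.insertNth_apply_same] at hx
      exact h hx
    · rw [h1, Fin.insertNth_apply_succAbove] at hx
      rw [id] at hx
      rw [hx] at h1
      exact Fin.succAbove_ne _ _ h1
  obtain ⟨b, hb, -⟩ := exists_monotone_succAbove hmiss
  rw [← funext hb, ← simplexRingMap_simplexRingMap, hg q l'.succAbove
    (Fin.strictMono_succAbove l').monotone (Fin.succAbove_ne l'), map_zero]

theorem simplexRingMap_merge_self {p : ℕ} (r : Fin (p + 2)) (i' : Fin (p + 1))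
    (g : simplexRing.{u} p) :
    simplexRingMap.{u} r.succAbove
      (simplexRingMap.{u} (Fin.insertNth (α := fun _ => Fin (p + 1)) r i' id) g) = g := by
  rw [simplexRingMap_simplexRingMap]
  have : (fun i => Fin.insertNth (α := fun _ => Fin (p + 1)) r i' id (r.succAbove i)) =
    fun i => i := funext fun i => by rw [Fin.insertNth_apply_succAbove]; rfl
  rw [this, simplexRingMap_id]
  rfl

/-- Compatible functions on the faces of an algebraic simplex extend to the simplex. The faces are
handled one after the other; a function `g` on the face `t_r = 0` that vanishes on the faces treated
before is extended by `g` along a merging of vertices while some other face is left, and by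
`∑ t_i • (g along the merging of r into i)` for the last face. -/
theorem exists_simplexRingMap_succAbove_eq {p : ℕ} (c : Fin (p + 2) → simplexRing.{u} p)
    (hc : ∀ (q : ℕ) (a b : Fin (q + 1) → Fin (p + 1)) (i l : Fin (p + 2)), Monotone a →
      Monotone b → (∀ x, i.succAbove (a x) = l.succAbove (b x)) →
      simplexRingMap.{u} a (c i) = simplexRingMap.{u} b (c l)) :
    ∃ f : simplexRing.{u} (p + 1), ∀ i, simplexRingMap.{u} i.succAbove f = c i := by
  suffices H : ∀ L : Finset (Fin (p + 2)), ∃ f : simplexRing.{u} (p + 1),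
      ∀ i ∈ L, simplexRingMap.{u} i.succAbove f = c i by
    obtain ⟨f, hf⟩ := H Finset.univ
    exact ⟨f, fun i => hf i (Finset.mem_univ i)⟩
  intro L
  induction L using Finset.induction_on with
  | empty => exact ⟨0, by simp⟩
  | insert r L hr ih =>
    obtain ⟨f, hf⟩ := ih
    set g := c r - simplexRingMap.{u} r.succAbove f with hgdef
    have hg : ∀ l', r.succAbove l' ∈ L → ∀ (q : ℕ) (a : Fin (q + 1) → Fin (p + 1)), Monotone a →
        (∀ x, a x ≠ l') → simplexRingMap.{u} a g = 0 := by
      intro l' hl q a ha hal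
      obtain ⟨b, hb, hbm⟩ := exists_monotone_succAbove (l := r.succAbove l')
        (e := fun x => r.succAbove (a x))
        (fun x hx => hal x (Fin.succAbove_right_injective hx))
      have hbm' := hbm ((Fin.strictMono_succAbove r).monotone.comp ha)
      rw [hgdef, map_sub, sub_eq_zero, hc q a b r (r.succAbove l') ha hbm' fun x => (hb x).symm,
        simplexRingMap_simplexRingMap, ← hf _ hl, simplexRingMap_simplexRingMap, funext hb]
    suffices H : ∃ f' : simplexRing.{u} (p + 1), simplexRingMap.{u} r.succAbove f' = g ∧
        ∀ l' : Fin (p + 1), r.succAbove l' ∈ L →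
          simplexRingMap.{u} (r.succAbove l').succAbove f' = 0 by
      obtain ⟨f', h1, h2⟩ := H
      refine ⟨f + f', fun i hi => ?_⟩
      rw [map_add]
      rcases Fin.eq_self_or_eq_succAbove r i with rfl | ⟨l', rfl⟩
      · rw [h1, hgdef]; ring
      · have hl : r.succAbove l' ∈ L :=
          (Finset.mem_insert.mp hi).resolve_left (Fin.succAbove_ne _ _)
        rw [h2 l' hl, hf _ hl, add_zero]
    by_cases hi : ∃ i', r.succAbove i' ∉ L
    · obtain ⟨i', hi'⟩ := hi
      refine ⟨simplexRingMap.{u} (Fin.insertNth (α := fun _ => Fin (p + 1)) r i' id) g,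
        simplexRingMap_merge_self r i' g, fun l' hl => ?_⟩
      refine simplexRingMap_merge_eq_zero r i' l' ?_ g (hg l' hl)
      rintro rfl
      exact hi' hl
    · push Not at hi
      refine ⟨∑ i', bary (p + 1) (r.succAbove i') *
        simplexRingMap.{u} (Fin.insertNth (α := fun _ => Fin (p + 1)) r i' id) g, ?_,
        fun l' hl => ?_⟩
      · rw [map_sum]
        have : ∀ i', simplexRingMap.{u} r.succAbove (bary (p + 1) (r.succAbove i') *
          simplexRingMap.{u} (Fin.insertNth (α := fun _ => Fin (p + 1)) r i' id) g) =
          bary p i' * g := by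
          intro i'
          rw [map_mul, simplexRingMap_merge_self,
            simplexRingMap_bary_of_injective Fin.succAbove_right_injective]
        simp only [this]
        rw [← Finset.sum_mul, sum_bary, one_mul]
      · rw [map_sum]
        refine Finset.sum_eq_zero fun i' _ => ?_
        rw [map_mul]
        by_cases h : i' = l'
        · subst h
          rw [simplexRingMap_bary_eq_zero _ _ (Fin.succAbove_ne _), zero_mul]
        · rw [simplexRingMap_merge_eq_zero r i' l' h g (hg l' hl), mul_zero]

/-- The product of the barycentric coordinates, an equation of the boundary. -/
abbrev baryProd (k : ℕ) : simplexRing.{u} k := ∏ i, bary k i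

theorem simplexRingMap_baryProd {p : ℕ} (r : Fin (p + 2)) :
    simplexRingMap.{u} r.succAbove (baryProd (p + 1)) = 0 := by
  rw [map_prod]
  have h : simplexRingMap.{u} r.succAbove (bary (p + 1) r) = 0 :=
    simplexRingMap_bary_eq_zero _ _ (Fin.succAbove_ne r)
  exact Finset.prod_eq_zero (f := fun i => simplexRingMap.{u} r.succAbove (bary (p + 1) i))
    (Finset.mem_univ r) h

/-- An endomorphism that is the identity modulo `t` on generators is so on all elements. That the
`x_i` generate is expressed through homomorphisms, in the form provided by `simplexRing_hom_ext`. -/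
theorem dvd_sub_of_dvd_sub_generators {A : Type u} [CommRing A] {ι : Type*} (x : ι → A)
    (hx : ∀ (R : Type u) [CommRing R] (f g : A →+* R), (∀ i, f (x i) = g (x i)) → f = g)
    (φ : A →+* A) (t : A) (h : ∀ i, t ∣ φ (x i) - x i) (y : A) : t ∣ φ y - y := by
  have key := hx _ ((Ideal.Quotient.mk (Ideal.span {t})).comp φ) (Ideal.Quotient.mk _)
    (fun i => Ideal.Quotient.eq.mpr (Ideal.mem_span_singleton.mpr (h i)))
  exact Ideal.mem_span_singleton.mp (Ideal.Quotient.eq.mp congr($key y))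

theorem sum_merge_eq {A : Type*} [AddCommMonoid A] {p : ℕ} (r : Fin (p + 2)) (i' l : Fin (p + 1))
    (F : Fin (p + 2) → A) :
    ∑ j with Fin.insertNth (α := fun _ => Fin (p + 1)) r i' id j = l, F j =
      (if i' = l then F r else 0) + F (r.succAbove l) := by
  rw [Finset.sum_filter, Fin.sum_univ_succAbove _ r]
  simp only [Fin.insertNth_apply_same, Fin.insertNth_apply_succAbove, id]
  rw [Finset.sum_ite_eq' Finset.univ l, if_pos (Finset.mem_univ l)]

/-- The kernel of the restriction to a face is generated by a barycentric coordinate: restricting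
to the face and pulling back along a merging of vertices is the identity modulo `t_r`. -/
theorem bary_dvd_of_simplexRingMap_eq_zero {p : ℕ} (r : Fin (p + 2)) (y : simplexRing.{u} (p + 1))
    (hy : simplexRingMap.{u} r.succAbove y = 0) : bary (p + 1) r ∣ y := by
  let μ := Fin.insertNth (α := fun _ => Fin (p + 1)) r 0 id
  have key := dvd_sub_of_dvd_sub_generators (bary.{u} (p + 1))
    (fun R _ f g h => simplexRing_hom_ext h)
    ((simplexRingMap.{u} μ).comp (simplexRingMap.{u} r.succAbove)) (bary.{u} (p + 1) r) (by
      intro j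
      rw [RingHom.comp_apply]
      rcases Fin.eq_self_or_eq_succAbove r j with rfl | ⟨l, rfl⟩
      · rw [simplexRingMap_bary_eq_zero _ _ (Fin.succAbove_ne j), map_zero, zero_sub]
        exact (dvd_refl (bary.{u} (p + 1) j)).neg_right
      · rw [simplexRingMap_bary_of_injective Fin.succAbove_right_injective, simplexRingMap_X,
          sum_merge_eq, add_sub_cancel_right]
        split_ifs
        · exact dvd_refl _
        · exact dvd_zero _) y
  rw [RingHom.comp_apply, hy, map_zero, zero_sub] at key
  exact dvd_neg.mp key

end SimplexRing

/-! ### Translations of affine space -/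

section Translation

/-- The translation `x ↦ x + (c_0, …, c_{n-1})` of `𝔸ⁿ_X` by the first `n` members of a sequence of
global functions on `X`. -/
def affTrans (n : ℕ) {X : Scheme.{u}} (c : ℕ → Γ(X, ⊤)) : Aff n X ⟶ Aff n X :=
  AffineSpace.homOfVector (Aff n X ↘ X) fun k =>
    AffineSpace.coord X k + (Aff n X ↘ X).appTop (c k.down)

@[simp]
theorem affTrans_over (n : ℕ) {X : Scheme.{u}} (c : ℕ → Γ(X, ⊤)) :
    affTrans n c ≫ (Aff n X ↘ X) = Aff n X ↘ X :=
  AffineSpace.homOfVector_over _ _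

theorem affTrans_coord (n : ℕ) {X : Scheme.{u}} (c : ℕ → Γ(X, ⊤)) (k : ULift.{u} (Fin n)) :
    (affTrans n c).appTop (AffineSpace.coord X k) =
      AffineSpace.coord X k + (Aff n X ↘ X).appTop (c k.down) :=
  AffineSpace.homOfVector_appTop_coord _ _ _

theorem affTrans_comp (n : ℕ) {X : Scheme.{u}} (c d : ℕ → Γ(X, ⊤)) :
    affTrans n c ≫ affTrans n d = affTrans n (c + d) := by
  refine AffineSpace.hom_ext ?_ fun k => ?_
  · rw [Category.assoc, affTrans_over, affTrans_over, affTrans_over]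
  · rw [Scheme.Hom.comp_appTop, CommRingCat.comp_apply, affTrans_coord, map_add, affTrans_coord,
      ← CommRingCat.comp_apply, ← Scheme.Hom.comp_appTop, affTrans_over, affTrans_coord,
      Pi.add_apply, map_add]
    ring

theorem affTrans_zero (n : ℕ) (X : Scheme.{u}) : affTrans n (0 : ℕ → Γ(X, ⊤)) = 𝟙 _ := by
  refine AffineSpace.hom_ext ?_ fun k => ?_
  · rw [affTrans_over, Category.id_comp]
  · rw [affTrans_coord, Pi.zero_apply, map_zero, add_zero]
    simp

instance (n : ℕ) {X : Scheme.{u}} (c : ℕ → Γ(X, ⊤)) : IsIso (affTrans n c) :=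
  ⟨affTrans n (-c), by rw [affTrans_comp, add_neg_cancel, affTrans_zero],
    by rw [affTrans_comp, neg_add_cancel, affTrans_zero]⟩

theorem affTrans_map (n : ℕ) {X X' : Scheme.{u}} (g : X' ⟶ X) (c : ℕ → Γ(X, ⊤)) :
    affTrans n (fun r => g.appTop (c r)) ≫ affMap n g = affMap n g ≫ affTrans n c := by
  refine AffineSpace.hom_ext ?_ fun k => ?_
  · rw [Category.assoc, Category.assoc, affTrans_over, AffineSpace.map_over,
      reassoc_of% (affTrans_over.{u})]
  · rw [Scheme.Hom.comp_appTop, Scheme.Hom.comp_appTop, CommRingCat.comp_apply,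
      CommRingCat.comp_apply, AffineSpace.map_appTop_coord, affTrans_coord, affTrans_coord, map_add,
      AffineSpace.map_appTop_coord]
    congr 1
    rw [← CommRingCat.comp_apply, ← CommRingCat.comp_apply, ← Scheme.Hom.comp_appTop,
      ← Scheme.Hom.comp_appTop, AffineSpace.map_over]

theorem affTrans_proj (n : ℕ) {X : Scheme.{u}} (c : ℕ → Γ(X, ⊤)) :
    affTrans (n + 1) c ≫ affProj n X = affProj n X ≫ affTrans n c := by
  have e : ∀ k, (affProj n X).appTop (AffineSpace.coord X k) =
    AffineSpace.coord X ⟨k.down.castSucc⟩ := fun k => AffineSpace.reindex_appTop_coord _ _ _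
  refine AffineSpace.hom_ext ?_ fun k => ?_
  · rw [Category.assoc, Category.assoc, affTrans_over, affProj_over, affTrans_over]
  · rw [Scheme.Hom.comp_appTop, Scheme.Hom.comp_appTop, CommRingCat.comp_apply,
      CommRingCat.comp_apply, e, affTrans_coord, affTrans_coord, map_add, e]
    congr 1
    rw [← CommRingCat.comp_apply, ← Scheme.Hom.comp_appTop, affProj_over]
    rfl

theorem affTrans_lastCoord (n : ℕ) {X : Scheme.{u}} (c : ℕ → Γ(X, ⊤)) :
    (affTrans (n + 1) c).appTop (lastCoord n X) =
      lastCoord n X + (Aff (n + 1) X ↘ X).appTop (c n) :=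
  affTrans_coord _ _ _

/-- A translation that is trivial in the last coordinate is compatible with the suspension. -/
theorem affTrans_affZero (n : ℕ) {X : Scheme.{u}} (c : ℕ → Γ(X, ⊤)) (hc : c n = 0) :
    affZero n X ≫ affTrans (n + 1) c = affTrans n c ≫ affZero n X := by
  refine aff_hom_ext ?_ ?_
  · rw [Category.assoc, Category.assoc, affTrans_proj, affZero_proj, ← Category.assoc,
      affZero_proj, Category.id_comp, Category.comp_id]
  · rw [Scheme.Hom.comp_appTop, Scheme.Hom.comp_appTop, CommRingCat.comp_apply,
      CommRingCat.comp_apply, affTrans_lastCoord, hc, map_zero, add_zero, affZero_lastCoord,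
      map_zero]

end Translation

/-! ### Moving a framed correspondence by an automorphism of affine space -/

section Moved

variable {S : Scheme.{u}} {n : ℕ} {X X' : Over S} {Y Y' : SchPt S}

/-- `D'` is obtained from `D` by applying the inverse of the automorphism `G` of `𝔸ⁿ_X`. -/
def NFr.Moved {n : ℕ} {X Y : Over S} (G : Aff n X.left ⟶ Aff n X.left) (D' D : NFr n X Y) : Prop :=
  ∃ (e : D'.Z ≅ D.Z) (sq : D'.i ≫ G = e.hom ≫ D.i), e.hom ≫ D.h = D'.h ∧
    Framing.IsInduced sq D'.framing D.framing

theorem NFr.Moved.comp {Y : Over S} {G G' : Aff n X.left ⟶ Aff n X.left} {D D' D'' : NFr n X Y}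
    (h' : D''.Moved G' D') (h : D'.Moved G D) : D''.Moved (G' ≫ G) D := by
  obtain ⟨e, sq, hh, f⟩ := h
  obtain ⟨e', sq', hh', f'⟩ := h'
  have sq₀ : D''.i ≫ G' ≫ G = (e' ≪≫ e).hom ≫ D.i := by
    rw [reassoc_of% sq', sq, Iso.trans_hom, Category.assoc]
  exact ⟨e' ≪≫ e, sq₀, by rw [Iso.trans_hom, Category.assoc, hh, hh'],
    f'.comp f sq₀ rfl rfl⟩

/-- Two correspondences moved to the same one by the same `G` are isomorphic. -/
theorem NFr.Moved.rel_of_comp {Y : Over S} {G : Aff n X.left ⟶ Aff n X.left} [Mono G]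
    {D D' D'' : NFr n X Y} (h' : D''.Moved G D) (h : D'.Moved G D) : D''.Rel D' := by
  obtain ⟨e, sq, hh, f⟩ := h
  obtain ⟨e', sq', hh', f'⟩ := h'
  have sq₀ : D''.i ≫ 𝟙 _ = (e' ≪≫ e.symm).hom ≫ D'.i := by
    rw [← cancel_mono G, Category.comp_id, Category.assoc, sq, sq']
    simp
  refine ⟨e' ≪≫ e.symm, sq₀, ?_, f'.of_comp f sq₀ (by simp) (Category.id_comp _).symm⟩
  rw [← hh, ← hh']
  simp

theorem NFr.Moved.trans_rel {Y : Over S} {G : Aff n X.left ⟶ Aff n X.left} {D D₁ D' : NFr n X Y}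
    (h : D'.Moved G D) (r : D.Rel D₁) : D'.Moved G D₁ := by
  have h1 : D.Moved (𝟙 _) D₁ := r
  have h2 := h.comp h1
  rwa [Category.comp_id] at h2

/-- Framings pulled back along a map of affine spaces are compatible with suspension. -/
theorem Framing.IsInduced.suspend_of_square {n : ℕ} {Z Z' X X' : Scheme.{u}} {i : Z ⟶ Aff n X}
    {i' : Z' ⟶ Aff n X'} {w : Z' ⟶ Z} {G : Aff n X' ⟶ Aff n X}
    {G' : Aff (n + 1) X' ⟶ Aff (n + 1) X} (hG : affProj n X' ≫ G = G' ≫ affProj n X)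
    (hG' : G'.appTop (lastCoord n X) = lastCoord n X') {sq : i' ≫ G = w ≫ i}
    {t : Framing i n} {t' : Framing i' n} (h : Framing.IsInduced sq t' t)
    (sq' : (i' ≫ affZero n X') ≫ G' = w ≫ (i ≫ affZero n X)) :
    Framing.IsInduced sq' t'.suspend t.suspend := by
  intro z j
  induction j using Fin.lastCases with
  | last =>
    simp only [Framing.suspend, Fin.lastCases_last]
    refine Eq.trans ?_ (conormalMap_conormalGerm sq' z ⊤ trivial (lastSection n i ⊤)).symm
    change conormalGerm _ ⊤ _ _ _ = conormalGerm _ ⊤ _ _ _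
    congr 1
    apply Subtype.ext
    change (Aff (n + 1) X').presheaf.map (𝟙 _) (lastCoord n X') =
      G'.appTop ((Aff (n + 1) X).presheaf.map (𝟙 _) (lastCoord n X))
    simp only [CategoryTheory.Functor.map_id, CommRingCat.id_apply]
    exact hG'.symm
  | cast j =>
    simp only [Framing.suspend, Fin.lastCases_castSucc]
    rw [h z j]
    obtain ⟨V, s, hz, -, hs, -⟩ := t.exists_chart (w z)
    rw [hs _ hz, conormalMap_conormalGerm]
    refine (conormalMap_conormalGerm (affZero_square n i') z (G ⁻¹ᵁ V)
      (mem_preimage_of_square sq hz) (sectionMap sq V (s j))).trans ?_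
    refine Eq.trans ?_ (congrArg (conormalMap sq' z)
      (conormalMap_conormalGerm (affZero_square n i) (w z) V hz (s j)).symm)
    refine Eq.trans ?_ (conormalMap_conormalGerm sq' z (affProj n X ⁻¹ᵁ V)
      (mem_preimage_of_square (affZero_square n i) (w := 𝟙 Z) hz)
      (sectionMap (affZero_square n i) V (s j))).symm
    have key : ∀ (f₁ f₂ : Aff (n + 1) X' ⟶ Aff n X) (hf : f₁ = f₂) (x : Γ(Aff n X, V))
      (s₁ : sectionIdeal (i' ≫ affZero n X') (f₁ ⁻¹ᵁ V))
      (s₂ : sectionIdeal (i' ≫ affZero n X') (f₂ ⁻¹ᵁ V))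
      (hs₁ : s₁.1 = f₁.app V x) (hs₂ : s₂.1 = f₂.app V x) (h1) (h2),
      conormalGerm _ _ z h1 s₁ = conormalGerm _ _ z h2 s₂ := by
      rintro f₁ _ rfl x s₁ s₂ hs₁ hs₂ h1 h2
      congr 1
      exact Subtype.ext (hs₁.trans hs₂.symm)
    exact key (affProj n X' ≫ G) (G' ≫ affProj n X) hG (s j).1 _ _ rfl rfl _ _

theorem NFr.Moved.suspend {Y : Over S} {D D' : NFr n X Y} {c : ℕ → Γ(X.left, ⊤)} (hc : c n = 0)
    (h : D'.Moved (affTrans n c) D) : D'.suspend.Moved (affTrans (n + 1) c) D.suspend := by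
  obtain ⟨e, sq, hh, f⟩ := h
  have sq' : (D'.i ≫ affZero n X.left) ≫ affTrans (n + 1) c =
      e.hom ≫ (D.i ≫ affZero n X.left) := by
    rw [Category.assoc, affTrans_affZero n c hc, reassoc_of% sq]
  exact ⟨e, sq', hh, f.suspend_of_square (affTrans_proj n c).symm
    (by rw [affTrans_lastCoord, hc, map_zero, add_zero]) sq'⟩

/-- The translate of a framed correspondence in `𝔸ⁿ_X`. -/
def NFr.translate {Y : Over S} (D : NFr n X Y) (c : ℕ → Γ(X.left, ⊤)) : NFr n X Y where
  Z := D.Z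
  i := D.i ≫ affTrans n c
  h := D.h
  isClosedImmersion := inferInstance
  isFinite := by rw [Category.assoc, affTrans_over]; exact D.isFinite
  isSyntomic := by rw [Category.assoc, affTrans_over]; exact D.isSyntomic
  w := by rw [Category.assoc D.i, affTrans_over]; exact D.w
  framing := Framing.ofCharts (w := 𝟙 D.Z) (G := affTrans n (-c)) (by
      rw [Category.assoc, affTrans_comp, add_neg_cancel, affTrans_zero, Category.comp_id,
        Category.id_comp]) D.framing fun z V s hz hs => by
    have := D.isSyntomic.flat
    have sq : 𝟙 D.Z ≫ D.i = (D.i ≫ affTrans n c) ≫ affTrans n (-c) := by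
      rw [Category.assoc, affTrans_comp, add_neg_cancel, affTrans_zero, Category.comp_id,
        Category.id_comp]
    exact hs.2.2.baseChange (IsPullback.of_horiz_isIso ⟨sq⟩)
      (π := Aff n X.left ↘ X.left) (π' := Aff n X.left ↘ X.left) (g := 𝟙 _)
      (IsPullback.of_horiz_isIso ⟨by rw [affTrans_over, Category.comp_id]⟩) hs.1 z hz

theorem NFr.translate_moved {Y : Over S} (D : NFr n X Y) (c : ℕ → Γ(X.left, ⊤)) :
    (D.translate c).Moved (affTrans n (-c)) D :=
  ⟨Iso.refl _, by
    change (D.i ≫ affTrans n c) ≫ affTrans n (-c) = 𝟙 _ ≫ D.i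
    rw [Category.assoc, affTrans_comp, add_neg_cancel, affTrans_zero, Category.comp_id,
      Category.id_comp], Category.id_comp _, fun _ _ => rfl⟩

theorem NFr.Rel.translate {Y : Over S} {D D' : NFr n X Y} (h : D.Rel D') (c : ℕ → Γ(X.left, ⊤)) :
    (D.translate c).Rel (D'.translate c) :=
  ((D.translate_moved c).trans_rel h).rel_of_comp (D'.translate_moved c)

theorem NFr.translate_translate {Y : Over S} (D : NFr n X Y) (c d : ℕ → Γ(X.left, ⊤)) :
    ((D.translate c).translate d).Rel (D.translate (d + c)) := by
  have h := ((D.translate c).translate_moved d).comp (D.translate_moved c)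
  rw [affTrans_comp, ← neg_add] at h
  exact h.rel_of_comp (D.translate_moved _)

theorem NFr.translate_zero {Y : Over S} (D : NFr n X Y) : (D.translate 0).Rel D := by
  have h := D.translate_moved 0
  rw [neg_zero, affTrans_zero] at h
  exact h

theorem NFr.translate_suspend {Y : Over S} (D : NFr n X Y) (c : ℕ → Γ(X.left, ⊤)) (hc : c n = 0) :
    (D.translate c).suspend.Rel (D.suspend.translate c) :=
  ((D.translate_moved c).suspend (c := -c) (by rw [Pi.neg_apply, hc, neg_zero])).rel_of_comp
    (D.suspend.translate_moved c)

theorem IsTransport.translate {g : X' ⟶ X} {p : Y ⟶ Y'} {D : NFr n X Y.sch}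
    {D' : NFr n X' Y'.sch} (h : IsTransport g p D' D) (c : ℕ → Γ(X.left, ⊤)) :
    IsTransport g p (D'.translate fun r => g.left.appTop (c r)) (D.translate c) := by
  obtain ⟨w, sq, hh, u, f⟩ := h
  have sq₁ : (D'.i ≫ affTrans n fun r => g.left.appTop (c r)) ≫ affMap n g.left =
      w ≫ D.i ≫ affTrans n c := by
    rw [Category.assoc, affTrans_map, reassoc_of% sq]
  have hneg : affTrans n (-fun r => g.left.appTop (c r)) ≫ affMap n g.left =
      affMap n g.left ≫ affTrans n (-c) := by
    rw [← affTrans_map]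
    congr 2
    ext r
    simp
  have u' : ∀ (T : Scheme.{u}) (a : T ⟶ D.Z) (b : T ⟶ Aff n X'.left) (c' : T ⟶ Y'.sch.left),
      b ≫ affMap n g.left = a ≫ D.i ≫ affTrans n c →
      a ≫ D.h ≫ plusRes p = c' ≫ inclPlus Y'.sch →
      ∃ l : T ⟶ D'.Z, l ≫ w = a ∧ l ≫ D'.i ≫ affTrans n (fun r => g.left.appTop (c r)) = b := by
    intro T a b c' h1 h2
    obtain ⟨l, hl, hl'⟩ := u T a (b ≫ affTrans n (-fun r => g.left.appTop (c r))) c' (by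
      rw [Category.assoc, hneg, reassoc_of% h1, affTrans_comp, add_neg_cancel, affTrans_zero,
        Category.comp_id]) h2
    exact ⟨l, hl, by rw [reassoc_of% hl', affTrans_comp, neg_add_cancel, affTrans_zero,
      Category.comp_id]⟩
  refine ⟨w, sq₁, hh, u', ?_⟩
  -- both framings are pulled back from the one of `D` along the same square
  have sq₄ : (D'.i ≫ affTrans n fun r => g.left.appTop (c r)) ≫ (affMap n g.left ≫
      affTrans n (-c)) = w ≫ D.i := by
    rw [← Category.assoc, sq₁, Category.assoc, Category.assoc, affTrans_comp, add_neg_cancel,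
      affTrans_zero, Category.comp_id]
  have sq₅ : (D'.i ≫ affTrans n fun r => g.left.appTop (c r)) ≫
      affTrans n (-fun r => g.left.appTop (c r)) = 𝟙 _ ≫ D'.i := by
    rw [Category.assoc, affTrans_comp, add_neg_cancel, affTrans_zero, Category.comp_id,
      Category.id_comp]
  have sq₆ : (D.i ≫ affTrans n c) ≫ affTrans n (-c) = 𝟙 _ ≫ D.i := by
    rw [Category.assoc, affTrans_comp, add_neg_cancel, affTrans_zero, Category.comp_id,
      Category.id_comp]
  have F' : Framing.IsInduced sq₅ (D'.translate fun r => g.left.appTop (c r)).framing D'.framing :=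
    fun _ _ => rfl
  have F : Framing.IsInduced sq₆ (D.translate c).framing D.framing := fun _ _ => rfl
  exact (F'.comp f sq₄ (Category.id_comp _).symm hneg.symm).of_comp F sq₁
    (Category.comp_id _).symm rfl

end Moved

/-! ### Morphisms that are finite, syntomic or closed immersions on the members of a family -/

section Family

variable {k : ℕ} {Z A : Scheme.{u}} {Z' : Fin k → Scheme.{u}} {o : ∀ j, Z' j ⟶ Z}

theorem isClosedMap_of_family {α β : Type*} [TopologicalSpace α] [TopologicalSpace β]
    {γ : Fin k → Type*} [∀ j, TopologicalSpace (γ j)] {o : ∀ j, γ j → α}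
    (ho : ∀ z, ∃ j z', o j z' = z) (hc : ∀ j, Continuous (o j)) {f : α → β}
    (h : ∀ j, IsClosedMap (f ∘ o j)) : IsClosedMap f := by
  intro C hC
  have e : f '' C = ⋃ j, (f ∘ o j) '' (o j ⁻¹' C) := by
    ext y
    simp only [Set.mem_image, Set.mem_iUnion, Set.mem_preimage]
    constructor
    · rintro ⟨z, hz, rfl⟩
      obtain ⟨j, z', rfl⟩ := ho z
      exact ⟨j, z', hz, rfl⟩
    · rintro ⟨j, z', hz, rfl⟩
      exact ⟨_, hz, rfl⟩
  rw [e]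
  exact isClosed_iUnion_of_finite fun j => h j _ (hC.preimage (hc j))

theorem universallyClosed_of_family (ho : ∀ z, ∃ j z', o j z' = z) {f : Z ⟶ A}
    (h : ∀ j, UniversallyClosed (o j ≫ f)) : UniversallyClosed f := by
  rw [universallyClosed_eq]
  intro Z₁ A₁ b a f₁ pb
  have h1 : ∀ j, IsPullback (pullback.snd (o j) b) (pullback.fst (o j) b) b (o j) := fun j =>
    (IsPullback.of_hasPullback (o j) b).flip
  refine isClosedMap_of_family (o := fun j => pullback.snd (o j) b) ?_
    (fun j => Scheme.Hom.continuous _) ?_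
  · intro z
    obtain ⟨j, z', hz'⟩ := ho (b z)
    obtain ⟨x, hx, -⟩ := Scheme.exists_preimage_of_isPullback (h1 j) z z' hz'.symm
    exact ⟨j, x, hx⟩
  · intro j
    have h2 : UniversallyClosed (pullback.snd (o j) b ≫ f₁) :=
      MorphismProperty.of_isPullback ((h1 j).flip.paste_vert pb.flip) (h j)
    exact Scheme.Hom.isClosedMap (pullback.snd (o j) b ≫ f₁)

/-- The open covering given by a jointly surjective family of open immersions. -/
abbrev familyCover (o : ∀ j, Z' j ⟶ Z) [∀ j, IsOpenImmersion (o j)]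
    (ho : ∀ z, ∃ j z', o j z' = z) : Z.OpenCover :=
  Scheme.Cover.mkOfCovers (Fin k) Z' o ho

variable [∀ j, IsOpenImmersion (o j)]

/-- The closedness of `f` uses that the family is finite. -/
theorem isClosedImmersion_of_family (ho : ∀ z, ∃ j z', o j z' = z) {f : Z ⟶ A}
    (h : ∀ j, IsClosedImmersion (o j ≫ f)) (hf : Function.Injective f) : IsClosedImmersion f := by
  rw [isClosedImmersion_iff]
  constructor
  · rw [IsZariskiLocalAtSource.iff_of_openCover (P := @SurjectiveOnStalks) (familyCover o ho)]
    exact fun j => (h j).toSurjectiveOnStalks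
  · refine .of_continuous_injective_isClosedMap f.continuous hf ?_
    exact isClosedMap_of_family (o := fun j => o j) ho (fun j => (o j).continuous) fun j =>
      (h j).isClosedEmbedding.isClosedMap

theorem HasLciChart.comp_openImmersion {K : CommRingCat.{u}} {F F' : Scheme.{u}} {p : F ⟶ Spec K}
    (o : F' ⟶ F) [IsOpenImmersion o] {y : F'} (h : HasLciChart (o ≫ p) y) :
    HasLciChart p (o y) := by
  obtain ⟨P, Q, φ, q, rs, j, hφ, hq, hker, hreg, hj, ⟨y₀, hy₀⟩, hjp⟩ := h
  exact ⟨P, Q, φ, q, rs, j ≫ o, hφ, hq, hker, hreg, inferInstance, ⟨y₀, congrArg o hy₀⟩,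
    by rw [Category.assoc, hjp]⟩

theorem isSyntomic_of_family (ho : ∀ z, ∃ j z', o j z' = z) {f : Z ⟶ A}
    (h : ∀ j, IsSyntomic (o j ≫ f)) : IsSyntomic f where
  flat := by
    have : IsZariskiLocalAtSource @Flat.{u} :=
      HasRingHomProperty.instIsZariskiLocalAtSource
    rw [IsZariskiLocalAtSource.iff_of_openCover (P := @Flat) (familyCover o ho)]
    exact fun j => (h j).flat
  locallyOfFinitePresentation := by
    have : IsZariskiLocalAtSource @LocallyOfFinitePresentation.{u} :=
      HasRingHomProperty.instIsZariskiLocalAtSource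
    rw [IsZariskiLocalAtSource.iff_of_openCover (P := @LocallyOfFinitePresentation)
      (familyCover o ho)]
    exact fun j => (h j).locallyOfFinitePresentation
  isLci_fiber x y := by
    obtain ⟨j, z', hz'⟩ := ho (f.fiberι x y)
    have h1 : IsPullback ((o j ≫ f).fiberι x) ((o j ≫ f).fiberToSpecResidueField x) (o j ≫ f)
      (A.fromSpecResidueField x) := IsPullback.of_hasPullback _ _
    have h2 : IsPullback (f.fiberι x) (f.fiberToSpecResidueField x) f
      (A.fromSpecResidueField x) := IsPullback.of_hasPullback _ _
    let e := h2.lift ((o j ≫ f).fiberι x ≫ o j) ((o j ≫ f).fiberToSpecResidueField x)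
      (by rw [Category.assoc, h1.w])
    have h3 : IsPullback e ((o j ≫ f).fiberι x) (f.fiberι x) (o j) := by
      refine IsPullback.of_right (h₁₂ := f.fiberToSpecResidueField x) (h₂₂ := f)
        (v₁₃ := A.fromSpecResidueField x) ?_ (h2.lift_fst _ _ _) h2.flip
      rw [h2.lift_snd]
      exact h1.flip
    have he : IsOpenImmersion e := MorphismProperty.of_isPullback h3.flip inferInstance
    obtain ⟨y', hy', -⟩ := Scheme.exists_preimage_of_isPullback h3 y z' hz'.symm
    have h4 := (h j).isLci_fiber x y'
    rw [← h2.lift_snd ((o j ≫ f).fiberι x ≫ o j) ((o j ≫ f).fiberToSpecResidueField x)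
      (by rw [Category.assoc, h1.w])] at h4
    have h5 := HasLciChart.comp_openImmersion e h4
    rwa [show e y' = y from hy'] at h5

theorem isFinite_of_family (ho : ∀ z, ∃ j z', o j z' = z) {f : Z ⟶ A} [IsAffineHom f]
    (h : ∀ j, IsFinite (o j ≫ f)) : IsFinite f := by
  rw [IsFinite.iff_isIntegralHom_and_locallyOfFiniteType,
    IsIntegralHom.iff_universallyClosed_and_isAffineHom]
  refine ⟨⟨universallyClosed_of_family ho fun j => inferInstance, inferInstance⟩, ?_⟩
  have : IsZariskiLocalAtSource @LocallyOfFiniteType.{u} :=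
    HasRingHomProperty.instIsZariskiLocalAtSource
  rw [IsZariskiLocalAtSource.iff_of_openCover (P := @LocallyOfFiniteType) (familyCover o ho)]
  exact fun j => ((IsFinite.iff_isIntegralHom_and_locallyOfFiniteType _).mp (h j)).2

end Family

/-! ### Conormal sheaves and open immersions -/

section ConormalOpen

variable {Z Z' A : Scheme.{u}}

theorem squareStalkMap_bijective {i : Z ⟶ A} {i' : Z' ⟶ A} {w : Z' ⟶ Z}
    (sq : i' ≫ 𝟙 A = w ≫ i) (z : Z') : Function.Bijective (squareStalkMap sq z) := by
  have e : i (w z) = i' z := by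
    change (w ≫ i) z = _
    rw [← sq, Category.comp_id]
  have h : ∀ (x y : A) (e : x = y) (h : x ⤳ y), IsIso (A.presheaf.stalkSpecializes h) := by
    rintro x _ rfl h
    rw [TopCat.Presheaf.stalkSpecializes_refl]
    infer_instance
  have h2 : IsIso (squareStalkMap sq z) := by
    unfold squareStalkMap
    exact IsIso.comp_isIso' (h _ _ (by rw [e]; rfl) _) inferInstance
  exact (ConcreteCategory.isIso_iff_bijective _).mp h2

theorem stalkIdeal_eq_map {i : Z ⟶ A} {i' : Z' ⟶ A} {w : Z' ⟶ Z} [IsOpenImmersion w]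
    (sq : i' ≫ 𝟙 A = w ≫ i) (z : Z') :
    (stalkIdeal i (w z)).map (squareStalkMap sq z).hom = stalkIdeal i' z := by
  have hb := squareStalkMap_bijective sq z
  apply le_antisymm
  · rw [Ideal.map_le_iff_le_comap]
    exact stalkIdeal_le_comap sq z
  · intro x hx
    obtain ⟨y, rfl⟩ := hb.2 x
    refine Ideal.mem_map_of_mem _ ?_
    rw [RingHom.mem_ker] at hx ⊢
    have e := congr($(squareStalkMap_stalkMap sq z) y)
    have hw : Function.Injective (w.stalkMap z) :=
      ((ConcreteCategory.isIso_iff_bijective _).mp inferInstance).1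
    apply hw
    rw [map_zero]
    exact e.symm.trans hx

/-- The conormal sheaf of an open subscheme of `Z` is the restriction of the one of `Z`. -/
theorem conormalMap_bijective {i : Z ⟶ A} {i' : Z' ⟶ A} {w : Z' ⟶ Z} [IsOpenImmersion w]
    (sq : i' ≫ 𝟙 A = w ≫ i) (z : Z') : Function.Bijective (conormalMap sq z) := by
  have hb := squareStalkMap_bijective sq z
  have hmap := stalkIdeal_eq_map sq z
  constructor
  · rw [injective_iff_map_eq_zero]
    intro a ha
    obtain ⟨a, rfl⟩ := Ideal.toCotangent_surjective _ a
    replace ha : squareStalkMap sq z a.1 ∈ (stalkIdeal i' z) ^ 2 :=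
      (Ideal.toCotangent_eq_zero _ _).mp ha
    rw [← hmap, ← Ideal.map_pow, Ideal.mem_map_iff_of_surjective _ hb.2] at ha
    obtain ⟨y, hy, hy'⟩ := ha
    obtain rfl : y = a.1 := hb.1 hy'
    exact (Ideal.toCotangent_eq_zero _ _).mpr hy
  · intro b
    obtain ⟨⟨b, hb'⟩, rfl⟩ := Ideal.toCotangent_surjective _ b
    rw [← hmap, Ideal.mem_map_iff_of_surjective _ hb.2] at hb'
    obtain ⟨y, hy, rfl⟩ := hb'
    exact ⟨(stalkIdeal i (w z)).toCotangent ⟨y, hy⟩, rfl⟩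

/-- Charts of a framing of an open subscheme of `Z` are charts for `Z`, after shrinking. -/
theorem Framing.exists_chart_of_openImmersion {i : Z ⟶ A} [IsClosedImmersion i] {w : Z' ⟶ Z}
    [IsOpenImmersion w] {i' : Z' ⟶ A} [IsClosedImmersion i'] (sq : i' ≫ 𝟙 A = w ≫ i) {n : ℕ}
    (t : Framing i' n) (z : Z') :
    ∃ (V : A.Opens) (s : Fin n → sectionIdeal i V), i (w z) ∈ V ∧ i ⁻¹ᵁ V ≤ w.opensRange ∧
      IsAffineOpen V ∧ IsConormalBasis (sectionIdeal i V) s ∧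
      ∀ y (hy : i (w y) ∈ V) j, t.sec y j = conormalMap sq y (conormalGerm i V (w y) hy (s j)) := by
  obtain rfl : i' = w ≫ i := by rw [← sq, Category.comp_id]
  obtain ⟨V₁, s₁, hz₁, hV₁, hs₁, hb₁⟩ := t.exists_chart z
  let C : Set A := i '' (w.opensRange : Set Z)ᶜ
  have hC : IsClosed C := i.isClosedEmbedding.isClosedMap _ w.opensRange.isOpen.isClosed_compl
  obtain ⟨V, hV, hzV, hle'⟩ := exists_isAffineOpen_mem_and_subset (X := A)
    (x := (w ≫ i) z) (U := V₁ ⊓ ⟨Cᶜ, hC.isOpen_compl⟩) ⟨hz₁, by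
      rintro ⟨y, hy, hy2⟩
      exact hy ⟨z, (i.isClosedEmbedding.injective hy2).symm⟩⟩
  have hle : V ≤ V₁ := fun x hx => (hle' hx).1
  have hr : i ⁻¹ᵁ V ≤ w.opensRange := by
    intro y hy
    by_contra hcon
    exact (hle' hy).2 ⟨y, hcon, rfl⟩
  have e := sectionIdeal_comp_openImmersion i w V hr
  refine ⟨V, fun j => ⟨_, e ▸ (sectionRestrict (w ≫ i) hle (s₁ j)).2⟩, hzV, hr, hV,
    isConormalBasis_of_eq e (fun j => rfl) (hb₁.restrict hV₁ hV hle), fun y hy j => ?_⟩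
  rw [hs₁ y (hle hy) j, conormalMap_conormalGerm, ← conormalGerm_restrict (w ≫ i) hle y hy]
  rfl

/-- Framings of the members of a disjoint open covering glue. -/
theorem Framing.exists_glue {k : ℕ} {Z' : Fin k → Scheme.{u}} (o : ∀ j, Z' j ⟶ Z)
    [∀ j, IsOpenImmersion (o j)] (ho : ∀ z, ∃ j z', o j z' = z)
    (hd : ∀ j l x y, o j x = o l y → j = l) {i : Z ⟶ A} [IsClosedImmersion i]
    {i' : ∀ j, Z' j ⟶ A} [∀ j, IsClosedImmersion (i' j)] (sq : ∀ j, i' j ≫ 𝟙 A = o j ≫ i) {n : ℕ}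
    (t : ∀ j, Framing (i' j) n) : ∃ t₀ : Framing i n, ∀ j, Framing.IsInduced (sq j) (t j) t₀ := by
  have h1 : ∀ z, ∃ a : Fin n → ConormalStalk i z, ∀ j z' (h : o j z' = z) m,
      (t j).sec z' m = conormalMap (sq j) z' (h ▸ a m) := by
    intro z
    obtain ⟨j, z', rfl⟩ := ho z
    choose a ha using fun m => (conormalMap_bijective (sq j) z').2 ((t j).sec z' m)
    refine ⟨a, fun l y h m => ?_⟩
    obtain rfl := hd _ _ _ _ h
    obtain rfl := (o l).isOpenEmbedding.injective h
    exact (ha m).symm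
  choose a ha using h1
  refine ⟨⟨a, fun z => ?_⟩, fun j z m => ha _ j z rfl m⟩
  obtain ⟨j, z', rfl⟩ := ho z
  obtain ⟨V, s, hz, hr, hV, hb, hs⟩ := (t j).exists_chart_of_openImmersion (sq j) z'
  refine ⟨V, s, hz, hV, fun y hy m => ?_, hb⟩
  obtain ⟨y', rfl⟩ := hr hy
  exact (conormalMap_bijective (sq j) y').1 ((ha _ j y' rfl m).symm.trans (hs y' hy m))

end ConormalOpen

/-! ### Decompositions of the target of a framed correspondence -/

section Decomposition

variable {S : Scheme.{u}} {n k : ℕ} {X : Over S}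

theorem Framing.IsInduced.congr_map {Z Z' A A' : Scheme.{u}} {i : Z ⟶ A} {i' : Z' ⟶ A'}
    {w : Z' ⟶ Z} {G G' : A' ⟶ A} {sq : i' ≫ G = w ≫ i} {t : Framing i n} {t' : Framing i' n}
    (h : Framing.IsInduced sq t' t) (hG : G = G') (sq' : i' ≫ G' = w ≫ i) :
    Framing.IsInduced sq' t' t := by
  subst hG
  exact h

/-- Whether a framing is pulled back from another one can be checked on an open covering. -/
theorem Framing.IsInduced.of_family {Z Z' A A' : Scheme.{u}} {i : Z ⟶ A} {i' : Z' ⟶ A'}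
    {w : Z' ⟶ Z} {G : A' ⟶ A} (sq : i' ≫ G = w ≫ i) {t : Framing i n} {t' : Framing i' n}
    {Z'' : Fin k → Scheme.{u}} {o : ∀ j, Z'' j ⟶ Z'} [∀ j, IsOpenImmersion (o j)]
    (ho : ∀ z, ∃ j z', o j z' = z) {i'' : ∀ j, Z'' j ⟶ A'} {sq' : ∀ j, i'' j ≫ 𝟙 A' = o j ≫ i'}
    {t'' : ∀ j, Framing (i'' j) n} (h' : ∀ j, Framing.IsInduced (sq' j) (t'' j) t')
    {w₀ : ∀ j, Z'' j ⟶ Z} (hw : ∀ j, w₀ j = o j ≫ w) {sq₀ : ∀ j, i'' j ≫ G = w₀ j ≫ i}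
    (h₀ : ∀ j, Framing.IsInduced (sq₀ j) (t'' j) t) : Framing.IsInduced sq t' t := by
  obtain rfl : w₀ = fun j => o j ≫ w := funext hw
  intro z m
  obtain ⟨j, x, rfl⟩ := ho z
  refine (conormalMap_bijective (sq' j) x).1 ((h' j x m).symm.trans ((h₀ j x m).trans ?_))
  obtain ⟨V, s, hz, -, hs, -⟩ := t.exists_chart (w (o j x))
  rw [hs _ hz, hs ((o j ≫ w) x) (by simpa using hz), conormalMap_conormalGerm,
    conormalMap_conormalGerm, conormalMap_conormalGerm]
  rfl

/-- `W` is the disjoint union of the open subschemes `q_j : V_j → W`, and `p_j : W_+ → (V_j)_+` is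
the map that collapses the complement of `V_j` to the base point. The cartesian squares, which say
that `V_j` is the part of `W` sent to `V_j ⊆ (V_j)_+` and that `p_j` is the identity there, imply
that the `q_j` are open immersions. -/
structure IsDecomposition {W : SchPt S} {V : Fin k → SchPt S} (p : ∀ j, W ⟶ V j)
    (q : ∀ j, (V j).sch ⟶ W.sch) : Prop where
  exists_eq : ∀ y, ∃ j x, (q j).left x = y
  eq_of_eq : ∀ j l x y, (q j).left x = (q l).left y → j = l
  isPullback : ∀ j, IsPullback (q j).left (𝟙 (V j).sch.left) (plusRes (p j)) (inclPlus (V j).sch)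

/-- The embedded schemes of a family of framed correspondences are pairwise disjoint. -/
def DisjointFamily {V : Fin k → Over S} (D : ∀ j, NFr n X (V j)) : Prop :=
  ∀ j l, j ≠ l → ∀ x y, (D j).i x ≠ (D l).i y

variable {W : SchPt S} {V : Fin k → SchPt S} {p : ∀ j, W ⟶ V j} {q : ∀ j, (V j).sch ⟶ W.sch}

theorem exists_sigmaι_eq_apply (Z : Fin k → Scheme.{u}) (z : (∐ Z : Scheme.{u})) :
    ∃ j x, Sigma.ι Z j x = z := by
  obtain ⟨x, hx⟩ := (sigmaOpenCover Z).covers z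
  exact ⟨_, x, hx⟩

theorem eq_of_sigmaι_eq {Z : Fin k → Scheme.{u}} (j l : Fin k) (x y)
    (h : Sigma.ι Z j x = Sigma.ι Z l y) : j = l :=
  congrArg Sigma.fst ((sigmaι_eq_iff Z j l x y).mp h)

/-- Framed correspondences to the `V_j` with pairwise disjoint embedded schemes come from a framed
correspondence to `W`. -/
theorem IsDecomposition.exists_glue (H : IsDecomposition p q) (D : ∀ j, NFr n X (V j).sch)
    (hD : DisjointFamily D) :
    ∃ D₀ : NFr n X W.sch, ∀ j, IsTransport (𝟙 X) (p j) (D j) D₀ := by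
  let Z : Fin k → Scheme.{u} := fun j => (D j).Z
  let i : ∐ Z ⟶ Aff n X.left := Sigma.desc fun j => (D j).i
  let h : ∐ Z ⟶ W.sch.left := Sigma.desc fun j => (D j).h ≫ (q j).left
  have hi : ∀ j, Sigma.ι Z j ≫ i = (D j).i := fun j => Sigma.ι_desc _ _
  have hh : ∀ j, Sigma.ι Z j ≫ h = (D j).h ≫ (q j).left := fun j => Sigma.ι_desc _ _
  have ho := exists_sigmaι_eq_apply Z
  have hi' : ∀ j x, i (Sigma.ι Z j x) = (D j).i x := fun j x => congr($(hi j) x)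
  have hclosed : IsClosedImmersion i := by
    refine isClosedImmersion_of_family ho (fun j => by rw [hi]; exact (D j).isClosedImmersion) ?_
    intro a b hab
    obtain ⟨j, x, rfl⟩ := ho a
    obtain ⟨l, y, rfl⟩ := ho b
    rw [hi', hi'] at hab
    by_cases hjl : j = l
    · subst hjl
      rw [(D j).i.isClosedEmbedding.injective hab]
    · exact (hD j l hjl x y hab).elim
  have sq : ∀ j, (D j).i ≫ 𝟙 _ = Sigma.ι Z j ≫ i := fun j => by rw [hi, Category.comp_id]
  obtain ⟨t, ht⟩ := Framing.exists_glue (Sigma.ι Z) ho eq_of_sigmaι_eq sq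
    fun j => (D j).framing
  have hsyn : IsSyntomic (i ≫ (Aff n X.left ↘ X.left)) :=
    isSyntomic_of_family ho fun j => by
      rw [← Category.assoc, hi]
      exact (D j).isSyntomic
  have hfin : IsFinite (i ≫ (Aff n X.left ↘ X.left)) :=
    isFinite_of_family ho fun j => by
      rw [← Category.assoc, hi]
      exact (D j).isFinite
  have hw : h ≫ W.sch.hom = (i ≫ (Aff n X.left ↘ X.left)) ≫ X.hom := by
    refine Sigma.hom_ext _ _ fun j => ?_
    rw [reassoc_of% hh j, Over.w, (D j).w, Category.assoc, Category.assoc, reassoc_of% hi j]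
  refine ⟨⟨∐ Z, i, h, hclosed, hfin, hsyn, hw, t⟩, fun j => ?_⟩
  have e : affMap n (𝟙 X : X ⟶ X).left = 𝟙 _ := AffineSpace.map_id _
  refine ⟨Sigma.ι Z j, by rw [e, sq], ?_, ?_, (ht j).congr_map e.symm _⟩
  · change _ = Sigma.ι Z j ≫ h ≫ _
    rw [reassoc_of% hh j, (H.isPullback j).w, Category.id_comp]
  · intro T a b c h1 h2
    change T ⟶ ∐ Z at a
    change b ≫ _ = a ≫ i at h1
    change a ≫ h ≫ _ = _ at h2
    rw [e, Category.comp_id] at h1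
    have hr : Set.range a ⊆ Set.range (Sigma.ι Z j) := by
      rintro _ ⟨x, rfl⟩
      obtain ⟨l, y, hy⟩ := ho (a x)
      obtain ⟨v, hv, -⟩ := Scheme.exists_preimage_of_isPullback (H.isPullback j) (h (a x)) (c x)
        congr($h2 x)
      have h3 : (q l).left ((D l).h y) = h (a x) := by
        rw [← hy]
        exact congr($(hh l) y).symm
      obtain rfl := H.eq_of_eq _ _ _ _ (h3.trans hv.symm)
      exact ⟨y, hy⟩
    refine ⟨IsOpenImmersion.lift (Sigma.ι Z j) a hr, IsOpenImmersion.lift_fac _ _ hr, ?_⟩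
    rw [← hi j, IsOpenImmersion.lift_fac_assoc, h1]

/-- The part of `Z` that is mapped to `Y' ⊆ Y'_+` is cut out by a cartesian square. -/
theorem IsTransport.exists_isPullback {Y Y' : SchPt S} {p : Y ⟶ Y'} {D : NFr n X Y.sch}
    {D' : NFr n X Y'.sch} (h : IsTransport (𝟙 X) p D' D) :
    ∃ (w : D'.Z ⟶ D.Z) (sq : D'.i ≫ 𝟙 _ = w ≫ D.i),
      IsPullback w D'.h (D.h ≫ plusRes p) (inclPlus Y'.sch) ∧
        Framing.IsInduced sq D'.framing D.framing := by
  have e : affMap n (𝟙 X : X ⟶ X).left = 𝟙 _ := AffineSpace.map_id _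
  obtain ⟨w, sq, hh, u, f⟩ := h
  have sq' : D'.i ≫ 𝟙 _ = w ≫ D.i := by rw [← sq, e]
  refine ⟨w, sq', ?_, f.congr_map e sq'⟩
  rw [Category.comp_id] at sq'
  have hm : Mono w := by
    have : Mono (w ≫ D.i) := by rw [← sq']; infer_instance
    exact mono_of_mono w D.i
  have u' : ∀ s : PullbackCone (D.h ≫ plusRes p) (inclPlus Y'.sch), ∃ l : s.pt ⟶ D'.Z,
      l ≫ w = s.fst := fun s => by
    obtain ⟨l, hl, -⟩ := u s.pt s.fst (s.fst ≫ D.i) s.snd (by rw [e, Category.comp_id])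
      s.condition
    exact ⟨l, hl⟩
  choose l hl using u'
  refine ⟨⟨hh.symm⟩, ⟨PullbackCone.IsLimit.mk hh.symm l hl (fun s => ?_) fun s m hm' _ => ?_⟩⟩
  · rw [← cancel_mono (inclPlus Y'.sch), Category.assoc, hh, reassoc_of% hl s]
    exact s.condition
  · rw [← cancel_mono w, hm', hl]

/-- A point of `Z` mapped to `Y' ⊆ Y'_+` and a point of `𝔸ⁿ_{X'}` over the same point of `𝔸ⁿ_X`
come from a point of `Z'`. -/
theorem IsTransport.exists_point {X' : Over S} {g : X' ⟶ X} {Y Y' : SchPt S} {p : Y ⟶ Y'}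
    {D : NFr n X Y.sch} {D' : NFr n X' Y'.sch} (h : IsTransport g p D' D) (z : D.Z)
    (x : Aff n X'.left) (hx : affMap n g.left x = D.i z)
    (hz : (D.h ≫ plusRes p) z ∈ Set.range (inclPlus Y'.sch)) : ∃ z' : D'.Z, D'.i z' = x := by
  obtain ⟨w, sq, hh, u, f⟩ := h
  -- lift the residue field point of `Z ×_{𝔸ⁿ_X} 𝔸ⁿ_{X'}` to `Z'` by the universal property
  obtain ⟨t, ht, ht'⟩ := Scheme.exists_preimage_of_isPullback
    (IsPullback.of_hasPullback D.i (affMap n g.left)) z x hx.symm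
  let P := pullback D.i (affMap n g.left)
  let s : Spec (P.residueField t) ⟶ P := P.fromSpecResidueField t
  have hs : ∀ y, s y = t := fun y => Scheme.fromSpecResidueField_apply t y
  have hr : Set.range ((s ≫ pullback.fst _ _) ≫ D.h ≫ plusRes p) ⊆
      Set.range (inclPlus Y'.sch) := by
    rintro _ ⟨y, rfl⟩
    have : ((s ≫ pullback.fst D.i (affMap n g.left)) ≫ D.h ≫ plusRes p) y =
        (D.h ≫ plusRes p) z := by
      change (D.h ≫ plusRes p) (pullback.fst D.i (affMap n g.left) (s y)) = _
      rw [hs]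
      exact congrArg _ ht
    rw [this]
    exact hz
  obtain ⟨l, -, hl⟩ := u _ (s ≫ pullback.fst _ _) (s ≫ pullback.snd _ _)
    (IsOpenImmersion.lift (inclPlus Y'.sch) _ hr) (by
      rw [Category.assoc, Category.assoc, pullback.condition])
    (IsOpenImmersion.lift_fac _ _ hr).symm
  obtain ⟨y⟩ : Nonempty (Spec (P.residueField t)) := inferInstance
  refine ⟨l y, ?_⟩
  have h3 := congr($hl y)
  refine h3.trans ?_
  change pullback.snd D.i (affMap n g.left) (s y) = x
  rw [hs]
  exact ht'

/-- Disjointness is preserved by pullback and by passing to open and closed parts. -/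
theorem DisjointFamily.transport {X' : Over S} {g : X' ⟶ X} {V V' : Fin k → SchPt S}
    {p : ∀ j, V j ⟶ V' j} {D : ∀ j, NFr n X (V j).sch} {D' : ∀ j, NFr n X' (V' j).sch}
    (hD : DisjointFamily D) (h : ∀ j, IsTransport g (p j) (D' j) (D j)) : DisjointFamily D' := by
  intro j l hjl x y hxy
  obtain ⟨w, sq, -⟩ := h j
  obtain ⟨w', sq', -⟩ := h l
  refine hD j l hjl (w x) (w' y) ?_
  have h1 : affMap n g.left ((D' j).i x) = (D j).i (w x) := congr($sq x)
  have h2 : affMap n g.left ((D' l).i y) = (D l).i (w' y) := congr($sq' y)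
  rw [← h1, ← h2, hxy]

theorem DisjointFamily.of_rel {V : Fin k → SchPt S} {D D' : ∀ j, NFr n X (V j).sch}
    (hD : DisjointFamily D) (h : ∀ j, (D' j).Rel (D j)) : DisjointFamily D' :=
  hD.transport (p := fun j => 𝟙 (V j)) fun j => (h j).isTransport

/-- The data relating a correspondence `D` to `W` and the parts `D'_j` of it lying over the `V_j`:
the latter form a disjoint open covering of `D`. -/
theorem IsDecomposition.exists_cover (H : IsDecomposition p q) {D : NFr n X W.sch}
    {D' : ∀ j, NFr n X (V j).sch} (h : ∀ j, IsTransport (𝟙 X) (p j) (D' j) D) :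
    ∃ (w : ∀ j, (D' j).Z ⟶ D.Z) (sq : ∀ j, (D' j).i ≫ 𝟙 _ = w j ≫ D.i),
      (∀ j, IsOpenImmersion (w j)) ∧ (∀ z, ∃ j x, w j x = z) ∧
      (∀ j l x y, w j x = w l y → j = l) ∧ (∀ j, w j ≫ D.h = (D' j).h ≫ (q j).left) ∧
      ∀ j, Framing.IsInduced (sq j) (D' j).framing D.framing := by
  choose w sq pb f using fun j => (h j).exists_isPullback
  have hq : ∀ j, w j ≫ D.h = (D' j).h ≫ (q j).left := by
    intro j
    have h1 := (H.isPullback j).lift_fst (w j ≫ D.h) (D' j).h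
      (by rw [Category.assoc, (pb j).w])
    have h2 := (H.isPullback j).lift_snd (w j ≫ D.h) (D' j).h
      (by rw [Category.assoc, (pb j).w])
    rw [Category.comp_id] at h2
    rw [← h1, h2]
  refine ⟨w, sq, fun j => MorphismProperty.of_isPullback (pb j).flip inferInstance, fun z => ?_,
    fun j l x y hxy => ?_, hq, f⟩
  · obtain ⟨j, v, hv⟩ := H.exists_eq (D.h z)
    obtain ⟨x, hx, -⟩ := Scheme.exists_preimage_of_isPullback (pb j) z v (by
      change plusRes (p j) (D.h z) = _
      rw [← hv]
      have := congr($((H.isPullback j).w) v)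
      simpa using this)
    exact ⟨j, x, hx⟩
  · refine H.eq_of_eq j l ((D' j).h x) ((D' l).h y) ?_
    have h1 : D.h (w j x) = (q j).left ((D' j).h x) := congr($(hq j) x)
    have h2 : D.h (w l y) = (q l).left ((D' l).h y) := congr($(hq l) y)
    rw [← h1, ← h2, hxy]

/-- The parts of a correspondence to `W` lying over the `V_j` are disjoint. -/
theorem IsDecomposition.disjointFamily (H : IsDecomposition p q) {D : NFr n X W.sch}
    {D' : ∀ j, NFr n X (V j).sch} (h : ∀ j, IsTransport (𝟙 X) (p j) (D' j) D) :
    DisjointFamily D' := by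
  obtain ⟨w, sq, -, -, hd, -⟩ := H.exists_cover h
  intro j l hjl x y hxy
  refine hjl (hd j l x y (D.i.isClosedEmbedding.injective ?_))
  have h1 : (D' j).i x = D.i (w j x) := congr($(sq j) x)
  have h2 : (D' l).i y = D.i (w l y) := congr($(sq l) y)
  rw [← h1, ← h2, hxy]

/-- A correspondence to `W` is determined by its parts lying over the `V_j`. -/
theorem IsDecomposition.rel (H : IsDecomposition p q) {D D₀ : NFr n X W.sch}
    {D' : ∀ j, NFr n X (V j).sch} (h : ∀ j, IsTransport (𝟙 X) (p j) (D' j) D)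
    (h₀ : ∀ j, IsTransport (𝟙 X) (p j) (D' j) D₀) : D.Rel D₀ := by
  obtain ⟨w, sq, ho, hc, hd, hq, f⟩ := H.exists_cover h
  obtain ⟨w₀, sq₀, ho₀, hc₀, hd₀, hq₀, f₀⟩ := H.exists_cover h₀
  have colim : ∀ {Z : Scheme.{u}} (w : ∀ j, (D' j).Z ⟶ Z) [∀ j, IsOpenImmersion (w j)]
      (_ : ∀ z, ∃ j x, w j x = z) (_ : ∀ j l x y, w j x = w l y → j = l),
      Nonempty (IsColimit (Cofan.mk Z w)) := by
    intro Z w _ hc hd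
    refine nonempty_isColimit_cofanMk_of w ?_ ?_
    · rw [eq_top_iff]
      intro z _
      obtain ⟨j, x, rfl⟩ := hc z
      exact TopologicalSpace.Opens.mem_iSup.mpr ⟨j, x, rfl⟩
    · intro j l hjl
      rw [Function.onFun, disjoint_iff, TopologicalSpace.Opens.ext_iff]
      refine Set.eq_empty_iff_forall_notMem.mpr ?_
      rintro _ ⟨⟨x, rfl⟩, ⟨y, hy⟩⟩
      exact hjl (hd j l x y hy.symm)
  obtain ⟨c⟩ := colim w hc hd
  obtain ⟨c₀⟩ := colim w₀ hc₀ hd₀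
  let e : D.Z ≅ D₀.Z := c.coconePointUniqueUpToIso c₀
  have he : ∀ j, w j ≫ e.hom = w₀ j := fun j =>
    c.comp_coconePointUniqueUpToIso_hom c₀ ⟨j⟩
  have sqe : D.i ≫ 𝟙 _ = e.hom ≫ D₀.i := by
    rw [Category.comp_id]
    refine Cofan.IsColimit.hom_ext c _ _ fun j => ?_
    change w j ≫ D.i = w j ≫ e.hom ≫ D₀.i
    rw [reassoc_of% he j, ← sq, sq₀]
  refine ⟨e, sqe, ?_, Framing.IsInduced.of_family sqe hc f (fun j => (he j).symm) f₀⟩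
  refine Cofan.IsColimit.hom_ext c _ _ fun j => ?_
  change w j ≫ e.hom ≫ D₀.h = w j ≫ D.h
  rw [reassoc_of% he j, hq, hq₀]

end Decomposition

/-! ### Stable classes of framed correspondences -/

section Stable

variable {S : Scheme.{u}} {n : ℕ} {X X' X'' : Over S}

theorem squareStalkMap_comp {Z Z' Z'' A A' A'' : Scheme.{u}} {i : Z ⟶ A} {i' : Z' ⟶ A'}
    {i'' : Z'' ⟶ A''} {w : Z' ⟶ Z} {G : A' ⟶ A} {w' : Z'' ⟶ Z'} {G' : A'' ⟶ A'}
    (sq : i' ≫ G = w ≫ i) (sq' : i'' ≫ G' = w' ≫ i') (sq₀ : i'' ≫ (G' ≫ G) = (w' ≫ w) ≫ i)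
    (z : Z'') (a : A.presheaf.stalk (i (w (w' z)))) :
    squareStalkMap sq' z (squareStalkMap sq (w' z) a) = squareStalkMap sq₀ z a := by
  obtain ⟨V, hV, s, rfl⟩ := A.presheaf.exists_germ_eq a
  rw [germ_squareStalkMap, germ_squareStalkMap]
  exact (germ_squareStalkMap sq₀ z V hV s).symm

theorem conormalMap_comp {Z Z' Z'' A A' A'' : Scheme.{u}} {i : Z ⟶ A} {i' : Z' ⟶ A'}
    {i'' : Z'' ⟶ A''} {w : Z' ⟶ Z} {G : A' ⟶ A} {w' : Z'' ⟶ Z'} {G' : A'' ⟶ A'}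
    (sq : i' ≫ G = w ≫ i) (sq' : i'' ≫ G' = w' ≫ i') {w₀ : Z'' ⟶ Z} {G₀ : A'' ⟶ A}
    (sq₀ : i'' ≫ G₀ = w₀ ≫ i) (hw : w₀ = w' ≫ w) (hG : G₀ = G' ≫ G)
    (t : ∀ y, ConormalStalk i y) (z : Z'') :
    conormalMap sq' z (conormalMap sq (w' z) (t (w (w' z)))) = conormalMap sq₀ z (t (w₀ z)) := by
  subst hw hG
  change _ = conormalMap sq₀ z (t (w (w' z)))
  obtain ⟨a, ha⟩ := Ideal.toCotangent_surjective _ (t (w (w' z)))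
  rw [← ha]
  unfold conormalMap
  rw [Ideal.mapCotangent_toCotangent, Ideal.mapCotangent_toCotangent]
  refine Eq.trans ?_ (Ideal.mapCotangent_toCotangent (stalkIdeal i (w (w' z))) (stalkIdeal i'' z)
    (squareStalkMap sq₀ z).hom.toIntAlgHom (stalkIdeal_le_comap sq₀ z) a).symm
  congr 1
  exact Subtype.ext (squareStalkMap_comp sq sq' sq₀ z a.1)

theorem conormalMap_id {Z A : Scheme.{u}} {i : Z ⟶ A} {w : Z ⟶ Z} {G : A ⟶ A}
    (sq : i ≫ G = w ≫ i) (hw : w = 𝟙 Z) (hG : G = 𝟙 A) (t : ∀ y, ConormalStalk i y) (z : Z) :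
    conormalMap sq z (t (w z)) = t z := by
  subst hw hG
  change conormalMap sq z (t z) = t z
  obtain ⟨a, ha⟩ := Ideal.toCotangent_surjective _ (t z)
  rw [← ha]
  refine (Ideal.mapCotangent_toCotangent (stalkIdeal i z) (stalkIdeal i z)
    (squareStalkMap sq z).hom.toIntAlgHom (stalkIdeal_le_comap sq z) a).trans ?_
  congr 1
  apply Subtype.ext
  obtain ⟨V, hV, s, hs⟩ := A.presheaf.exists_germ_eq a.1
  change squareStalkMap sq z a.1 = a.1
  rw [← hs]
  exact germ_squareStalkMap sq z V hV s

/-- The embedding `𝔸ⁿ → 𝔸ⁿ⁺¹` gives a retraction of the suspension of framings. -/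
theorem NFr.Rel.of_suspend {Y : Over S} {D D' : NFr n X Y} (h : D.suspend.Rel D'.suspend) :
    D.Rel D' := by
  obtain ⟨e, sq, hh, f⟩ := h
  change D.Z ≅ D'.Z at e
  change (D.i ≫ affZero n X.left) ≫ 𝟙 _ = e.hom ≫ D'.i ≫ affZero n X.left at sq
  have sq₀ : D.i ≫ 𝟙 _ = e.hom ≫ D'.i := by
    rw [← cancel_mono (affZero n X.left), Category.comp_id, Category.assoc, ← sq, Category.comp_id]
  refine ⟨e, sq₀, hh, fun z j => ?_⟩
  have sqZ : D.i ≫ affZero n X.left = 𝟙 _ ≫ (D.i ≫ affZero n X.left) :=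
    (Category.id_comp _).symm
  have hs : ∀ (D : NFr n X Y) (z : D.Z), D.suspend.framing.sec z j.castSucc =
      conormalMap (affZero_square n D.i) z (D.framing.sec z j) := fun D z => by
    change D.framing.suspend.sec z j.castSucc = _
    simp only [Framing.suspend, Fin.lastCases_castSucc]
  have hid : affZero n X.left ≫ affProj n X.left = 𝟙 _ := affZero_proj n X.left
  have l1 : conormalMap sqZ z (conormalMap (affZero_square n D.i) z (D.framing.sec z j)) =
      D.framing.sec z j :=
    (conormalMap_comp (affZero_square n D.i) sqZ
      (sq₀ := (by rw [Category.comp_id, Category.id_comp] : D.i ≫ 𝟙 _ = 𝟙 _ ≫ D.i))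
      (by rw [Category.id_comp]) hid.symm (fun z => D.framing.sec z j) z).trans
      (conormalMap_id _ rfl rfl (fun z => D.framing.sec z j) z)
  have sqP : (D.i ≫ affZero n X.left) ≫ affProj n X.left = e.hom ≫ D'.i := by
    rw [Category.assoc, hid, sq₀]
  have l2 : conormalMap sq z (conormalMap (affZero_square n D'.i) (e.hom z)
      (D'.framing.sec (e.hom z) j)) = conormalMap sqP z (D'.framing.sec (e.hom z) j) :=
    conormalMap_comp (affZero_square n D'.i) sq sqP (by rw [Category.comp_id])
      (by rw [Category.id_comp]) (fun z => D'.framing.sec z j) z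
  have l3 : conormalMap sqZ z (conormalMap sqP z (D'.framing.sec (e.hom z) j)) =
      conormalMap sq₀ z (D'.framing.sec (e.hom z) j) :=
    conormalMap_comp sqP sqZ sq₀ (by rw [Category.id_comp]) hid.symm
      (fun z => D'.framing.sec z j) z
  have h1 : conormalMap (affZero_square n D.i) z (D.framing.sec z j) =
      conormalMap sq z (conormalMap (affZero_square n D'.i) (e.hom z)
        (D'.framing.sec (e.hom z) j)) :=
    (hs D z).symm.trans ((f z j.castSucc).trans (congrArg (conormalMap sq z) (hs D' (e.hom z))))
  exact l1.symm.trans ((congrArg (conormalMap sqZ z) (h1.trans l2)).trans l3)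

theorem CorrNfr.suspend_injective {Y : Over S} :
    Function.Injective (CorrNfr.suspend : CorrNfr n X Y → CorrNfr (n + 1) X Y) := by
  intro x y
  induction x using Quotient.inductionOn with
  | h D =>
    induction y using Quotient.inductionOn with
    | h D' => exact fun h => Quotient.sound (NFr.Rel.of_suspend (Quotient.exact h))

/-- The value of `h^{nfr}_S(V)` at `X`. -/
abbrev StableCorr (V : SchPt S) (X : Over S) : Type (u + 1) := ((hnfr S).obj V).obj (op X)

variable {V V' V'' : SchPt S}

/-- The element of `h^{nfr}_S(V)(X)` given by a correspondence of level `n`. -/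
def stableClass (D : NFr n X V.sch) : StableCorr V X :=
  ((colimit.ι (Functor.ofSequence (corrNfrSuspend S)) n).app V).app (op X) (Quotient.mk _ D)

/-- The functoriality of `h^{nfr}_S(V)(X)` in `V_+` and `X`. -/
def stableMap (g : X' ⟶ X) (p : V ⟶ V') (x : StableCorr V X) : StableCorr V' X' :=
  ((hnfr S).obj V').map g.op (((hnfr S).map p).app (op X) x)

theorem stableMap_id (x : StableCorr V X) : stableMap (𝟙 X) (𝟙 V) x = x := by
  unfold stableMap
  rw [op_id, CategoryTheory.Functor.map_id, CategoryTheory.Functor.map_id]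
  rfl

theorem stableMap_comp (g : X' ⟶ X) (g' : X'' ⟶ X') (p : V ⟶ V') (p' : V' ⟶ V'')
    (x : StableCorr V X) :
    stableMap (g' ≫ g) (p ≫ p') x = stableMap g' p' (stableMap g p x) := by
  have h := congr($(((hnfr S).map p').naturality g.op) (((hnfr S).map p).app (op X) x))
  unfold stableMap
  rw [op_comp, CategoryTheory.Functor.map_comp, CategoryTheory.Functor.map_comp]
  exact congrArg (((hnfr S).obj V'').map g'.op) h.symm

/-- The colimit cocone computing `h^{nfr}_S(V)(X)`. -/
def stableIsColimit (V : SchPt S) (X : Over S) :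
    IsColimit (((evaluation _ _).obj V ⋙ (evaluation _ _).obj (op X)).mapCocone
      (colimit.cocone (Functor.ofSequence (corrNfrSuspend S)))) :=
  isColimitOfPreserves _ (colimit.isColimit _)

theorem exists_stableClass (x : StableCorr V X) : ∃ (n : ℕ) (D : NFr n X V.sch),
    x = stableClass D := by
  obtain ⟨n, y, hy⟩ := Types.jointly_surjective_of_isColimit (stableIsColimit V X) x
  obtain ⟨D, rfl⟩ := Quotient.exists_rep y
  exact ⟨n, D, hy.symm⟩

theorem stableClass_suspend (D : NFr n X V.sch) : stableClass D.suspend = stableClass D := by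
  have h := colimit.w (Functor.ofSequence (corrNfrSuspend S)) (homOfLE (Nat.le_succ n))
  rw [Functor.ofSequence_map_homOfLE_succ] at h
  exact congr((($h).app V).app (op X) (Quotient.mk _ D))

/-- As suspension is injective, no correspondences become isomorphic in the colimit. -/
theorem stableClass_eq_iff {D D' : NFr n X V.sch} :
    stableClass D = stableClass D' ↔ D.Rel D' := by
  constructor
  · intro h
    obtain ⟨m, f, g, hfg⟩ := (Types.FilteredColimit.isColimit_eq_iff _ (stableIsColimit V X)
      (i := n) (j := n) (xi := Quotient.mk _ D) (xj := Quotient.mk _ D')).mp h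
    obtain rfl : f = g := Subsingleton.elim _ _
    have inj : ∀ m (hm : n ≤ m), Function.Injective ((((Functor.ofSequence (corrNfrSuspend S)).map
        (homOfLE hm)).app V).app (op X)) := by
      intro m hm
      induction m, hm using Nat.le_induction with
      | base =>
        have h1 : homOfLE (le_refl n) = 𝟙 n := rfl
        rw [h1, CategoryTheory.Functor.map_id]
        exact Function.injective_id
      | succ m hm ih =>
        rw [← homOfLE_comp hm (Nat.le_succ m), CategoryTheory.Functor.map_comp,
          Functor.ofSequence_map_homOfLE_succ]
        exact CorrNfr.suspend_injective.comp ih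
    exact Quotient.exact (inj m (leOfHom f) hfg)
  · intro h
    unfold stableClass
    rw [Quotient.sound h]

theorem stableMap_stableClass {g : X' ⟶ X} {p : V ⟶ V'} {D : NFr n X V.sch}
    {D' : NFr n X' V'.sch} (h : IsTransport g p D' D) :
    stableMap g p (stableClass D) = stableClass D' := by
  let ι := colimit.ι (Functor.ofSequence (corrNfrSuspend S)) n
  have h1 := congr((($(ι.naturality p)).app (op X)) (Quotient.mk _ D))
  have h2 := congr($((ι.app V').naturality g.op)
    (CorrNfr.map (𝟙 X) p (Quotient.mk _ D)))
  have h3 := CorrNfr.map_comp (𝟙 X) g p (𝟙 V') (Quotient.mk _ D)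
  rw [Category.comp_id, Category.comp_id, CorrNfr.map_mk_eq h] at h3
  refine (congrArg (((hnfr S).obj V').map g.op) h1.symm).trans (h2.symm.trans ?_)
  exact congrArg ((ι.app V').app (op X')) h3.symm

end Stable

section Level

variable {S : Scheme.{u}} {n k : ℕ} {X X' : Over S} {V V' : SchPt S}

/-- The `m`-fold suspension. -/
def NFr.suspendBy {Y : Over S} (D : NFr n X Y) : ∀ m : ℕ, NFr (n + m) X Y
  | 0 => D
  | m + 1 => (D.suspendBy m).suspend

theorem stableClass_suspendBy (D : NFr n X V.sch) (m : ℕ) :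
    stableClass (D.suspendBy m) = stableClass D := by
  induction m with
  | zero => rfl
  | succ m ih => exact (stableClass_suspend _).trans ih

/-- Translation by a sequence that vanishes from the level `n` on commutes with suspension. -/
theorem stableClass_suspendBy_translate (D : NFr n X V.sch) (c : ℕ → Γ(X.left, ⊤))
    (hc : ∀ r, n ≤ r → c r = 0) (m : ℕ) :
    stableClass ((D.suspendBy m).translate c) = stableClass (D.translate c) := by
  induction m with
  | zero => rfl
  | succ m ih =>
    rw [← ih, ← stableClass_suspend ((D.suspendBy m).translate c)]
    exact (stableClass_eq_iff.mpr
      ((D.suspendBy m).translate_suspend c (hc _ (Nat.le_add_right n m)))).symm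

theorem NFr.suspendBy_coord {Y : Over S} (D : NFr n X Y) (m : ℕ) (r : Fin (n + m))
    (hr : n ≤ r.1) : (D.suspendBy m).i.appTop (AffineSpace.coord X.left ⟨r⟩) = 0 := by
  induction m with
  | zero => exact absurd r.2 (Nat.not_lt.mpr hr)
  | succ m ih =>
    change ((D.suspendBy m).i ≫ affZero (n + m) X.left).appTop _ = 0
    rw [Scheme.Hom.comp_appTop, CommRingCat.comp_apply]
    induction r using Fin.lastCases with
    | last =>
      refine (congrArg _ (affZero_lastCoord (n + m) X.left)).trans ?_
      rw [map_zero]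
    | cast r =>
      have e : (affZero (n + m) X.left).appTop (AffineSpace.coord X.left ⟨r.castSucc⟩) =
          AffineSpace.coord X.left ⟨r⟩ := by
        refine (AffineSpace.homOfVector_appTop_coord _ _ _).trans ?_
        simp
      refine (congrArg _ e).trans (ih r hr)

theorem disjointFamily_suspend {V : Fin k → Over S} {D : ∀ j, NFr n X (V j)} :
    DisjointFamily (fun j => (D j).suspend) ↔ DisjointFamily D := by
  have h : Function.Injective (affZero n X.left) := (affZero n X.left).isClosedEmbedding.injective
  exact ⟨fun H j l hjl x y hxy => H j l hjl x y (congrArg (affZero n X.left) hxy),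
    fun H j l hjl x y hxy => H j l hjl x y (h hxy)⟩

theorem disjointFamily_suspendBy {V : Fin k → Over S} {D : ∀ j, NFr n X (V j)} (m : ℕ) :
    DisjointFamily (fun j => (D j).suspendBy m) ↔ DisjointFamily D := by
  induction m with
  | zero => rfl
  | succ m ih => exact disjointFamily_suspend.trans ih

theorem exists_stableClass_le (x : StableCorr V X) :
    ∃ n : ℕ, ∀ N, n ≤ N → ∃ D : NFr N X V.sch, x = stableClass D := by
  obtain ⟨n, D, rfl⟩ := exists_stableClass x
  refine ⟨n, fun N hN => ?_⟩
  obtain ⟨m, rfl⟩ := Nat.exists_eq_add_of_le hN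
  exact ⟨D.suspendBy m, (stableClass_suspendBy D m).symm⟩

/-- Finitely many stable classes are represented at a common, arbitrarily large level. -/
theorem exists_stableClass_family {V : Fin k → SchPt S} (x : ∀ j, StableCorr (V j) X) (N₀ : ℕ) :
    ∃ N, N₀ ≤ N ∧ ∃ D : ∀ j, NFr N X (V j).sch, ∀ j, x j = stableClass (D j) := by
  choose n hn using fun j => exists_stableClass_le (x j)
  refine ⟨N₀ + ∑ j, n j, Nat.le_add_right _ _, ?_⟩
  have h : ∀ j, n j ≤ N₀ + ∑ j, n j := fun j =>
    (Finset.single_le_sum (fun _ _ => Nat.zero_le _) (Finset.mem_univ j)).trans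
      (Nat.le_add_left _ _)
  choose D hD using fun j => hn j _ (h j)
  exact ⟨D, hD⟩

end Level

/-! ### Translating stable classes -/

section Act

variable {S : Scheme.{u}} {n k : ℕ} {X X' : Over S} {V V' : SchPt S}

open Classical in
/-- Translation of stable classes by a sequence of global functions with finitely many nonzero
members; a junk value for other sequences. -/
def stableAct (c : ℕ → Γ(X.left, ⊤)) (x : StableCorr V X) : StableCorr V X :=
  if h : ∃ (n : ℕ) (D : NFr n X V.sch), (∀ r, n ≤ r → c r = 0) ∧ x = stableClass D then
    stableClass (h.choose_spec.choose.translate c)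
  else x

theorem stableClass_translate_eq {m : ℕ} {D : NFr n X V.sch} {D' : NFr m X V.sch}
    (h : stableClass D = stableClass D') (c : ℕ → Γ(X.left, ⊤)) (hc : ∀ r, n ≤ r → c r = 0)
    (hc' : ∀ r, m ≤ r → c r = 0) :
    stableClass (D.translate c) = stableClass (D'.translate c) := by
  rw [← stableClass_suspendBy_translate D c hc m, ← stableClass_suspendBy_translate D' c hc' n]
  rw [← stableClass_suspendBy D m, ← stableClass_suspendBy D' n] at h
  generalize D.suspendBy m = E at h ⊢
  generalize D'.suspendBy n = E' at h ⊢
  have key : ∀ (a b : ℕ) (_ : a = b) (E : NFr a X V.sch) (E' : NFr b X V.sch),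
      stableClass E = stableClass E' →
      stableClass (E.translate c) = stableClass (E'.translate c) := by
    rintro a _ rfl E E' h
    exact stableClass_eq_iff.mpr ((stableClass_eq_iff.mp h).translate c)
  exact key _ _ (Nat.add_comm n m) E E' h

theorem stableAct_stableClass (D : NFr n X V.sch) (c : ℕ → Γ(X.left, ⊤))
    (hc : ∀ r, n ≤ r → c r = 0) : stableAct c (stableClass D) = stableClass (D.translate c) := by
  have h : ∃ (m : ℕ) (D' : NFr m X V.sch), (∀ r, m ≤ r → c r = 0) ∧
      stableClass D = stableClass D' := ⟨n, D, hc, rfl⟩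
  unfold stableAct
  rw [dif_pos h]
  exact (stableClass_translate_eq h.choose_spec.choose_spec.2 c hc
    h.choose_spec.choose_spec.1).symm

/-- The sequence `c` has finitely many nonzero members. -/
def FinSupp {R : Type*} [Zero R] (c : ℕ → R) : Prop := ∃ N, ∀ r, N ≤ r → c r = 0

theorem FinSupp.add {R : Type*} [AddMonoid R] {c d : ℕ → R} (hc : FinSupp c) (hd : FinSupp d) :
    FinSupp (c + d) := by
  obtain ⟨N, hN⟩ := hc
  obtain ⟨M, hM⟩ := hd
  exact ⟨N + M, fun r hr => by rw [Pi.add_apply, hN r (by omega), hM r (by omega), add_zero]⟩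

theorem FinSupp.map {R R' : Type*} [Semiring R] [Semiring R'] {c : ℕ → R} (hc : FinSupp c)
    (f : R →+* R') : FinSupp fun r => f (c r) := by
  obtain ⟨N, hN⟩ := hc
  exact ⟨N, fun r hr => (congrArg f (hN r hr)).trans (map_zero f)⟩

theorem finSupp_zero {R : Type*} [Zero R] : FinSupp (0 : ℕ → R) := ⟨0, fun _ _ => rfl⟩

theorem exists_stableClass_finSupp (x : StableCorr V X) {R : Type*} [Zero R] {c : ℕ → R}
    (hc : FinSupp c) :
    ∃ (n : ℕ) (D : NFr n X V.sch), (∀ r, n ≤ r → c r = 0) ∧ x = stableClass D := by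
  obtain ⟨N, hN⟩ := hc
  obtain ⟨n, hn⟩ := exists_stableClass_le x
  obtain ⟨D, hD⟩ := hn (n + N) (Nat.le_add_right _ _)
  exact ⟨_, D, fun r hr => hN r (by omega), hD⟩

theorem stableAct_zero (x : StableCorr V X) : stableAct 0 x = x := by
  obtain ⟨n, D, -, rfl⟩ := exists_stableClass_finSupp x (finSupp_zero (R := ℕ))
  rw [stableAct_stableClass D 0 fun _ _ => rfl]
  exact stableClass_eq_iff.mpr D.translate_zero

theorem stableAct_stableAct {c d : ℕ → Γ(X.left, ⊤)} (hc : FinSupp c) (hd : FinSupp d)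
    (x : StableCorr V X) : stableAct d (stableAct c x) = stableAct (d + c) x := by
  obtain ⟨n, D, hn, rfl⟩ := exists_stableClass_finSupp x (c := fun r => (c r, d r)) (by
    obtain ⟨N, hN⟩ := hc
    obtain ⟨M, hM⟩ := hd
    exact ⟨N + M, fun r hr => Prod.ext (hN r (by omega)) (hM r (by omega))⟩)
  have hn1 : ∀ r, n ≤ r → c r = 0 := fun r hr => congrArg Prod.fst (hn r hr)
  have hn2 : ∀ r, n ≤ r → d r = 0 := fun r hr => congrArg Prod.snd (hn r hr)
  rw [stableAct_stableClass D c hn1, stableAct_stableClass _ d hn2, stableAct_stableClass D _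
    fun r hr => by rw [Pi.add_apply, hn1 r hr, hn2 r hr, add_zero]]
  exact stableClass_eq_iff.mpr (D.translate_translate c d)

theorem stableMap_stableAct (g : X' ⟶ X) (p : V ⟶ V') {c : ℕ → Γ(X.left, ⊤)} (hc : FinSupp c)
    (x : StableCorr V X) : stableMap g p (stableAct c x) =
      stableAct (fun r => g.left.appTop (c r)) (stableMap g p x) := by
  obtain ⟨n, D, hn, rfl⟩ := exists_stableClass_finSupp x hc
  have h := D.isTransport_pull g p
  rw [stableAct_stableClass D c hn, stableMap_stableClass h, stableMap_stableClass (h.translate c),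
    stableAct_stableClass _ _ fun r hr => by rw [hn r hr, map_zero]]

/-- The stable classes `x_j` are represented by correspondences with disjoint embedded schemes. -/
def StableDisjoint {V : Fin k → SchPt S} (x : ∀ j, StableCorr (V j) X) : Prop :=
  ∃ (n : ℕ) (D : ∀ j, NFr n X (V j).sch), (∀ j, x j = stableClass (D j)) ∧ DisjointFamily D

/-- Disjointness of a family of stable classes does not depend on the representatives. -/
theorem StableDisjoint.disjointFamily {V : Fin k → SchPt S} {D : ∀ j, NFr n X (V j).sch}
    (h : StableDisjoint fun j => stableClass (D j)) : DisjointFamily D := by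
  obtain ⟨m, E, hE, hd⟩ := h
  rw [← disjointFamily_suspendBy n] at hd
  rw [← disjointFamily_suspendBy m]
  have hE' : ∀ j, stableClass ((D j).suspendBy m) = stableClass ((E j).suspendBy n) := fun j => by
    rw [stableClass_suspendBy, stableClass_suspendBy]
    exact hE j
  have key : ∀ (a b : ℕ) (_ : a = b) (E : ∀ j, NFr a X (V j).sch) (E' : ∀ j, NFr b X (V j).sch),
      (∀ j, stableClass (E j) = stableClass (E' j)) → DisjointFamily E' → DisjointFamily E := by
    rintro a _ rfl E E' h hd
    exact hd.of_rel fun j => stableClass_eq_iff.mp (h j)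
  exact key _ _ (Nat.add_comm n m) _ _ hE' hd

theorem StableDisjoint.stableMap {V V' : Fin k → SchPt S} {x : ∀ j, StableCorr (V j) X}
    (h : StableDisjoint x) (g : X' ⟶ X) (p : ∀ j, V j ⟶ V' j) :
    StableDisjoint fun j => stableMap g (p j) (x j) := by
  obtain ⟨n, D, hx, hD⟩ := h
  have ht := fun j => (D j).isTransport_pull g (p j)
  exact ⟨n, fun j => (D j).pull g (p j), fun j =>
    (congrArg _ (hx j)).trans (stableMap_stableClass (ht j)),
    hD.transport ht⟩

variable {W : SchPt S} {V : Fin k → SchPt S} {p : ∀ j, W ⟶ V j} {q : ∀ j, (V j).sch ⟶ W.sch}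

/-- A stable class of correspondences to `W` is determined by its components over the `V_j`. -/
theorem IsDecomposition.stableMap_injective (H : IsDecomposition p q) {x y : StableCorr W X}
    (h : ∀ j, stableMap (𝟙 X) (p j) x = stableMap (𝟙 X) (p j) y) : x = y := by
  obtain ⟨n, hn⟩ := exists_stableClass_le x
  obtain ⟨m, hm⟩ := exists_stableClass_le y
  obtain ⟨D, rfl⟩ := hn (n + m) (Nat.le_add_right _ _)
  obtain ⟨E, rfl⟩ := hm (n + m) (Nat.le_add_left _ _)
  have h1 := fun j => D.isTransport_pull (𝟙 X) (p j)
  have h2 := fun j => E.isTransport_pull (𝟙 X) (p j)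
  refine stableClass_eq_iff.mpr (H.rel (D' := fun j => E.pull (𝟙 X) (p j)) (fun j => ?_) h2)
  have h3 := h j
  rw [stableMap_stableClass (h1 j), stableMap_stableClass (h2 j), stableClass_eq_iff] at h3
  have h4 := (h1 j).comp h3.symm.isTransport
  rwa [Category.id_comp, Category.comp_id] at h4

/-- The image of `h^{nfr}_S(W)` in the product of the `h^{nfr}_S(V_j)` consists of the families that
are represented by correspondences with disjoint embedded schemes. -/
theorem IsDecomposition.exists_stableMap_eq_iff (H : IsDecomposition p q)
    (x : ∀ j, StableCorr (V j) X) :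
    (∃ y : StableCorr W X, ∀ j, stableMap (𝟙 X) (p j) y = x j) ↔ StableDisjoint x := by
  constructor
  · rintro ⟨y, hy⟩
    obtain ⟨n, D, rfl⟩ := exists_stableClass y
    have h := fun j => D.isTransport_pull (𝟙 X) (p j)
    exact ⟨n, fun j => D.pull (𝟙 X) (p j), fun j => by rw [← hy, stableMap_stableClass (h j)],
      H.disjointFamily h⟩
  · rintro ⟨n, D, hx, hD⟩
    obtain ⟨D₀, h⟩ := H.exists_glue D hD
    exact ⟨stableClass D₀, fun j => by rw [stableMap_stableClass (h j), hx]⟩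

end Act

/-! ### General position -/

section Push

variable {S : Scheme.{u}} {n k : ℕ} {X : Over S}

theorem mem_basicOpen_appTop_iff {Z A : Scheme.{u}} (f : Z ⟶ A) (s : Γ(A, ⊤)) (z : Z) :
    z ∈ Z.basicOpen (f.appTop s) ↔ f z ∈ A.basicOpen s := by
  have h := Scheme.preimage_basicOpen_top f s
  rw [← h]
  rfl

/-- Translating the `j`-th member of a family by `u` in a fresh coordinate of its own makes the
family disjoint over the locus where `u` is invertible. It is then disjoint everywhere if the
complement of this locus is covered by schemes on which `u` vanishes and the family is disjoint. -/
theorem exists_stableDisjoint {V : Fin k → SchPt S} (x : ∀ j, StableCorr (V j) X)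
    (s : Γ(X.left, ⊤)) (hs : ∀ b : X.left, b ∉ X.left.basicOpen s → ∃ (X' : Over S) (g : X' ⟶ X),
      b ∈ Set.range g.left ∧ g.left.appTop s = 0 ∧
        StableDisjoint fun j => stableMap g (𝟙 (V j)) (x j)) :
    ∃ N : ℕ, StableDisjoint fun j : Fin k => stableAct (Pi.single (N + j.1) s) (x j) := by
  obtain ⟨n, -, D, hD⟩ := exists_stableClass_family x 0
  let c : Fin k → ℕ → Γ(X.left, ⊤) := fun j => Pi.single (n + j.1) s
  have hc : ∀ j r, n + k ≤ r → c j r = 0 := fun j r hr => Pi.single_eq_of_ne (by omega) _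
  let E : ∀ j, NFr (n + k) X (V j).sch := fun j => ((D j).suspendBy k).translate (c j)
  have hE : ∀ j, stableAct (c j) (x j) = stableClass (E j) := fun j => by
    rw [hD, ← stableClass_suspendBy (D j) k, stableAct_stableClass _ _ (hc j)]
  refine ⟨n, n + k, E, hE, ?_⟩
  intro j l hjl y z hyz
  -- the coordinate `r` restricts to `s` on the `j`-th member and to `0` on the others
  let r : ULift.{u} (Fin (n + k)) := ⟨⟨n + j.1, by omega⟩⟩
  have hcoord : ∀ l, (E l).i.appTop (AffineSpace.coord X.left r) =
      ((E l).i ≫ (Aff (n + k) X.left ↘ X.left)).appTop (c l (n + j.1)) := by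
    intro l
    change (((D l).suspendBy k).i ≫ affTrans (n + k) (c l)).appTop _ =
      ((((D l).suspendBy k).i ≫ affTrans (n + k) (c l)) ≫ (Aff (n + k) X.left ↘ X.left)).appTop _
    rw [Category.assoc, affTrans_over, Scheme.Hom.comp_appTop, CommRingCat.comp_apply,
      affTrans_coord, map_add, (D l).suspendBy_coord k _ (Nat.le_add_right n j.1), zero_add,
      ← CommRingCat.comp_apply, ← Scheme.Hom.comp_appTop]
  have hj := hcoord j
  have hl := hcoord l
  rw [show c j (n + j.1) = s from Pi.single_eq_same _ _] at hj
  rw [show c l (n + j.1) = 0 from Pi.single_eq_of_ne (by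
    intro h
    exact hjl (Fin.ext (by omega))) _, map_zero] at hl
  -- so a common point of the `j`-th and the `l`-th member lies over a point where `s` vanishes
  have hb : (Aff (n + k) X.left ↘ X.left) ((E j).i y) ∉ X.left.basicOpen s := by
    intro hmem
    have h1 : y ∈ (E j).Z.basicOpen
        (((E j).i ≫ (Aff (n + k) X.left ↘ X.left)).appTop s) :=
      (mem_basicOpen_appTop_iff _ _ _).mpr hmem
    rw [← hj, mem_basicOpen_appTop_iff, hyz, ← mem_basicOpen_appTop_iff, hl,
      Scheme.basicOpen_zero] at h1
    exact h1
  obtain ⟨X', g, ⟨b', hb'⟩, hg, hdis⟩ := hs _ hb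
  have ht := fun m => (E m).isTransport_pull g (𝟙 (V m))
  -- over `X'` the translation is trivial, and the family is disjoint by assumption
  have hF : DisjointFamily fun m => (E m).pull g (𝟙 (V m)) := by
    apply StableDisjoint.disjointFamily
    have : (fun m => stableClass ((E m).pull g (𝟙 (V m)))) =
        fun m => stableMap g (𝟙 (V m)) (x m) := by
      funext m
      have h0 : (fun r => g.left.appTop (c m r)) = 0 := by
        funext r
        by_cases hr : r = n + m.1
        · subst hr
          rw [show c m (n + m.1) = s from Pi.single_eq_same _ _, hg]
          rfl
        · rw [show c m r = 0 from Pi.single_eq_of_ne hr _, map_zero]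
          rfl
      rw [← stableMap_stableClass (ht m), ← hE, stableMap_stableAct g _ ⟨n + k, hc m⟩, h0,
        stableAct_zero]
    rw [this]
    exact hdis
  -- lift the common point to `X'`
  obtain ⟨a, ha, -⟩ := Scheme.exists_preimage_of_isPullback
    (AffineSpace.isPullback_map (n := ULift.{u} (Fin (n + k))) g.left) ((E j).i y) b' hb'.symm
  have hr : ∀ m (z : (E m).Z), ((E m).h ≫ plusRes (𝟙 (V m))) z ∈
      Set.range (inclPlus (V m).sch) := fun m z => ⟨(E m).h z, rfl⟩
  obtain ⟨y', hy'⟩ := (ht j).exists_point y a ha (hr j y)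
  obtain ⟨z', hz'⟩ := (ht l).exists_point z a (ha.trans hyz) (hr l z)
  exact hF j l hjl y' z' (hy'.trans hz'.symm)

end Push

/-! ### Functions and faces of `X × Δ^•` -/

section Faces

variable {S : Scheme.{u}}

/-- The projection `X × Δ^m → Δ^m`. -/
def simplexProj (X : Over S) (m : SimplexCategory) :
    ((prodSimplex X).obj m).left ⟶ Spec (CommRingCat.of (simplexRing.{u} m.len)) :=
  (prod.snd : X.left ⨯ algSimplex.obj m ⟶ algSimplex.obj m)

/-- The function on `T` that is the pullback of `f ∈ R` along a morphism `T → Spec R`. -/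
def pullFun {R : CommRingCat.{u}} {T : Scheme.{u}} (s : T ⟶ Spec R) : R →+* Γ(T, ⊤) :=
  ((Scheme.ΓSpecIso R).inv ≫ s.appTop).hom

theorem appTop_pullFun {R R' : CommRingCat.{u}} {T T' : Scheme.{u}} {s : T ⟶ Spec R}
    {s' : T' ⟶ Spec R'} {g : T' ⟶ T} {φ : R ⟶ R'} (h : g ≫ s = s' ≫ Spec.map φ) (f : R) :
    g.appTop (pullFun s f) = pullFun s' (φ f) := by
  have h3 : ((Scheme.ΓSpecIso R).inv ≫ s.appTop) ≫ g.appTop =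
      φ ≫ (Scheme.ΓSpecIso R').inv ≫ s'.appTop := by
    rw [Category.assoc, ← Scheme.Hom.comp_appTop, h, Scheme.Hom.comp_appTop,
      ← Scheme.ΓSpecIso_inv_naturality_assoc]
  exact congr($h3 f)

theorem mem_basicOpen_pullFun {R : CommRingCat.{u}} {T : Scheme.{u}} (s : T ⟶ Spec R) (f : R)
    (t : T) : t ∈ T.basicOpen (pullFun s f) ↔ f ∉ (s t).asIdeal := by
  change t ∈ T.basicOpen (s.appTop ((Scheme.ΓSpecIso R).inv f)) ↔ _
  rw [mem_basicOpen_appTop_iff, basicOpen_eq_of_affine']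
  simp
  rfl

/-- The function on `X × Δ^m` given by an element of the coordinate ring of `Δ^m`. -/
def simplexFun (X : Over S) (m : SimplexCategory) :
    simplexRing.{u} m.len →+* Γ(((prodSimplex X).obj m).left, ⊤) :=
  pullFun (simplexProj X m)

theorem simplexProj_map (X : Over S) {m l : SimplexCategory} (a : m ⟶ l) :
    ((prodSimplex X).map a).left ≫ simplexProj X l =
      simplexProj X m ≫ Spec.map (CommRingCat.ofHom (simplexRingMap.{u} a.toOrderHom)) :=
  prod.map_snd (𝟙 X.left) (algSimplex.map a)

theorem simplexFun_map (X : Over S) {m l : SimplexCategory} (a : m ⟶ l)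
    (f : simplexRing.{u} l.len) :
    ((prodSimplex X).map a).left.appTop (simplexFun X l f) =
      simplexFun X m (simplexRingMap a.toOrderHom f) :=
  appTop_pullFun (simplexProj_map X a) f

theorem isPullback_prod_map {C : Type*} [Category* C] [HasBinaryProducts C] (A : C) {B B' : C}
    (f : B ⟶ B') : IsPullback (prod.snd : A ⨯ B ⟶ B) (prod.map (𝟙 A) f) f
      (prod.snd : A ⨯ B' ⟶ B') := by
  refine ⟨⟨(prod.map_snd _ _).symm⟩, ⟨PullbackCone.IsLimit.mk _
    (fun s => prod.lift (s.snd ≫ prod.fst) s.fst) (fun s => prod.lift_snd _ _) (fun s => ?_)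
    (fun s t h1 h2 => ?_)⟩⟩
  · rw [prod.lift_map, Category.comp_id]
    refine prod.hom_ext ?_ ?_
    · rw [prod.lift_fst]
    · rw [prod.lift_snd]
      exact s.condition
  · refine prod.hom_ext ?_ (by rw [h1, prod.lift_snd])
    rw [prod.lift_fst, ← h2, Category.assoc, prod.map_fst, Category.comp_id]

theorem isPullback_simplexProj (X : Over S) {m l : SimplexCategory} (a : m ⟶ l) :
    IsPullback (simplexProj X m) ((prodSimplex X).map a).left
      (Spec.map (CommRingCat.ofHom (simplexRingMap.{u} a.toOrderHom))) (simplexProj X l) :=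
  isPullback_prod_map X.left (algSimplex.map a)

/-- A prime ideal of the coordinate ring of `Δ^{p+1}` containing the product of the barycentric
coordinates lies on a face. -/
theorem exists_comap_simplexRingMap_eq {p : ℕ} (P : PrimeSpectrum (simplexRing.{u} (p + 1)))
    (hP : baryProd (p + 1) ∈ P.asIdeal) :
    ∃ (r : Fin (p + 2)) (Q : PrimeSpectrum (simplexRing.{u} p)),
      Q.asIdeal.comap (simplexRingMap.{u} r.succAbove) = P.asIdeal := by
  have := P.isPrime
  obtain ⟨r, -, hr⟩ := Ideal.IsPrime.prod_mem_iff.mp hP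
  have hsurj : Function.Surjective (simplexRingMap.{u} r.succAbove) := fun g =>
    ⟨_, simplexRingMap_merge_self r 0 g⟩
  have hker : RingHom.ker (simplexRingMap.{u} r.succAbove) ≤ P.asIdeal := fun y hy => by
    obtain ⟨z, rfl⟩ := bary_dvd_of_simplexRingMap_eq_zero r y hy
    exact Ideal.mul_mem_right _ _ hr
  refine ⟨r, ⟨P.asIdeal.map (simplexRingMap.{u} r.succAbove),
    Ideal.map_isPrime_of_surjective hsurj hker⟩, ?_⟩
  rw [Ideal.comap_map_of_surjective _ hsurj]
  exact sup_eq_left.mpr hker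

/-- The points of `X × Δ^{p+1}` where the product of the barycentric coordinates vanishes lie on the
faces. -/
theorem mem_range_face (X : Over S) {p : ℕ} (b : ((prodSimplex X).obj (.mk (p + 1))).left)
    (hb : b ∉ ((prodSimplex X).obj (.mk (p + 1))).left.basicOpen
      (simplexFun X (.mk (p + 1)) (baryProd (p + 1)))) :
    ∃ r : Fin (p + 2), b ∈ Set.range ((prodSimplex X).map (SimplexCategory.δ r)).left := by
  rw [simplexFun, mem_basicOpen_pullFun, not_not] at hb
  obtain ⟨r, Q, hQ⟩ := exists_comap_simplexRingMap_eq (simplexProj X (.mk (p + 1)) b) hb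
  obtain ⟨b', -, hb'⟩ := Scheme.exists_preimage_of_isPullback
    (isPullback_simplexProj X (SimplexCategory.δ r)) Q b (PrimeSpectrum.ext hQ)
  exact ⟨r, b', hb'⟩

end Faces

/-! ### Moving families into disjoint position -/

section Rlp

open Simplicial SSet SSet.modelCategoryQuillen

/-- The lifting property against the boundary inclusions `∂Δ[n] ⟶ Δ[n]`, in terms of faces. -/
theorem rlp_I_of_exists {T B : SSet.{u}} (p : T ⟶ B)
    (h₀ : ∀ b : B _⦋0⦌, ∃ t : T _⦋0⦌, p.app _ t = b)
    (h : ∀ (n : ℕ) (b : B _⦋n + 1⦌) (t : Fin (n + 2) → T _⦋n⦌),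
      (∀ i, p.app _ (t i) = B.map (SimplexCategory.δ i).op b) →
      (∀ (q : ℕ) (a a' : ⦋q⦌ ⟶ ⦋n⦌) (i l : Fin (n + 2)),
        a ≫ SimplexCategory.δ i = a' ≫ SimplexCategory.δ l →
        T.map a.op (t i) = T.map a'.op (t l)) →
      ∃ s : T _⦋n + 1⦌, p.app _ s = b ∧ ∀ i, T.map (SimplexCategory.δ i).op s = t i) :
    I.{u}.rlp p := by
  rintro _ _ _ ⟨n⟩
  refine ⟨fun {f g} sq => ?_⟩
  obtain _ | n := n
  · obtain ⟨t, ht⟩ := h₀ (SSet.yonedaEquiv g)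
    refine ⟨⟨SSet.yonedaEquiv.symm t, boundary.hom_ext₀, ?_⟩⟩
    apply SSet.yonedaEquiv.injective
    rw [SSet.yonedaEquiv_comp, Equiv.apply_symm_apply, ht]
  · have h1 : ∀ i, p.app _ (SSet.yonedaEquiv (boundary.ι i ≫ f)) =
        B.map (SimplexCategory.δ i).op (SSet.yonedaEquiv g) := fun i => by
      rw [← SSet.yonedaEquiv_comp, Category.assoc, sq.w, boundary.ι_ι_assoc]
      exact (SSet.yonedaEquiv_naturality (SimplexCategory.δ i) g).symm
    have h2 : ∀ (q : ℕ) (a a' : ⦋q⦌ ⟶ ⦋n⦌) (i l : Fin (n + 2)),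
        a ≫ SimplexCategory.δ i = a' ≫ SimplexCategory.δ l →
        T.map a.op (SSet.yonedaEquiv (boundary.ι i ≫ f)) =
          T.map a'.op (SSet.yonedaEquiv (boundary.ι l ≫ f)) := fun q a a' i l e => by
      rw [SSet.yonedaEquiv_naturality a, SSet.yonedaEquiv_naturality a']
      have : SSet.stdSimplex.map a ≫ boundary.ι i = SSet.stdSimplex.map a' ≫ boundary.ι l := by
        rw [← cancel_mono ∂Δ[n + 1].ι, Category.assoc, Category.assoc, boundary.ι_ι,
          boundary.ι_ι]
        exact ((SSet.stdSimplex.map_comp a (SimplexCategory.δ i)).symm.trans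
          (congrArg SSet.stdSimplex.map e)).trans
            (SSet.stdSimplex.map_comp a' (SimplexCategory.δ l))
      rw [← Category.assoc, this, Category.assoc]
    obtain ⟨s, hs, hs'⟩ := h n (SSet.yonedaEquiv g)
      (fun i => SSet.yonedaEquiv (boundary.ι i ≫ f)) h1 h2
    refine ⟨⟨SSet.yonedaEquiv.symm s, boundary.hom_ext fun i => ?_, ?_⟩⟩
    · have e := SSet.yonedaEquiv_symm_naturality_left (SimplexCategory.δ i) s
      rw [hs' i, Equiv.symm_apply_apply] at e
      rw [boundary.ι_ι_assoc]
      exact e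
    · apply SSet.yonedaEquiv.injective
      rw [SSet.yonedaEquiv_comp, Equiv.apply_symm_apply, hs]

end Rlp

section Moved

variable {S : Scheme.{u}} {k : ℕ} {V V' : SchPt S}

/-- Translation of a stable class on `X × Δ^m` by elements of the coordinate ring of `Δ^m`. -/
def simplexAct (X : Over S) (m : SimplexCategory) (c : ℕ → simplexRing.{u} m.len)
    (x : StableCorr V ((prodSimplex X).obj m)) : StableCorr V ((prodSimplex X).obj m) :=
  stableAct (fun r => simplexFun X m (c r)) x

variable (X : Over S) {m l : SimplexCategory}

theorem simplexAct_zero (x : StableCorr V ((prodSimplex X).obj m)) : simplexAct X m 0 x = x := by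
  have h : (fun r => simplexFun X m ((0 : ℕ → simplexRing.{u} m.len) r)) = 0 :=
    funext fun _ => map_zero (simplexFun X m)
  rw [simplexAct, h, stableAct_zero]

theorem simplexAct_simplexAct {c d : ℕ → simplexRing.{u} m.len} (hc : FinSupp c) (hd : FinSupp d)
    (x : StableCorr V ((prodSimplex X).obj m)) :
    simplexAct X m d (simplexAct X m c x) = simplexAct X m (d + c) x := by
  have h : (fun r => simplexFun X m ((d + c) r)) =
      (fun r => simplexFun X m (d r)) + fun r => simplexFun X m (c r) :=
    funext fun _ => map_add (simplexFun X m) _ _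
  rw [simplexAct, simplexAct, stableAct_stableAct (hc.map _) (hd.map _), simplexAct, h]

theorem stableMap_simplexAct (a : m ⟶ l) (p : V ⟶ V') {c : ℕ → simplexRing.{u} l.len}
    (hc : FinSupp c) (x : StableCorr V ((prodSimplex X).obj l)) :
    stableMap ((prodSimplex X).map a) p (simplexAct X l c x) =
      simplexAct X m (fun r => simplexRingMap a.toOrderHom (c r))
        (stableMap ((prodSimplex X).map a) p x) := by
  rw [simplexAct, stableMap_stableAct _ _ (hc.map _), simplexAct]
  congr 1
  exact funext fun r => simplexFun_map X a (c r)

theorem stableMap_map_id (x : StableCorr V ((prodSimplex X).obj m)) :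
    stableMap ((prodSimplex X).map (𝟙 m)) (𝟙 V) x = x := by
  rw [CategoryTheory.Functor.map_id, stableMap_id]

theorem stableMap_map_comp {m' : SimplexCategory} (b : m' ⟶ m) (a : m ⟶ l)
    (x : StableCorr V ((prodSimplex X).obj l)) :
    stableMap ((prodSimplex X).map (b ≫ a)) (𝟙 V) x =
      stableMap ((prodSimplex X).map b) (𝟙 V) (stableMap ((prodSimplex X).map a) (𝟙 V) x) := by
  rw [CategoryTheory.Functor.map_comp, ← stableMap_comp, Category.comp_id]

variable (V : Fin k → SchPt S)

/-- The product over `j` of the simplicial sets `h^{nfr}_S(V_j)(X × Δ^•)`. -/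
def prodCorr : SSet.{u + 1} where
  obj m := ∀ j, StableCorr (V j) ((prodSimplex X).obj m.unop)
  map a := ↾fun x j => stableMap ((prodSimplex X).map a.unop) (𝟙 (V j)) (x j)
  map_id m := by
    ext x j
    exact stableMap_map_id X (x j)
  map_comp a b := by
    ext x j
    exact stableMap_map_comp X b.unop a.unop (x j)

/-- A family of stable classes on `X × Δ^m` together with translations making it disjoint. -/
@[ext]
structure MovedFamily (m : SimplexCategory) where
  x : ∀ j, StableCorr (V j) ((prodSimplex X).obj m)
  c : Fin k → ℕ → simplexRing.{u} m.len
  finSupp : ∀ j, FinSupp (c j)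
  disjoint : StableDisjoint fun j => simplexAct X m (c j) (x j)

variable {X V}

/-- The pullback of a moved family along `X × Δ^m → X × Δ^l`. -/
def MovedFamily.map (a : m ⟶ l) (t : MovedFamily X V l) : MovedFamily X V m where
  x j := stableMap ((prodSimplex X).map a) (𝟙 (V j)) (t.x j)
  c j r := simplexRingMap a.toOrderHom (t.c j r)
  finSupp j := (t.finSupp j).map _
  disjoint := by
    have h := t.disjoint.stableMap ((prodSimplex X).map a) fun j => 𝟙 (V j)
    simpa only [stableMap_simplexAct X a _ (t.finSupp _)] using h

variable (X V)

/-- The simplicial set of families together with translations making them disjoint. -/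
def movedFamilies : SSet.{u + 1} where
  obj m := MovedFamily X V m.unop
  map a := ↾MovedFamily.map a.unop
  map_id m := by
    refine ConcreteCategory.hom_ext _ _ fun t => ?_
    refine MovedFamily.ext (funext fun j => stableMap_map_id X (t.x j)) ?_
    exact funext fun j => funext fun r =>
      congr($(simplexRingMap_id m.unop.len) (t.c j r))
  map_comp a b := by
    refine ConcreteCategory.hom_ext _ _ fun t => ?_
    refine MovedFamily.ext (funext fun j => stableMap_map_comp X b.unop a.unop (t.x j)) ?_
    exact funext fun j => funext fun r =>
      congr($(simplexRingMap_comp b.unop.toOrderHom a.unop.toOrderHom) (t.c j r))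

/-- Forgetting the translations. -/
def forgetMove : movedFamilies X V ⟶ prodCorr X V where
  app _ := ↾fun t => t.x
  naturality _ _ _ := rfl

variable {X V}

/-- Every family over a simplex admits translations extending given ones over the boundary: extend
those arbitrarily, and then move the `j`-th member by the product of the barycentric coordinates in
a fresh coordinate. -/
theorem MovedFamily.exists_extend (n : ℕ)
    (b : ∀ j, StableCorr (V j) ((prodSimplex X).obj (.mk (n + 1))))
    (t : Fin (n + 2) → MovedFamily X V (.mk n))
    (ht : ∀ i j, (t i).x j = stableMap ((prodSimplex X).map (SimplexCategory.δ i)) (𝟙 (V j)) (b j))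
    (hc : ∀ (q : ℕ) (a a' : SimplexCategory.mk q ⟶ .mk n) (i l : Fin (n + 2)),
        a ≫ SimplexCategory.δ i = a' ≫ SimplexCategory.δ l → (t i).map a = (t l).map a') :
    ∃ s : MovedFamily X V (.mk (n + 1)), s.x = b ∧
      ∀ i, s.map (SimplexCategory.δ i) = t i := by
  -- the extension is taken to be zero where possible, so that it has finite support in `r`
  have h1 : ∀ j r, ∃ f : simplexRing.{u} (n + 1),
      (∀ i, simplexRingMap.{u} i.succAbove f = (t i).c j r) ∧
        ((∀ i, (t i).c j r = 0) → f = 0) := by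
    intro j r
    by_cases h0 : ∀ i, (t i).c j r = 0
    · exact ⟨0, fun i => by rw [h0, map_zero], fun _ => rfl⟩
    · obtain ⟨f, hf⟩ := exists_simplexRingMap_succAbove_eq (fun i => (t i).c j r)
        (fun q a a' i l ha ha' e => by
          have h2 := hc q (SimplexCategory.Hom.mk ⟨a, ha⟩) (SimplexCategory.Hom.mk ⟨a', ha'⟩) i l
            (by ext x : 3; exact e x)
          exact congrFun (congrFun (congrArg MovedFamily.c h2) j) r)
      exact ⟨f, hf, fun h => absurd h h0⟩
  choose f hf hf0 using h1
  have hfin : ∀ j, FinSupp (f j) := by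
    intro j
    choose N hN using fun i => (t i).finSupp j
    exact ⟨∑ i, N i, fun r hr => hf0 j r fun i => hN i r
      ((Finset.single_le_sum (fun _ _ => Nat.zero_le _) (Finset.mem_univ i)).trans hr)⟩
  obtain ⟨N, hN⟩ := exists_stableDisjoint (fun j => simplexAct X (.mk (n + 1)) (f j) (b j))
    (simplexFun X (.mk (n + 1)) (baryProd (n + 1))) (fun z hz => by
      obtain ⟨i, hi⟩ := mem_range_face X z hz
      refine ⟨_, (prodSimplex X).map (SimplexCategory.δ i), hi, ?_, ?_⟩
      · rw [simplexFun_map]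
        exact (congrArg _ (simplexRingMap_baryProd i)).trans (map_zero _)
      · have h3 : (fun j => stableMap ((prodSimplex X).map (SimplexCategory.δ i)) (𝟙 (V j))
            (simplexAct X (.mk (n + 1)) (f j) (b j))) =
            fun j => simplexAct X (.mk n) ((t i).c j) ((t i).x j) := by
          funext j
          rw [stableMap_simplexAct X _ _ (hfin j), ht]
          congr 1
          exact funext fun r => hf j r i
        rw [h3]
        exact (t i).disjoint)
  -- these translations vanish on the boundary, so they do not change the restrictions to the faces
  let d : Fin k → ℕ → simplexRing.{u} (n + 1) := fun j => Pi.single (N + j.1) (baryProd (n + 1))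
  have hd : ∀ j, FinSupp (d j) := fun j =>
    ⟨N + j.1 + 1, fun r hr => Pi.single_eq_of_ne (by omega) _⟩
  have hN' : (fun j => simplexAct X (.mk (n + 1)) (d j + f j) (b j)) = fun j : Fin k =>
      stableAct (Pi.single (N + j.1) (simplexFun X (.mk (n + 1)) (baryProd (n + 1))))
        (simplexAct X (.mk (n + 1)) (f j) (b j)) := by
    funext j
    rw [← simplexAct_simplexAct X (hfin j) (hd j), simplexAct]
    congr 1
    funext r
    by_cases hr : r = N + j.1
    · subst hr
      rw [Pi.single_eq_same]
      exact congrArg _ (Pi.single_eq_same _ _)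
    · rw [Pi.single_eq_of_ne hr]
      exact (congrArg _ (Pi.single_eq_of_ne hr _)).trans (map_zero _)
  refine ⟨⟨b, fun j => d j + f j, fun j => (hd j).add (hfin j), by rw [hN']; exact hN⟩, rfl,
    fun i => MovedFamily.ext (funext fun j => (ht i j).symm) (funext fun j => funext fun r => ?_)⟩
  change simplexRingMap.{u} i.succAbove (d j r + f j r) = _
  rw [map_add, hf]
  have h4 : simplexRingMap.{u} i.succAbove (d j r) = 0 := by
    by_cases hr : r = N + j.1
    · subst hr
      exact (congrArg _ (Pi.single_eq_same _ _)).trans (simplexRingMap_baryProd i)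
    · exact (congrArg _ (Pi.single_eq_of_ne hr _)).trans (map_zero _)
  rw [h4, zero_add]

/-- Every family over a point can be made disjoint, by translating the `j`-th member by `1` in a
fresh coordinate of its own. -/
theorem MovedFamily.exists_zero (b : ∀ j, StableCorr (V j) ((prodSimplex X).obj (.mk 0))) :
    ∃ s : MovedFamily X V (.mk 0), s.x = b := by
  obtain ⟨N, hN⟩ := exists_stableDisjoint b (simplexFun X (.mk 0) 1) (fun z hz => by
    rw [map_one, Scheme.basicOpen_of_isUnit _ isUnit_one] at hz
    exact (hz trivial).elim)
  let d : Fin k → ℕ → simplexRing.{u} 0 := fun j => Pi.single (N + j.1) 1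
  have hd : ∀ j, FinSupp (d j) := fun j =>
    ⟨N + j.1 + 1, fun r hr => Pi.single_eq_of_ne (by omega) _⟩
  refine ⟨⟨b, d, hd, ?_⟩, rfl⟩
  have hN' : (fun j => simplexAct X (.mk 0) (d j) (b j)) = fun j : Fin k =>
      stableAct (Pi.single (N + j.1) (simplexFun X (.mk 0) 1)) (b j) := by
    funext j
    rw [simplexAct]
    congr 1
    funext r
    by_cases hr : r = N + j.1
    · subst hr
      rw [Pi.single_eq_same]
      exact congrArg _ (Pi.single_eq_same _ _)
    · rw [Pi.single_eq_of_ne hr]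
      exact (congrArg _ (Pi.single_eq_of_ne hr _)).trans (map_zero _)
  rw [hN']
  exact hN

/-- Forgetting the translations is a trivial fibration from moved families to families. -/
theorem forgetMove_rlp : SSet.modelCategoryQuillen.I.rlp (forgetMove X V) := by
  refine rlp_I_of_exists _ (fun b => MovedFamily.exists_zero b) fun n b t ht hc => ?_
  exact MovedFamily.exists_extend n b t (fun i j => congrFun (ht i) j) hc

end Moved

/-! ### Families over the algebraic simplices and decompositions -/

section Comparison

open MonoidalCategory Simplicial SSet HomotopicalAlgebra

variable {S : Scheme.{u}} {k : ℕ} (X : Over S) {W : SchPt S} {V : Fin k → SchPt S}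
  {p : ∀ j, W ⟶ V j} {q : ∀ j, (V j).sch ⟶ W.sch}

/-- The barycentric coordinate `t_i` of `Δ^1`, pulled back to `Δ^m` along an `m`-simplex of
`Δ[1]`. -/
def scale (i : Fin 2) {m : SimplexCategoryᵒᵖ} (y : (Δ[1] : SSet.{u + 1}).obj m) :
    simplexRing.{u} m.unop.len :=
  simplexRingMap (SSet.stdSimplex.objEquiv y).toOrderHom (bary 1 i)

theorem scale_map (i : Fin 2) {m l : SimplexCategoryᵒᵖ} (a : m ⟶ l)
    (y : (Δ[1] : SSet.{u + 1}).obj m) :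
    scale i ((Δ[1] : SSet.{u + 1}).map a y) = simplexRingMap a.unop.toOrderHom (scale i y) :=
  congr($(simplexRingMap_comp a.unop.toOrderHom (SSet.stdSimplex.objEquiv y).toOrderHom)
    (bary 1 i))

theorem scale_const_of_ne {i i' : Fin 2} (h : i ≠ i') (m : SimplexCategoryᵒᵖ) :
    scale.{u} i ((SSet.stdSimplex.const 1 i' m)) = 0 :=
  simplexRingMap_bary_eq_zero _ _ fun _ e => h e.symm

theorem scale_const_self (i : Fin 2) (m : SimplexCategoryᵒᵖ) :
    scale.{u} i ((SSet.stdSimplex.const 1 i m)) = 1 := by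
  have h : ∑ i', scale.{u} i' ((SSet.stdSimplex.const 1 i m)) = 1 := by
    unfold scale
    rw [← map_sum, sum_bary, map_one]
  rw [← h, Finset.sum_eq_single i]
  · intro i' _ hi
    exact scale_const_of_ne hi m
  · simp

/-- The homotopy on moved families which multiplies the translations by the coordinate `t_i` of
the interval. -/
def moveHomotopy (V : Fin k → SchPt S) (i : Fin 2) :
    movedFamilies X V ⊗ (Δ[1] : SSet.{u + 1}) ⟶ prodCorr X V where
  app m := ↾fun t j => simplexAct X m.unop (fun r => scale i t.2 * t.1.c j r) (t.1.x j)
  naturality m l a := by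
    refine ConcreteCategory.hom_ext _ _ fun t => funext fun j => ?_
    have hf : FinSupp fun r => scale i t.2 * t.1.c j r :=
      (t.1.finSupp j).imp fun N hN r hr => by
        change _ * _ = _
        rw [hN r hr, mul_zero]
    refine Eq.trans ?_ (stableMap_simplexAct X a.unop (𝟙 _) hf (t.1.x j)).symm
    change simplexAct X l.unop (fun r => scale i _ * _) _ = _
    refine congrArg (simplexAct X l.unop · _) (funext fun r => ?_)
    rw [map_mul, ← scale_map]
    rfl

/-- The simplicial set `h^{nfr}_S(W)(X × Δ^•)`. -/
abbrev corrSimplices (W : SchPt S) : SSet.{u + 1} := (prodSimplex X).op ⋙ (hnfr S).obj W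

theorem corrSimplices_map {m l : SimplexCategoryᵒᵖ} (a : m ⟶ l)
    (x : StableCorr W ((prodSimplex X).obj m.unop)) :
    (corrSimplices X W).map a x = stableMap ((prodSimplex X).map a.unop) (𝟙 W) x := by
  unfold stableMap
  rw [CategoryTheory.Functor.map_id]
  rfl

/-- The map `h^{nfr}_S(W)(X × Δ^•) → ∏_j h^{nfr}_S(V_j)(X × Δ^•)` induced by maps
`W_+ → (V_j)_+`. -/
def toProdCorr (p : ∀ j, W ⟶ V j) : corrSimplices X W ⟶ prodCorr X V where
  app _ := ↾fun x j => stableMap (𝟙 _) (p j) x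
  naturality m l a := by
    refine ConcreteCategory.hom_ext _ _ fun x => funext fun j => ?_
    change stableMap (𝟙 _) (p j) ((corrSimplices X W).map a x) =
      stableMap _ (𝟙 (V j)) (stableMap (𝟙 _) (p j) x)
    rw [corrSimplices_map, ← stableMap_comp, ← stableMap_comp]
    simp only [Category.id_comp, Category.comp_id]

variable {X}

/-- The correspondence glued from the members of a moved family. -/
def glueMoved (H : IsDecomposition p q) : movedFamilies X V ⟶ corrSimplices X W where
  app _ := ↾fun t => ((H.exists_stableMap_eq_iff _).mpr t.disjoint).choose
  naturality m l a := by
    refine ConcreteCategory.hom_ext _ _ fun t => H.stableMap_injective fun j => ?_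
    have h1 := ((H.exists_stableMap_eq_iff _).mpr t.disjoint).choose_spec j
    have h2 := ((H.exists_stableMap_eq_iff _).mpr (t.map a.unop).disjoint).choose_spec j
    have h3 := congrFun (congr($((toProdCorr X p).naturality a)
      ((H.exists_stableMap_eq_iff _).mpr t.disjoint).choose)) j
    refine h2.trans (Eq.trans ?_ h3.symm)
    refine Eq.trans ?_ (congrArg (stableMap ((prodSimplex X).map a.unop) (𝟙 (V j))) h1.symm)
    exact (stableMap_simplexAct X a.unop (𝟙 _) (t.finSupp j) (t.x j)).symm

theorem glueMoved_toProdCorr (H : IsDecomposition p q) {m : SimplexCategoryᵒᵖ}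
    (t : (movedFamilies X V).obj m) (j : Fin k) :
    (toProdCorr X p).app m ((glueMoved H).app m t) j = simplexAct X m.unop (t.c j) (t.x j) :=
  ((H.exists_stableMap_eq_iff _).mpr t.disjoint).choose_spec j

/-- The family of restrictions of a correspondence, which is disjoint without translations. -/
def splitCorr (H : IsDecomposition p q) : corrSimplices X W ⟶ movedFamilies X V where
  app m := ↾fun x =>
    { x := (toProdCorr X p).app m x
      c := fun _ => 0
      finSupp := fun _ => finSupp_zero
      disjoint := by
        simp only [simplexAct_zero]
        exact (H.exists_stableMap_eq_iff _).mp ⟨x, fun _ => rfl⟩ }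
  naturality m l a := by
    refine ConcreteCategory.hom_ext _ _ fun x =>
      MovedFamily.ext ?_ ?_
    · exact congr($((toProdCorr X p).naturality a) x)
    · exact funext fun j => funext fun r => (map_zero _).symm

variable (X)

/-- If `W` is the disjoint union of the `V_j`, then `h^{nfr}_S(W)(X × Δ^•)` is the simplicial subset
of `∏_j h^{nfr}_S(V_j)(X × Δ^•)` formed by the disjoint families, and the inclusion is a weak
equivalence: translations, scaled by the coordinates of the interval, deform it to a trivial
fibration. -/
theorem IsDecomposition.isWeakEquivalence (H : IsDecomposition p q) :
    IsWeakEquivalence (toProdCorr X p) := by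
  have hmono : Mono (toProdCorr X p) := by
    rw [NatTrans.mono_iff_mono_app]
    intro m
    rw [mono_iff_injective]
    exact fun x y h => H.stableMap_injective fun j => congrFun h j
  have h0 : ∀ {m : SimplexCategoryᵒᵖ} (t : MovedFamily X V m.unop) (j : Fin k) {s}, s = 0 →
      simplexAct X m.unop (fun r => s * t.c j r) (t.x j) = t.x j := by
    rintro m t j _ rfl
    simp only [zero_mul]
    exact simplexAct_zero X _
  have h1 : ∀ {m : SimplexCategoryᵒᵖ} (t : MovedFamily X V m.unop) (j : Fin k) {s}, s = 1 →
      simplexAct X m.unop (fun r => s * t.c j r) (t.x j) = simplexAct X m.unop (t.c j) (t.x j) := by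
    rintro m t j _ rfl
    simp only [one_mul]
  -- at one end of the interval the translations are zero, at the other end they are the given ones
  have e0 : ∀ i i' : Fin 2, i ≠ i' → ∀ {m : SimplexCategoryᵒᵖ} (t : (movedFamilies X V).obj m),
      (moveHomotopy X V i).app m (t, SSet.stdSimplex.const 1 i' m) = (forgetMove X V).app m t :=
    fun i i' h m t => funext fun j => h0 t j (scale_const_of_ne h m)
  have e1 : ∀ (i : Fin 2) {m : SimplexCategoryᵒᵖ} (t : (movedFamilies X V).obj m),
      (moveHomotopy X V i).app m (t, SSet.stdSimplex.const 1 i m) =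
        (glueMoved H ≫ toProdCorr X p).app m t :=
    fun i m t => funext fun j => (h1 t j (scale_const_self i m)).trans
      (glueMoved_toProdCorr H t j).symm
  refine isWeakEquivalence_of_trivialFibration forgetMove_rlp (glueMoved H) (splitCorr H) rfl ?_
    ⟨homotopyMk (moveHomotopy X V 1) ?_ ?_⟩ ⟨homotopyMk (moveHomotopy X V 0) ?_ ?_⟩
  · ext m x
    refine H.stableMap_injective fun j => ?_
    exact (glueMoved_toProdCorr H _ j).trans (simplexAct_zero X _)
  · exact NatTrans.ext (funext fun m => ConcreteCategory.hom_ext _ _ fun t => e0 1 0 (by decide) t)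
  · exact NatTrans.ext (funext fun m => ConcreteCategory.hom_ext _ _ fun t => e1 1 t)
  · exact NatTrans.ext (funext fun m => ConcreteCategory.hom_ext _ _ fun t => e1 0 t)
  · exact NatTrans.ext (funext fun m => ConcreteCategory.hom_ext _ _ fun t => e0 0 1 (by decide) t)

end Comparison

/-! ### Coproducts of schemes over a base -/

section Coproducts

variable {S : Scheme.{u}} {k : ℕ}

/-- The scheme underlying a finite coproduct of `S`-schemes is the disjoint union. -/
def sigmaLeftIso (Y : Fin k → Over S) : (∐ fun j => (Y j).left : Scheme.{u}) ≅ (∐ Y).left :=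
  (PreservesCoproduct.iso (Over.forget S) Y).symm

theorem sigmaι_left (Y : Fin k → Over S) (j : Fin k) :
    (Sigma.ι Y j).left = Sigma.ι (fun j => (Y j).left) j ≫ (sigmaLeftIso Y).hom :=
  (ι_comp_sigmaComparison (Over.forget S) Y j).symm

/-- If `W` is the coproduct of the `V_j`, then the pointed maps `W_+ → (V_j)_+` that are the
identity on `V_j` and send the other summands to the base point form a decomposition. -/
theorem isDecomposition_of_iso {W : SchPt S} {V : Fin k → SchPt S} {p : ∀ j, W ⟶ V j}
    {q : ∀ j, (V j).sch ⟶ W.sch} (e : (∐ fun j => (V j).sch) ≅ W.sch)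
    (he : ∀ j, q j = Sigma.ι (fun j => (V j).sch) j ≫ e.hom)
    (h : ∀ j, q j ≫ coprod.inl ≫ plusMap (p j) = coprod.inl)
    (h' : ∀ j l, l ≠ j → q l ≫ coprod.inl ≫ plusMap (p j) = toBase _ ≫ coprod.inr) :
    IsDecomposition p q := by
  let E : (∐ fun j => (V j).sch.left : Scheme.{u}) ≅ W.sch.left :=
    sigmaLeftIso (fun j => (V j).sch) ≪≫ (Over.forget S).mapIso e
  have hE : ∀ j, (q j).left = Sigma.ι (fun j => (V j).sch.left) j ≫ E.hom := by
    intro j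
    rw [he, Over.comp_left, sigmaι_left, Category.assoc]
    rfl
  have hopen : ∀ j, IsOpenImmersion (q j).left := by
    intro j
    rw [hE]
    infer_instance
  have hex : ∀ y, ∃ j x, (q j).left x = y := by
    intro y
    obtain ⟨j, x, hx⟩ := exists_sigmaι_eq_apply (fun j => (V j).sch.left) (E.inv y)
    refine ⟨j, x, ?_⟩
    rw [hE]
    change E.hom (Sigma.ι (fun j => (V j).sch.left) j x) = y
    rw [hx]
    exact congr($(E.inv_hom_id) y)
  refine ⟨hex, fun j l x y hxy => ?_, fun j => ?_⟩
  · rw [hE, hE] at hxy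
    exact eq_of_sigmaι_eq j l x y (E.hom.homeomorph.injective hxy)
  · have hj : (q j).left ≫ plusRes (p j) = inclPlus (V j).sch := congr(($(h j)).left)
    have hmono : Mono (inclPlus (V j).sch) := inferInstance
    refine ⟨⟨by rw [hj, Category.id_comp]⟩, ⟨PullbackCone.IsLimit.mk _ (fun s => s.snd)
      (fun s => ?_) (fun s => Category.comp_id _)
      fun s m _ hm => (Category.comp_id m).symm.trans hm⟩⟩
    -- points of the other summands are sent to the base point, which does not lie in `V_j`
    have hr : Set.range s.fst ⊆ Set.range (q j).left := by
      rintro _ ⟨t, rfl⟩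
      obtain ⟨l, x, hx⟩ := hex (s.fst t)
      by_cases hl : l = j
      · subst hl
        exact ⟨x, hx⟩
      · have h1 : (q l).left ≫ plusRes (p j) = (toBase (V l).sch).left ≫ basePlus (V j).sch :=
          congr(($(h' j l hl)).left)
        have h2 : basePlus (V j).sch ((toBase (V l).sch).left x) =
            inclPlus (V j).sch (s.snd t) := by
          refine (congr($h1 x)).symm.trans (Eq.trans ?_ congr($(s.condition) t))
          change plusRes (p j) ((q l).left x) = plusRes (p j) (s.fst t)
          rw [hx]
        exact ((isCompl_range_plus (V j).sch).disjoint.le_bot ⟨⟨_, rfl⟩, ⟨_, h2⟩⟩).elim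
    have hfac := IsOpenImmersion.lift_fac (q j).left s.fst hr
    have hs : IsOpenImmersion.lift (q j).left s.fst hr = s.snd := by
      rw [← cancel_mono (inclPlus (V j).sch), ← s.condition]
      refine (congrArg (_ ≫ ·) hj.symm).trans ?_
      rw [reassoc_of% hfac]
    rw [← hs, hfac]

theorem isDecomposition_collapse (Y : Fin k → Over S) :
    IsDecomposition (W := SchPt.of (∐ Y)) (V := fun j => SchPt.of (Y j)) (collapse Y)
      (fun j => Sigma.ι Y j) := by
  refine isDecomposition_of_iso (Iso.refl _) (fun j => (Category.comp_id _).symm) (fun j => ?_)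
    fun j l hl => ?_
  · change Sigma.ι Y j ≫ coprod.inl ≫ coprod.desc _ _ = _
    rw [coprod.inl_desc, Sigma.ι_desc, dif_pos rfl, eqToHom_refl, Category.id_comp]
  · change Sigma.ι Y l ≫ coprod.inl ≫ coprod.desc _ _ = _
    rw [coprod.inl_desc, Sigma.ι_desc, dif_neg hl]

theorem isDecomposition_rho (Y : Over S) (n : ℕ) :
    IsDecomposition (W := (finPower Y).obj (.mk n)) (V := fun _ : Fin n => (finPower Y).obj (.mk 1))
      (fun i => (finPower Y).map (FinPt.rho n i))
      (fun i => (Sigma.desc fun _ => 𝟙 Y : (∐ fun _ : Fin 1 => Y) ⟶ Y) ≫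
        Sigma.ι (fun _ : Fin n => Y) i) := by
  let e : (∐ fun _ : Fin 1 => Y) ≅ Y :=
    { hom := Sigma.desc fun _ => 𝟙 Y
      inv := Sigma.ι (fun _ : Fin 1 => Y) 0
      hom_inv_id := Sigma.hom_ext _ _ fun i => by
        rw [Subsingleton.elim i 0, Sigma.ι_desc_assoc, Category.id_comp, Category.comp_id]
      inv_hom_id := Sigma.ι_desc _ _ }
  have hρ : ∀ i l : Fin n, Sigma.ι (fun _ : Fin n => Y) l ≫ coprod.inl ≫
      finMap Y (FinPt.rho n i) = finIncl Y 1 (if some l = some i then some 0 else none) := by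
    intro i l
    have h := finIncl_finMap Y (FinPt.rho n i) (some l)
    rw [finIncl, Category.assoc] at h
    exact h
  have h1 : ∀ i : Fin n, e.hom ≫ Sigma.ι (fun _ : Fin n => Y) i ≫ coprod.inl ≫
      finMap Y (FinPt.rho n i) = coprod.inl := by
    intro i
    rw [hρ, if_pos rfl]
    exact e.hom_inv_id_assoc _
  have h2 : ∀ i l : Fin n, l ≠ i → e.hom ≫ Sigma.ι (fun _ : Fin n => Y) l ≫ coprod.inl ≫
      finMap Y (FinPt.rho n i) = toBase _ ≫ coprod.inr := by
    intro i l hl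
    rw [hρ, if_neg fun h => hl (Option.some_injective _ h)]
    have h3 : e.hom ≫ toBase Y = toBase _ := Over.mkIdTerminal.hom_ext _ _
    rw [← h3, Category.assoc]
    rfl
  exact isDecomposition_of_iso (Sigma.mapIso fun _ => e)
    (fun j => (Sigma.ι_map (fun _ : Fin n => e.hom) j).symm)
    (fun j => (Category.assoc _ _ _).trans (h1 j))
    fun j l hl => (Category.assoc _ _ _).trans (h2 j l hl)

end Coproducts

/-! ### Products of presheaves -/

section Products

variable {S : Scheme.{u}} {k : ℕ}

/-- A functor to types that preserves the product takes it to the product of types. -/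
theorem bijective_map_pi_π {C : Type*} [Category* C] (G : C ⥤ Type*) (F : Fin k → C) [HasProduct F]
    [PreservesLimit (Discrete.functor F) G] :
    Function.Bijective fun (x : G.obj (∏ᶜ F)) j => G.map (Pi.π F j) x := by
  have h := (Types.isLimit_iff _).mp ⟨isLimitOfPreserves G (limit.isLimit (Discrete.functor F))⟩
  have h' : ∀ y : ∀ j, G.obj (F j), ∃! x : G.obj (∏ᶜ F), ∀ j : Discrete (Fin k),
      G.map (Pi.π F j.as) x = y j.as := fun y =>
    h (fun j => y j.as) (by
      rintro ⟨i⟩ ⟨j⟩ ⟨⟨f⟩⟩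
      obtain rfl : i = j := f
      exact congr($((Discrete.functor F ⋙ G).map_id ⟨i⟩) (y i)))
  refine ⟨fun x x' e => ?_, fun y => ?_⟩
  · exact (h' fun j => G.map (Pi.π F j) x').unique (fun j => congrFun e j.as) fun _ => rfl
  · obtain ⟨x, hx, -⟩ := h' y
    exact ⟨x, funext fun j => hx ⟨j⟩⟩

variable (X : Over S) {W : SchPt S} {V : Fin k → SchPt S}
  {p : ∀ j, W ⟶ V j} {q : ∀ j, (V j).sch ⟶ W.sch}

/-- The comparison map to any simplicial set `B` that is a product of the
`h^{nfr}_S(V_j)(X × Δ^•)` through maps `π_j` is a weak equivalence. -/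
theorem IsDecomposition.isWeakEquivalence_of_bijective (H : IsDecomposition p q) {B : SSet.{u + 1}}
    (π : ∀ j, B ⟶ corrSimplices X (V j))
    (hπ : ∀ m, Function.Bijective fun (x : B.obj m) j => (π j).app m x)
    (f : corrSimplices X W ⟶ B)
    (hf : ∀ j, f ≫ π j = Functor.whiskerLeft (prodSimplex X).op ((hnfr S).map (p j))) :
    IsWeakEquivalence f := by
  let e : B ⟶ prodCorr X V :=
    { app := fun m => ↾fun x j => (π j).app m x
      naturality := fun m l a => by
        refine ConcreteCategory.hom_ext _ _ fun x => funext fun j => ?_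
        exact (congr($((π j).naturality a) x)).trans (corrSimplices_map X a _) }
  have he : IsIso e := by
    rw [NatTrans.isIso_iff_isIso_app]
    exact fun m => (isIso_iff_bijective _).mpr (hπ m)
  refine IsWeakEquivalence.of_comp_iso e ?_
  have hfe : f ≫ e = toProdCorr X p := by
    refine NatTrans.ext (funext fun m => ConcreteCategory.hom_ext _ _ fun x => funext fun j => ?_)
    refine (congr(($(hf j)).app m x)).trans ?_
    change _ = stableMap (𝟙 _) (p j) x
    unfold stableMap
    rw [op_id, CategoryTheory.Functor.map_id]
    rfl
  rw [hfe]
  exact H.isWeakEquivalence X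

theorem isLhtpEquivalence_hnfrToProd (Y : Fin k → Over S) :
    IsLhtpEquivalence (hnfrToProd Y) := by
  intro X
  refine (isDecomposition_collapse Y).isWeakEquivalence_of_bijective X
    (fun j => ((Lhtp S).map (Pi.π (fun j => (hnfr S).obj (SchPt.of (Y j))) j)).app (op X))
    (fun m => ?_) _ fun j => ?_
  · exact bijective_map_pi_π ((evaluation _ _).obj (op ((prodSimplex X).obj m.unop)))
      fun j => (hnfr S).obj (SchPt.of (Y j))
  · refine (congr(($((Lhtp S).map_comp (hnfrToProd Y) (Pi.π _ j))).app (op X))).symm.trans ?_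
    rw [hnfrToProd, Pi.lift_π]
    rfl

theorem isEInfinityObject_hnfr (Y : Over S) :
    IsEInfinityObject (finPower Y ⋙ hnfr S ⋙ Lhtp S) := by
  intro n X
  let A := finPower Y ⋙ hnfr S ⋙ Lhtp S
  refine (isDecomposition_rho Y n).isWeakEquivalence_of_bijective X
    (fun j => (Pi.π (fun _ : Fin n => A.obj (FinPt.mk 1)) j).app (op X)) (fun m => ?_) _
    fun j => ?_
  · exact bijective_map_pi_π ((evaluation _ _).obj (op X) ⋙ (evaluation _ _).obj m)
      fun _ : Fin n => A.obj (FinPt.mk 1)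
  · refine (NatTrans.comp_app _ _ _).symm.trans ?_
    rw [Pi.lift_π]
    rfl

end Products

end

end NormalFraming

theorem mainTheorem10 (S : Scheme.{u}) :
    (∀ (k : ℕ) (Y : Fin k → Over S),
      NormalFraming.IsLhtpEquivalence (NormalFraming.hnfrToProd Y)) ∧
    (∀ Y : Over S, NormalFraming.IsEInfinityObject
      (NormalFraming.finPower Y ⋙ NormalFraming.hnfr S ⋙ NormalFraming.Lhtp S)) :=
  ⟨fun _ Y => NormalFraming.isLhtpEquivalence_hnfrToProd Y,
    fun Y => NormalFraming.isEInfinityObject_hnfr Y⟩
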